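/- **Setting.** A tree network $Q$ is a finite combinatorial tree, each of whose arcs has a positive length; it has no nodes of degree two and is neither a single node nor a line segment. Each arc is identified with an open interval of that length, so that $Q$ (arcs together with nodes) is a metric space with the shortest-path metric $d$ and carries the length measure $\lambda$; put $\mu=\lambda(Q)$. Points in the interior of an arc are called regular. A leaf node is a node of degree one, and its adjacent arc is a leaf arc. A unit speed path is one satisfying $d(S(t),S(t'))\le|t-t'|$. **Game.** Let $0<\alpha<2\mu$. The Patroller chooses a patrol, i.e. a unit speed path $S:[0,\infty)\to Q$; the Attacker chooses a point $x\in Q$ and a starting time $\tau\ge 0$. The attack is intercepted if $S(t)=x$ for some $t\in[\tau,\tau+\alpha]$. The Patroller maximizes and the Attacker minimizes the probability of interception; mixed strategies are probability measures on patrols and on attacks. **Extremity set.** $E$ is the set of regular points $x$ such that one of the two connected components of $Q\setminus\{x\}$ has length less than $\alpha/2$. The pair $(Q,\alpha)$ satisfies the *Leaf Condition* if $E$ consists exactly of the points in the interior of a leaf arc at distance less than $\alpha/2$ from the leaf node of that arc. **$E$-patrolling strategies.** A tour is a closed unit speed path that visits all points of $Q$; a Chinese Postman Tour (CPT) is a tour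 of minimum length. For a closed unit speed path $T$ of length $L$, its randomized periodic extension is the patrol $t\mapsto T((t+\Delta)\bmod L)$ with $\Delta$ uniform in $[0,L]$. An $E$-patrolling strategy is the randomized periodic extension of a closed unit speed path $S^E$ obtained as follows. If $\bar E=Q$, then $S^E$ is any CPT. If $\bar E\ne Q$, take a CPT $S$ that starts at a regular point outside $\bar E$ and that, upon its first arrival at each connected component $K$ of $\bar E$, tours $K$ in a single closed path $C_K$ with image $K$ and of length $2\lambda(K)$. For every component $K$ insert a second copy of $C_K$ into $S$: immediately after the first one if $\lambda(K)\ge\alpha/2$, and at the next time at which $S$ returns to $K$ after the first one if $\lambda(K)<\alpha/2$. **$E$-attack strategy.** For a leaf node $v$ let $e_v$ be the length of the component of $E$ whose closure contains $v$, and let $M=\max_v e_v$. With probability $\lambda(E^c)/(\mu+\lambda(E))$ attack a uniformly random point of $E^c$ at starting time $M$; for each leaf node $v$, with probability $2e_v/(\mu+\lambda(E))$ attack at $v$ at a starting time chosen uniformly in $[M-e_v,M+e_v]$. **Theorem.** Let $Q$ be a tree network and $0<\alpha<2\mu$, and suppose that $(Q,\alpha)$ satisfies the Leaf Condition. Then $E$-patrolling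 strategies exist and every $E$-patrolling strategy is optimal for the Patroller, the $E$-attack strategy is optimal for the Attacker, and the game has the value $$V=\frac{\alpha}{\mu+\lambda(E)}.$$ -/

import Mathlib

open MeasureTheory Set
open scoped NNReal ENNReal

/-- A tree network: a finite combinatorial tree, other than a single node or a line segment,
without nodes of degree two, together with a positive length for each arc. -/
structure TreeNetwork (V : Type*) [Fintype V] where
  graph : SimpleGraph V
  isTree : graph.IsTree
  two_lt_card : 2 < Fintype.card V
  degree_ne_two : ∀ v, (graph.neighborSet v).ncard ≠ 2
  len : graph.edgeSet → ℝ
  len_pos : ∀ e, 0 < len e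

namespace TreeNetwork

variable {V : Type*} [Fintype V] (Q : TreeNetwork V)

/-! ### The network as a metric space -/

/-- The arcs of the network. -/
abbrev Arc : Type _ := Q.graph.edgeSet

noncomputable instance : Fintype Q.Arc := Fintype.ofFinite _

/-- A point of the network: a node, or a point in the interior of an arc `e`, given by its
distance `s` from the end `tail e`, where `0 < s < len e`. -/
inductive Point where
  | node (v : V) : Point
  | inner (e : Q.Arc) (s : Ioo (0 : ℝ) (Q.len e)) : Point

variable {Q}

/-- The end of the arc `e` from which positions on `e` are measured (an arbitrary choice). -/
noncomputable def tail (e : Q.Arc) : V := (Quot.out e.1).1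

/-- The other end of the arc `e`. -/
noncomputable def head (e : Q.Arc) : V := (Quot.out e.1).2

/-- The node `v` is on the side of the head of `e` once `e` is removed from the tree. -/
def HeadSide (e : Q.Arc) (v : V) : Prop :=
  (Q.graph.deleteEdges {e.1}).Reachable (head e) v

open Classical in
/-- Position, measured from the tail of `e`, of the point of the closed arc `e` that is closest to
the given node. -/
noncomputable def nodeCoord (e : Q.Arc) (v : V) : ℝ := if HeadSide e v then Q.len e else 0

open Classical in
/-- Position, measured from the tail of `e`, of the point of the closed arc `e` that is closest to
the given point. -/
noncomputable def coord (e : Q.Arc) : Q.Point → ℝ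
  | .node v => nodeCoord e v
  | .inner e' s => if e' = e then (s : ℝ) else nodeCoord e (tail e')

theorem mk_tail_head (e : Q.Arc) : s(tail e, head e) = e.1 := Quot.out_eq e.1

theorem adj_tail_head (e : Q.Arc) : Q.graph.Adj (tail e) (head e) := by
  have h := e.2
  rw [← mk_tail_head e] at h
  exact h

theorem headSide_head (e : Q.Arc) : HeadSide e (head e) := SimpleGraph.Reachable.refl _

theorem not_headSide_tail (e : Q.Arc) : ¬ HeadSide e (tail e) := by
  intro h
  have hb := SimpleGraph.isAcyclic_iff_forall_isBridge.1 Q.isTree.isAcyclic e.2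
  rw [← mk_tail_head e, SimpleGraph.isBridge_iff, mk_tail_head] at hb
  exact hb h.symm

theorem headSide_congr {e : Q.Arc} {u v : V} (h : Q.graph.Adj u v) (he : s(u, v) ≠ e.1) :
    HeadSide e u ↔ HeadSide e v := by
  have h1 : (Q.graph.deleteEdges {e.1}).Reachable u v :=
    SimpleGraph.Adj.reachable (by simpa [SimpleGraph.deleteEdges_adj] using ⟨h, he⟩)
  exact ⟨fun hu => hu.trans h1, fun hv => hv.trans h1.symm⟩

theorem headSide_ends_congr {e e' : Q.Arc} (h : e' ≠ e) :
    HeadSide e (tail e') ↔ HeadSide e (head e') :=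
  headSide_congr (adj_tail_head e') (by rw [mk_tail_head]; exact fun h' => h (Subtype.ext h'))

theorem exists_headSide_ne {u v : V} (huv : u ≠ v) :
    ∃ e : Q.Arc, ¬ (HeadSide e u ↔ HeadSide e v) := by
  by_contra! hall
  obtain ⟨p, hp⟩ := Q.isTree.connected.exists_isPath u v
  cases p with
  | nil => exact huv rfl
  | @cons _ w _ hadj p =>
    set e : Q.Arc := ⟨s(u, w), hadj⟩ with he
    have hnot : s(u, w) ∉ p.edges := by
      intro hmem
      exact ((SimpleGraph.Walk.cons_isPath_iff _ _).1 hp).2 (p.fst_mem_support_of_mem_edges hmem)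
    have hwv : (Q.graph.deleteEdges {e.1}).Reachable w v :=
      ⟨p.toDeleteEdges {s(u, w)} (by
        intro e' he' h
        rw [mem_singleton_iff] at h
        exact hnot (h ▸ he'))⟩
    have hs : s(tail e, head e) = s(u, w) := mk_tail_head e
    rcases Sym2.eq_iff.1 hs with ⟨h1, h2⟩ | ⟨h1, h2⟩
    · have a : HeadSide e v := by
        unfold HeadSide; rw [h2]; exact hwv
      have b := not_headSide_tail e
      rw [h1] at b
      exact b ((hall e).2 a)
    · have a : HeadSide e u := h2 ▸ headSide_head e
      have b := not_headSide_tail e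
      rw [h1] at b
      exact b (((hall e).1 a).trans hwv.symm)

theorem coord_inner_self (e : Q.Arc) (s : Ioo (0 : ℝ) (Q.len e)) : coord e (.inner e s) = s := by
  simp [coord]

theorem coord_inner_ne {e e' : Q.Arc} (h : e' ≠ e) (s : Ioo (0 : ℝ) (Q.len e')) :
    coord e (.inner e' s) = nodeCoord e (tail e') := by
  simp [coord, h]

theorem nodeCoord_eq (e : Q.Arc) (v : V) : nodeCoord e v = 0 ∨ nodeCoord e v = Q.len e := by
  unfold nodeCoord; split_ifs <;> simp

theorem coord_injective {x y : Q.Point} (h : ∀ e, coord e x = coord e y) : x = y := by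
  have key : ∀ (e : Q.Arc) (s : Ioo (0 : ℝ) (Q.len e)) (v : V), (s : ℝ) ≠ nodeCoord e v := by
    intro e s v hs
    rcases nodeCoord_eq e v with h' | h'
    · exact s.2.1.ne' (hs.trans h')
    · exact s.2.2.ne (hs.trans h')
  cases x with
  | node u =>
    cases y with
    | node v =>
      by_contra hne
      obtain ⟨e, he⟩ := exists_headSide_ne (Q := Q) (u := u) (v := v) (fun h' => hne (by rw [h']))
      have := h e
      have hl := Q.len_pos e
      simp only [coord, nodeCoord] at this
      split_ifs at this <;> first | linarith | tauto
    | inner e s => exact absurd ((coord_inner_self e s).symm.trans (h e).symm) (key e s u)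
  | inner e s =>
    cases y with
    | node v => exact absurd ((coord_inner_self e s).symm.trans (h e)) (key e s v)
    | inner e' s' =>
      by_cases hee : e' = e
      · subst hee
        have := h e'
        rw [coord_inner_self, coord_inner_self] at this
        rw [Subtype.ext this]
      · have := h e
        rw [coord_inner_self, coord_inner_ne hee] at this
        exact absurd this (key e s _)

/-- The distance `d (x, y)` is the length of the unique simple path of the tree from `x` to `y`.
That path covers, on each closed arc `e`, exactly the segment between the positions `coord e x`
and `coord e y`. -/
noncomputable instance : MetricSpace Q.Point where
  dist x y := ∑ e : Q.Arc, |coord e x - coord e y|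
  dist_self x := by simp
  dist_comm x y := by simp only [abs_sub_comm]
  dist_triangle x y z := by
    rw [← Finset.sum_add_distrib]
    exact Finset.sum_le_sum fun e _ => abs_sub_le _ _ _
  eq_of_dist_eq_zero {x y} h := by
    refine coord_injective fun e => ?_
    have h' : ∑ e : Q.Arc, |coord e x - coord e y| = 0 := h
    have := (Finset.sum_eq_zero_iff_of_nonneg fun e _ => abs_nonneg _).1 h' e (Finset.mem_univ e)
    exact sub_eq_zero.1 (abs_eq_zero.1 this)

theorem dist_eq (x y : Q.Point) : dist x y = ∑ e : Q.Arc, |coord e x - coord e y| := rfl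

noncomputable instance : MeasurableSpace Q.Point := borel _

instance : BorelSpace Q.Point := ⟨rfl⟩

/-! ### Length -/

open Classical in
/-- The parametrization by `[0, len e]` of the closed arc `e`, from its tail to its head. -/
noncomputable def onArc (e : Q.Arc) (t : ℝ) : Q.Point :=
  if h : t ∈ Ioo 0 (Q.len e) then .inner e ⟨t, h⟩
  else if t ≤ 0 then .node (tail e) else .node (head e)

theorem coord_onArc_self (e : Q.Arc) (t : ℝ) : coord e (onArc e t) = max 0 (min t (Q.len e)) := by
  have hl := Q.len_pos e
  unfold onArc
  split_ifs with h1 h2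
  · rw [coord_inner_self, min_eq_left h1.2.le, max_eq_right h1.1.le]
  · rw [max_eq_left ((min_le_left _ _).trans h2)]
    simp [coord, nodeCoord, not_headSide_tail]
  · have h3 : Q.len e ≤ t := by
      by_contra h4
      exact h1 ⟨not_le.1 h2, not_le.1 h4⟩
    rw [min_eq_right h3, max_eq_right hl.le]
    simp [coord, nodeCoord, headSide_head]

theorem coord_onArc_ne {e e' : Q.Arc} (h : e' ≠ e) (t : ℝ) :
    coord e (onArc e' t) = nodeCoord e (tail e') := by
  unfold onArc
  split_ifs with h1 h2
  · exact coord_inner_ne h _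
  · rfl
  · have h3 := headSide_ends_congr h
    by_cases h4 : HeadSide e (tail e')
    · simp [coord, nodeCoord, h4, h3.1 h4]
    · simp [coord, nodeCoord, h4, mt h3.2 h4]

/-- Each closed arc is isometric to an interval. -/
theorem dist_onArc (e : Q.Arc) {s t : ℝ} (hs : s ∈ Icc 0 (Q.len e)) (ht : t ∈ Icc 0 (Q.len e)) :
    dist (onArc e s) (onArc e t) = |s - t| := by
  rw [dist_eq, Finset.sum_eq_single e]
  · rw [coord_onArc_self, coord_onArc_self, min_eq_left hs.2, min_eq_left ht.2, max_eq_right hs.1,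
      max_eq_right ht.1]
  · intro e' _ hne
    rw [coord_onArc_ne hne.symm, coord_onArc_ne hne.symm]; simp
  · simp

theorem continuous_onArc (e : Q.Arc) : Continuous (onArc e) := by
  rw [continuous_iff_continuousAt]
  intro t
  rw [ContinuousAt, tendsto_iff_dist_tendsto_zero]
  have hd : ∀ s, dist (onArc e s) (onArc e t) =
      |max 0 (min s (Q.len e)) - max 0 (min t (Q.len e))| := by
    intro s
    rw [dist_eq, Finset.sum_eq_single e]
    · rw [coord_onArc_self, coord_onArc_self]
    · intro e' _ hne
      rw [coord_onArc_ne hne.symm, coord_onArc_ne hne.symm]; simp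
    · simp
  simp only [hd]
  have hc : Continuous fun s : ℝ => |max 0 (min s (Q.len e)) - max 0 (min t (Q.len e))| := by
    fun_prop
  simpa using hc.tendsto t

theorem measurable_onArc (e : Q.Arc) : Measurable (onArc e) := (continuous_onArc e).measurable

variable (Q) in
/-- The length measure `λ` of the network: Lebesgue measure on each arc. -/
noncomputable def length : Measure Q.Point :=
  ∑ e : Q.Arc, (volume.restrict (Ioo 0 (Q.len e))).map (onArc e)

variable (Q) in
/-- The total length `μ = λ(Q)`. -/
noncomputable def totalLength : ℝ := Q.length.real univ

variable (Q) in
/-- A leaf node: a node of degree one. -/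
def IsLeaf (v : V) : Prop := (Q.graph.neighborSet v).ncard = 1

/-- A regular point: an interior point of an arc. -/
def IsRegular (x : Q.Point) : Prop := ∃ e s, x = .inner e s

/-! ### The extremity set -/

variable (Q) in
/-- The extremity set `E`: the regular points `x` such that one of the connected components of
`Q - {x}` has length less than `α / 2`. -/
def extremitySet (α : ℝ) : Set Q.Point :=
  {x | IsRegular x ∧ ∃ y, y ≠ x ∧ Q.length.real (connectedComponentIn {x}ᶜ y) < α / 2}

variable (Q) in
/-- The Leaf Condition: `E` consists of all points on every leaf arc within distance `α / 2` of its
leaf node. -/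
def LeafCondition (α : ℝ) : Prop :=
  Q.extremitySet α =
    {x | ∃ (v : V) (e : Q.Arc) (s : Ioo (0 : ℝ) (Q.len e)),
      Q.IsLeaf v ∧ v ∈ e.1 ∧ x = .inner e s ∧ dist x (.node v) < α / 2}

/-! ### The game -/

variable (Q) in
/-- A patrol: a unit speed path `S (t)`, `t ≥ 0`. -/
abbrev Patrol : Type _ := {S : ℝ≥0 → Q.Point // LipschitzWith 1 S}

variable (Q) in
/-- A pure attack: the attacked point and the starting time of the attack. -/
abbrev Attack : Type _ := Q.Point × ℝ≥0

/-- The patrol visits the attacked point during the attack interval `[τ, τ + α]`. -/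
def Intercepts (α : ℝ) (S : Q.Patrol) (a : Q.Attack) : Prop :=
  ∃ t : ℝ≥0, (a.2 : ℝ) ≤ t ∧ (t : ℝ) ≤ a.2 + α ∧ S.1 t = a.1

/-- The probability of interception when the patrol has law `σ` and the attack, independent of it,
has law `ρ`. -/
noncomputable def payoff (α : ℝ) (σ : Measure Q.Patrol) (ρ : Measure Q.Attack) : ℝ≥0∞ :=
  (σ.prod ρ) {p | Intercepts α p.1 p.2}

/-- The interception probability that a mixed patrol guarantees. -/
noncomputable def patrolGuarantee (α : ℝ) (σ : Measure Q.Patrol) : ℝ≥0∞ :=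
  ⨅ ρ : ProbabilityMeasure Q.Attack, payoff α σ ρ

/-- The upper bound on the interception probability that a mixed attack guarantees. -/
noncomputable def attackGuarantee (α : ℝ) (ρ : Measure Q.Attack) : ℝ≥0∞ :=
  ⨆ σ : ProbabilityMeasure Q.Patrol, payoff α σ ρ

variable (Q) in
/-- `w` is the value of the game `(Q, α)` in mixed strategies. -/
def IsValue (α w : ℝ) : Prop :=
  (⨆ σ : ProbabilityMeasure Q.Patrol, patrolGuarantee α (σ : Measure Q.Patrol)) = ENNReal.ofReal w ∧
  (⨅ ρ : ProbabilityMeasure Q.Attack, attackGuarantee α (ρ : Measure Q.Attack)) = ENNReal.ofReal w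

/-- `σ` is an optimal mixed strategy of the Patroller. -/
def PatrollerOptimal (α : ℝ) (σ : Measure Q.Patrol) : Prop :=
  IsProbabilityMeasure σ ∧
  ∀ σ' : ProbabilityMeasure Q.Patrol, patrolGuarantee α (σ' : Measure Q.Patrol) ≤ patrolGuarantee α σ

/-- `ρ` is an optimal mixed strategy of the Attacker. -/
def AttackerOptimal (α : ℝ) (ρ : Measure Q.Attack) : Prop :=
  IsProbabilityMeasure ρ ∧
  ∀ ρ' : ProbabilityMeasure Q.Attack, attackGuarantee α ρ ≤ attackGuarantee α (ρ' : Measure Q.Attack)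

/-! ### Closed paths and patrolling strategies -/

variable (Q) in
/-- A closed unit speed path `[0, L] → Q`, `L > 0`, given by its `L`-periodic extension to `ℝ`. -/
structure ClosedPath where
  L : ℝ
  L_pos : 0 < L
  toFun : ℝ → Q.Point
  lipschitz : LipschitzWith 1 toFun
  periodic : Function.Periodic toFun L

/-- A tour: a closed path that visits all points. -/
def ClosedPath.IsTour (S : Q.ClosedPath) : Prop := range S.toFun = univ

/-- A Chinese Postman Tour: a tour of minimum length. -/
def ClosedPath.IsCPT (S : Q.ClosedPath) : Prop :=
  S.IsTour ∧ ∀ S' : Q.ClosedPath, S'.IsTour → S.L ≤ S'.L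

/-- The periodic patrol `S_Δ (t) = S (t + Δ mod L)`. -/
noncomputable def ClosedPath.patrol (S : Q.ClosedPath) (Δ : ℝ) : Q.Patrol :=
  ⟨fun t => S.toFun (t + Δ), LipschitzWith.of_dist_le_mul fun s t => by
    simpa [NNReal.dist_eq, Real.dist_eq] using S.lipschitz.dist_le_mul (s + Δ) (t + Δ)⟩

/-- The randomized periodic extension: the patrol `S_Δ` with `Δ` uniform in `[0, L]`. -/
noncomputable def ClosedPath.randomExtension (S : Q.ClosedPath) : Measure Q.Patrol :=
  (ProbabilityTheory.cond volume (Icc 0 S.L)).map S.patrol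

variable (Q) in
/-- The connected components of the closure of the extremity set. -/
def closureComponents (α : ℝ) : Set (Set Q.Point) :=
  {K | ∃ x ∈ closure (Q.extremitySet α), K = connectedComponentIn (closure (Q.extremitySet α)) x}

/-- The closed path `T` arises by the following construction from a Chinese Postman Tour `S` that
starts at a regular point outside the closure of `E`.

For each component `K` of the closure of `E`, `t₁ K` is the time when `S` first arrives at `K`, and
`S` tours `K` from then on, during `[t₁ K, t₁ K + 2 λ(K)]`, in a single closed path `C_K` of length
`2 λ(K)`. A second copy of `C_K` is inserted into `S` at the time `τ K`, which is the end of the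
first copy if `α / 2 ≤ λ(K)`, and the time of the next return of `S` to `K` otherwise.

Time `t` of `S` becomes time `θ t` of `T`: the inserted copies that come before are added. -/
def IsEExpansion (α : ℝ) (S T : Q.ClosedPath) : Prop :=
  S.IsCPT ∧ IsRegular (S.toFun 0) ∧ S.toFun 0 ∉ closure (Q.extremitySet α) ∧
  ∃ t₁ τ : Set Q.Point → ℝ,
    (∀ K ∈ Q.closureComponents α,
      IsLeast {t | 0 ≤ t ∧ S.toFun t ∈ K} (t₁ K) ∧
      S.toFun '' Icc (t₁ K) (t₁ K + 2 * Q.length.real K) = K ∧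
      S.toFun (t₁ K + 2 * Q.length.real K) = S.toFun (t₁ K) ∧
      (α / 2 ≤ Q.length.real K → τ K = t₁ K + 2 * Q.length.real K) ∧
      (Q.length.real K < α / 2 →
        IsLeast {t | t₁ K + 2 * Q.length.real K < t ∧ t ≤ S.L ∧ S.toFun t ∈ K} (τ K))) ∧
    ∃ θ : ℝ → ℝ,
      (∀ t, θ t = t + ∑ᶠ K ∈ {K ∈ Q.closureComponents α | τ K < t}, 2 * Q.length.real K) ∧
      T.L = θ S.L ∧
      (∀ t ∈ Icc 0 S.L, T.toFun (θ t) = S.toFun t) ∧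
      ∀ K ∈ Q.closureComponents α, ∀ s ∈ Icc 0 (2 * Q.length.real K),
        T.toFun (θ (τ K) + s) = S.toFun (t₁ K + s)

/-- `T` is a closed path `S^E` whose randomized periodic extension is an `E`-patrolling strategy:
any Chinese Postman Tour if the closure of `E` is all of `Q`, and a path given by the construction
above otherwise. -/
def IsEPatrollingTour (α : ℝ) (T : Q.ClosedPath) : Prop :=
  (closure (Q.extremitySet α) = univ → T.IsCPT) ∧
  (closure (Q.extremitySet α) ≠ univ → ∃ S : Q.ClosedPath, IsEExpansion α S T)

variable (Q) in
/-- The mixed strategy `σ` is an `E`-patrolling strategy. -/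
def IsEPatrollingStrategy (α : ℝ) (σ : Measure Q.Patrol) : Prop :=
  ∃ T : Q.ClosedPath, IsEPatrollingTour α T ∧ σ = T.randomExtension

/-! ### The attack strategy -/

variable (Q) in
/-- The component of the extremity set whose closure contains the leaf node `v`. -/
def leafComponent (α : ℝ) (v : V) : Set Q.Point :=
  {x ∈ Q.extremitySet α | .node v ∈ closure (connectedComponentIn (Q.extremitySet α) x)}

variable (Q) in
/-- The length `e_v` of the component of the extremity set at the leaf node `v`. -/
noncomputable def leafLength (α : ℝ) (v : V) : ℝ := Q.length.real (Q.leafComponent α v)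

variable (Q) in
/-- The largest of the lengths `e_v`, over the leaf nodes `v`. -/
noncomputable def maxLeafLength (α : ℝ) : ℝ := ⨆ v : {v // Q.IsLeaf v}, Q.leafLength α v

noncomputable instance : Fintype {v // Q.IsLeaf v} := Fintype.ofFinite _

variable (Q) in
/-- The `E`-attack strategy: with probability `λ(Eᶜ) / (μ + λ(E))`, attack a uniformly random point
of `Eᶜ` at time `M`; for each leaf node `v`, with probability `2 e_v / (μ + λ(E))`, attack at `v` at
a start time chosen uniformly in `[M - e_v, M + e_v]`. Here `M` is the largest of the `e_v`. -/
noncomputable def eAttack (α : ℝ) : Measure Q.Attack :=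
  let E := Q.extremitySet α
  let M := Q.maxLeafLength α
  let N := Q.totalLength + Q.length.real E
  ENNReal.ofReal (Q.length.real Eᶜ / N) •
      (ProbabilityTheory.cond Q.length Eᶜ).prod (Measure.dirac M.toNNReal) +
    ∑ v : {v // Q.IsLeaf v}, ENNReal.ofReal (2 * Q.leafLength α v / N) •
      (Measure.dirac (Point.node v.1)).prod
        ((ProbabilityTheory.cond volume
          (Icc (M - Q.leafLength α v) (M + Q.leafLength α v))).map Real.toNNReal)

end TreeNetwork

/-! Both players' guarantees compare measures of sets of times. Write N = μ + λ(E).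

Attacker. Fix a patrol. N times its probability of intercepting the attack is at most the length of
Eᶜ that it covers during [M, M + α] plus, for each leaf node v, the measure of the starting times in
[M - e_v, M + e_v] whose attack at v is met. The first term is at most the time spent in Eᶜ. By
`volume_gain_le` each other term is at most the part of [M, M + α] lying within e_v of a visit to v,
when the patrol is at distance less than e_v from v. Up to finitely many points these places are
disjoint, so the sum is at most α (`attack_gain_le`).

Patroller. Against an attack at x, a random translate of a closed path T of length L succeeds with
probability |H| / L, where H is one period of `T.hitting α x`. If closure E = Q, then N = 2μ = L,
and a single visit to x gives |H| ≥ α. Otherwise L ≤ 2N, and it suffices that H is everything or |H|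
≥ 2α (`IsEExpansion.guarantee`). For x outside E and not a leaf node, cut Q at x into two open
pieces. A piece C contributes α to H: if every time spent in C belongs to H, because a tour spends
at least 2λ(C) ≥ α there; if some time in C is missed, because the last α units before the next
visit to x are spent in C. For x in a component K of closure E, the inserted copy of the tour of K
yields two visits that are at least α apart in both directions around the cycle. If λ(K) ≥ α/2 the
copy itself takes that long. If λ(K) < α/2, then K is a bunch of whole leaf arcs at one node w, and
between the two copies the tour explores a branch at w of length at least α/2. This rests on
rigidity: a tour of length 2μ spends exactly 2λ(A) in every A, hence enters each branch only once
(`IsTour.ordConnected_excursion`).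

Existence. A loop around Q without its arms is built arc by arc; the arms are inserted at the first
arrival at their inner ends, which gives a tour of length 2μ, and then the second copies are
inserted. A small component is revisited because what lies outside any one branch at w is longer
than K (`IsTour.exists_return`). -/

namespace TreeNetwork

variable {V : Type*} [Fintype V] {Q : TreeNetwork V}

/-! ### Coordinates, rays and branches -/

theorem mem_arc_iff {u : V} {e : Q.Arc} : u ∈ e.1 ↔ u = tail e ∨ u = head e := by
  rw [← mk_tail_head e, Sym2.mem_iff]

theorem tail_mem (e : Q.Arc) : tail e ∈ e.1 := mem_arc_iff.2 (Or.inl rfl)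

theorem head_mem (e : Q.Arc) : head e ∈ e.1 := mem_arc_iff.2 (Or.inr rfl)

theorem nodeCoord_head (e : Q.Arc) : nodeCoord e (head e) = Q.len e := by
  simp [nodeCoord, headSide_head]

theorem nodeCoord_tail (e : Q.Arc) : nodeCoord e (tail e) = 0 := by
  simp [nodeCoord, not_headSide_tail]

theorem nodeCoord_eq_iff {e : Q.Arc} {u v : V} :
    nodeCoord e u = nodeCoord e v ↔ (HeadSide e u ↔ HeadSide e v) := by
  have hl := Q.len_pos e
  unfold nodeCoord
  by_cases hu : HeadSide e u <;> by_cases hv : HeadSide e v <;> simp [hu, hv, hl.ne, hl.ne']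

theorem nodeCoord_eq_of_mem {e f : Q.Arc} (h : e ≠ f) {u v : V} (hu : u ∈ e.1) (hv : v ∈ e.1) :
    nodeCoord f u = nodeCoord f v := by
  have h1 := headSide_ends_congr h
  rw [nodeCoord_eq_iff]
  rcases mem_arc_iff.1 hu with rfl | rfl <;> rcases mem_arc_iff.1 hv with rfl | rfl <;> tauto

theorem coord_node (e : Q.Arc) (v : V) : coord e (.node v) = nodeCoord e v := rfl

theorem nodeCoord_mem_Icc (e : Q.Arc) (v : V) : nodeCoord e v ∈ Icc 0 (Q.len e) := by
  have hl := Q.len_pos e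
  rcases nodeCoord_eq e v with h | h <;> simp [h, hl.le]

theorem coord_mem_Icc (e : Q.Arc) (x : Q.Point) : coord e x ∈ Icc 0 (Q.len e) := by
  cases x with
  | node v => exact nodeCoord_mem_Icc e v
  | inner e' s =>
    by_cases h : e' = e
    · subst h
      rw [coord_inner_self]
      exact ⟨s.2.1.le, s.2.2.le⟩
    · rw [coord_inner_ne h]
      exact nodeCoord_mem_Icc e _

theorem abs_coord_sub_le_dist (e : Q.Arc) (x y : Q.Point) : |coord e x - coord e y| ≤ dist x y := by
  rw [dist_eq]
  exact Finset.single_le_sum (f := fun e => |coord e x - coord e y|) (fun _ _ => abs_nonneg _)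
    (Finset.mem_univ e)

theorem lipschitz_coord (e : Q.Arc) : LipschitzWith 1 (coord e : Q.Point → ℝ) :=
  LipschitzWith.of_dist_le_mul fun x y => by
    simpa [Real.dist_eq] using abs_coord_sub_le_dist e x y

theorem continuous_coord (e : Q.Arc) : Continuous (coord e : Q.Point → ℝ) :=
  (lipschitz_coord e).continuous

theorem onArc_of_mem {e : Q.Arc} {t : ℝ} (h : t ∈ Ioo 0 (Q.len e)) :
    (onArc e t : Q.Point) = .inner e ⟨t, h⟩ := by simp [onArc, h]

theorem exists_eq_inner_of_coord {e : Q.Arc} {x : Q.Point} (h : coord e x ∈ Ioo 0 (Q.len e)) :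
    ∃ s, x = .inner e s := by
  have key : ∀ v, nodeCoord e v ∉ Ioo 0 (Q.len e) := by
    intro v hv
    rcases nodeCoord_eq e v with h' | h' <;> simp [h'] at hv
  cases x with
  | node v => exact absurd h (key v)
  | inner e' s =>
    by_cases hee : e' = e
    · subst hee; exact ⟨s, rfl⟩
    · rw [coord_inner_ne hee] at h
      exact absurd h (key _)

theorem onArc_coord {e : Q.Arc} {x : Q.Point} (h : coord e x ∈ Ioo 0 (Q.len e)) :
    onArc e (coord e x) = x := by
  obtain ⟨s, rfl⟩ := exists_eq_inner_of_coord h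
  rw [coord_inner_self, onArc_of_mem s.2]

theorem eq_of_coord_mem {e e' : Q.Arc} {x : Q.Point} (h : coord e x ∈ Ioo 0 (Q.len e))
    (h' : coord e' x ∈ Ioo 0 (Q.len e')) : e = e' := by
  obtain ⟨s, rfl⟩ := exists_eq_inner_of_coord h
  obtain ⟨s', hs⟩ := exists_eq_inner_of_coord h'
  injection hs

theorem coord_onArc {e : Q.Arc} {t : ℝ} (h : t ∈ Icc 0 (Q.len e)) : coord e (onArc e t) = t := by
  rw [coord_onArc_self, min_eq_left h.2, max_eq_right h.1]

theorem isRegular_iff {x : Q.Point} : IsRegular x ↔ ∃ e, coord e x ∈ Ioo 0 (Q.len e) := by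
  constructor
  · rintro ⟨e, s, rfl⟩
    exact ⟨e, by rw [coord_inner_self]; exact s.2⟩
  · rintro ⟨e, h⟩
    obtain ⟨s, hs⟩ := exists_eq_inner_of_coord h
    exact ⟨e, s, hs⟩

theorem headSide_iff_of_walk {e : Q.Arc} {u v : V} (p : Q.graph.Walk u v) (h : e.1 ∉ p.edges) :
    HeadSide e u ↔ HeadSide e v := by
  have h1 : (Q.graph.deleteEdges {e.1}).Reachable u v :=
    ⟨p.toDeleteEdges {e.1} fun e' he' h' => h (by rw [mem_singleton_iff] at h'; exact h' ▸ he')⟩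
  exact ⟨fun hu => hu.trans h1, fun hv => hv.trans h1.symm⟩

/-- The first arc of the path from `u` to `v` is the only arc at `u` that separates `u` from `v`. -/
theorem existsUnique_separating_arc {u v : V} (huv : u ≠ v) :
    ∃ e : Q.Arc, (u ∈ e.1 ∧ nodeCoord e u ≠ nodeCoord e v) ∧
      ∀ f : Q.Arc, u ∈ f.1 → nodeCoord f u ≠ nodeCoord f v → f = e := by
  obtain ⟨p, hp⟩ := Q.isTree.connected.exists_isPath u v
  cases p with
  | nil => exact absurd rfl huv
  | @cons _ w _ hadj p =>
    rw [SimpleGraph.Walk.cons_isPath_iff] at hp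
    have hnot : ∀ f : Q.Arc, u ∈ f.1 → f.1 ∉ p.edges := by
      intro f hf hmem
      exact hp.2 (p.mem_support_of_mem_edges hmem hf)
    refine ⟨⟨s(u, w), hadj⟩, ⟨by simp, ?_⟩, ?_⟩
    · set e : Q.Arc := ⟨s(u, w), hadj⟩ with he
      have h1 := headSide_iff_of_walk (e := e) p (hnot e (by simp [he]))
      rw [← nodeCoord_eq_iff] at h1
      rw [← h1]
      have hs : s(tail e, head e) = s(u, w) := mk_tail_head e
      have hl := Q.len_pos e
      rcases Sym2.eq_iff.1 hs with ⟨h2, h3⟩ | ⟨h2, h3⟩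
      · rw [← h2, ← h3, nodeCoord_head, nodeCoord_tail]; exact hl.ne
      · rw [← h2, ← h3, nodeCoord_head, nodeCoord_tail]; exact hl.ne'
    · intro f hf hne
      by_contra hfe
      apply hne
      rw [nodeCoord_eq_iff]
      refine headSide_iff_of_walk (SimpleGraph.Walk.cons hadj p) ?_
      rw [SimpleGraph.Walk.edges_cons, List.mem_cons]
      rintro (h | h)
      · exact hfe (Subtype.ext h)
      · exact hnot f hf h

/-! ### Depth functions, and the branches at a node. -/

/-- Distance from the node `u` along the closed arc `e`, of the point of `e` closest to `x`. -/
noncomputable def depth (u : V) (e : Q.Arc) (x : Q.Point) : ℝ := |coord e x - nodeCoord e u|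

theorem depth_nonneg (u : V) (e : Q.Arc) (x : Q.Point) : 0 ≤ depth u e x := abs_nonneg _

theorem depth_le (u : V) (e : Q.Arc) (x : Q.Point) : depth u e x ≤ Q.len e := by
  have h1 := coord_mem_Icc e x
  have h2 := nodeCoord_mem_Icc e u
  exact abs_le.2 ⟨by linarith [h1.1, h2.2], by linarith [h1.2, h2.1]⟩

theorem lipschitz_depth (u : V) (e : Q.Arc) : LipschitzWith 1 (depth u e : Q.Point → ℝ) :=
  LipschitzWith.of_dist_le_mul fun x y => by
    have h1 := abs_abs_sub_abs_le_abs_sub (coord e x - nodeCoord e u) (coord e y - nodeCoord e u)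
    rw [sub_sub_sub_cancel_right] at h1
    simpa [Real.dist_eq, depth] using h1.trans (abs_coord_sub_le_dist e x y)

theorem continuous_depth (u : V) (e : Q.Arc) : Continuous (depth u e : Q.Point → ℝ) :=
  (lipschitz_depth u e).continuous

theorem depth_node_self (u : V) (e : Q.Arc) : depth u e (.node u) = 0 := by
  simp [depth, coord_node]

theorem depth_node_of_mem {u w : V} {e : Q.Arc} (hu : u ∈ e.1) (hw : w ∈ e.1) (h : w ≠ u) :
    depth u e (.node w) = Q.len e := by
  have hl := Q.len_pos e
  rcases mem_arc_iff.1 hu with rfl | rfl <;> rcases mem_arc_iff.1 hw with rfl | rfl <;>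
    first
    | exact absurd rfl h
    | simp [depth, coord_node, nodeCoord_head, nodeCoord_tail, abs_of_pos hl]

/-- The points that the arc `e` separates from the node `w`. -/
def branch (w : V) (e : Q.Arc) : Set Q.Point := {x | 0 < depth w e x}

theorem isOpen_branch (w : V) (e : Q.Arc) : IsOpen (branch w e) :=
  isOpen_lt continuous_const (continuous_depth w e)

theorem depth_inner_of_not_mem {w : V} {e f : Q.Arc} (hw : w ∈ f.1) (hwe : w ∉ e.1)
    (s : Ioo (0 : ℝ) (Q.len e)) : depth w f (.inner e s) = depth w f (.node (tail e)) := by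
  have h : e ≠ f := by rintro rfl; exact hwe hw
  rw [depth, depth, coord_inner_ne h, coord_node]

theorem depth_inner_of_ne {w : V} {e f : Q.Arc} (hwe : w ∈ e.1) (h : e ≠ f)
    (s : Ioo (0 : ℝ) (Q.len e)) : depth w f (.inner e s) = 0 := by
  rw [depth, coord_inner_ne h, nodeCoord_eq_of_mem h (tail_mem e) hwe, sub_self, abs_zero]

/-- With `branch_unique`, this partitions the complement of `w` into the open branches of the arcs
at `w`. An interior point of an arc not at `w` is treated like the tail of that arc, since no arc at
`w` separates the two. -/
theorem exists_mem_branch {w : V} {x : Q.Point} (h : x ≠ .node w) :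
    ∃ e : Q.Arc, w ∈ e.1 ∧ x ∈ branch w e := by
  have hn : ∀ u, u ≠ w → ∃ e : Q.Arc, w ∈ e.1 ∧ Point.node u ∈ branch w e := by
    intro u hu
    obtain ⟨e, ⟨h1, h2⟩, -⟩ := existsUnique_separating_arc (Q := Q) hu.symm
    exact ⟨e, h1, abs_pos.2 (sub_ne_zero.2 h2.symm)⟩
  cases x with
  | node u => exact hn u fun h' => h (h' ▸ rfl)
  | inner e s =>
    by_cases hwe : w ∈ e.1
    · refine ⟨e, hwe, ?_⟩
      rw [branch, mem_ofPred_eq, depth, abs_pos, sub_ne_zero, coord_inner_self]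
      rcases nodeCoord_eq e w with h' | h' <;> rw [h']
      exacts [s.2.1.ne', s.2.2.ne]
    · obtain ⟨f, h1, h2⟩ := hn (tail e) (by rintro rfl; exact hwe (tail_mem e))
      refine ⟨f, h1, ?_⟩
      rw [branch, mem_ofPred_eq, depth_inner_of_not_mem h1 hwe]
      exact h2

theorem branch_unique {w : V} {e f : Q.Arc} (he : w ∈ e.1) (hf : w ∈ f.1) {x : Q.Point}
    (hxe : x ∈ branch w e) (hxf : x ∈ branch w f) : e = f := by
  have hn : ∀ u, Point.node u ∈ branch w e → Point.node u ∈ branch w f → e = f := by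
    intro u h1 h2
    have hu : w ≠ u := by
      rintro rfl
      exact h1.ne' (depth_node_self _ _)
    obtain ⟨g, -, h3⟩ := existsUnique_separating_arc (Q := Q) hu
    rw [h3 e he (sub_ne_zero.1 (abs_pos.1 h1)).symm, h3 f hf (sub_ne_zero.1 (abs_pos.1 h2)).symm]
  cases x with
  | node u => exact hn u hxe hxf
  | inner g s =>
    by_cases hwg : w ∈ g.1
    · by_cases h1 : g = e
      · by_cases h2 : g = f
        · exact h1 ▸ h2
        · exact absurd (depth_inner_of_ne hwg h2 s) hxf.ne'
      · exact absurd (depth_inner_of_ne hwg h1 s) hxe.ne'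
    · rw [branch, mem_ofPred_eq, depth_inner_of_not_mem he hwg] at hxe
      rw [branch, mem_ofPred_eq, depth_inner_of_not_mem hf hwg] at hxf
      exact hn _ hxe hxf

theorem node_not_mem_branch (w : V) (e : Q.Arc) : Point.node w ∉ branch w e :=
  fun h => h.ne' (depth_node_self w e)

/-! ### Arcs parametrized from a chosen end. -/

open Classical in
/-- The point of the arc `e` at distance `t` from its end `u`. -/
noncomputable def ray (u : V) (e : Q.Arc) (t : ℝ) : Q.Point :=
  if HeadSide e u then onArc e (Q.len e - t) else onArc e t

theorem continuous_ray (u : V) (e : Q.Arc) : Continuous (ray u e : ℝ → Q.Point) := by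
  unfold ray
  split_ifs
  · exact (continuous_onArc e).comp (by fun_prop)
  · exact continuous_onArc e

theorem dist_ray (u : V) (e : Q.Arc) {s t : ℝ} (hs : s ∈ Icc 0 (Q.len e))
    (ht : t ∈ Icc 0 (Q.len e)) : dist (ray u e s) (ray u e t) = |s - t| := by
  unfold ray
  split_ifs
  · rw [dist_onArc e ⟨by linarith [hs.2], by linarith [hs.1]⟩
      ⟨by linarith [ht.2], by linarith [ht.1]⟩, sub_sub_sub_cancel_left, abs_sub_comm]
  · exact dist_onArc e hs ht

theorem headSide_iff_of_mem {u : V} {e : Q.Arc} (h : u ∈ e.1) : HeadSide e u ↔ u = head e := by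
  rcases mem_arc_iff.1 h with rfl | rfl
  · exact ⟨fun h' => absurd h' (not_headSide_tail e),
      fun h' => absurd h' (adj_tail_head e).ne⟩
  · simp [headSide_head]

theorem onArc_zero (e : Q.Arc) : (onArc e 0 : Q.Point) = .node (tail e) := by
  simp [onArc]

theorem onArc_len (e : Q.Arc) : (onArc e (Q.len e) : Q.Point) = .node (head e) := by
  simp [onArc, Q.len_pos e]

theorem ray_zero {u : V} {e : Q.Arc} (h : u ∈ e.1) : ray u e 0 = .node u := by
  unfold ray
  split_ifs with h1
  · rw [sub_zero, onArc_len, (headSide_iff_of_mem h).1 h1]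
  · rcases mem_arc_iff.1 h with rfl | rfl
    · exact onArc_zero e
    · exact absurd (headSide_head e) h1

theorem exists_ray_len {u : V} {e : Q.Arc} (h : u ∈ e.1) :
    ∃ w, w ∈ e.1 ∧ w ≠ u ∧ ray u e (Q.len e) = .node w := by
  unfold ray
  split_ifs with h1
  · rw [headSide_iff_of_mem h] at h1
    exact ⟨tail e, tail_mem e, h1 ▸ (adj_tail_head e).ne, by rw [sub_self, onArc_zero]⟩
  · rw [headSide_iff_of_mem h] at h1
    exact ⟨head e, head_mem e, Ne.symm h1, onArc_len e⟩

theorem coord_ray {u : V} {e : Q.Arc} {t : ℝ} (ht : t ∈ Icc 0 (Q.len e)) :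
    coord e (ray u e t) = nodeCoord e u + t ∨ coord e (ray u e t) = nodeCoord e u - t := by
  unfold ray nodeCoord
  split_ifs
  · right
    rw [coord_onArc ⟨by linarith [ht.2], by linarith [ht.1]⟩]
  · left
    rw [coord_onArc ht]; ring

theorem depth_ray (u : V) (e : Q.Arc) {t : ℝ} (ht : t ∈ Icc 0 (Q.len e)) :
    depth u e (ray u e t) = t := by
  have h0 := ht.1
  rcases coord_ray (u := u) ht with h | h <;> simp [depth, h, abs_of_nonneg h0]

theorem ray_depth {u : V} {e : Q.Arc} {x : Q.Point} (h : coord e x ∈ Ioo 0 (Q.len e)) :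
    ray u e (depth u e x) = x := by
  unfold ray depth nodeCoord
  split_ifs with h1
  · rw [abs_of_neg (by linarith [h.2])]
    simp [onArc_coord h]
  · rw [sub_zero, abs_of_pos h.1, onArc_coord h]

theorem coord_mem_Ioo_iff (u : V) {e : Q.Arc} {x : Q.Point} :
    coord e x ∈ Ioo 0 (Q.len e) ↔ depth u e x ∈ Ioo 0 (Q.len e) := by
  have h := coord_mem_Icc e x
  unfold depth
  rcases nodeCoord_eq e u with h' | h'
  · rw [h', sub_zero, abs_of_nonneg h.1]
  · rw [h', abs_of_nonpos (by linarith [h.2])]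
    simp only [mem_Ioo]
    constructor <;> rintro ⟨h1, h2⟩ <;> constructor <;> linarith

theorem coord_ray_mem {u : V} {e : Q.Arc} {t : ℝ} (ht : t ∈ Ioo 0 (Q.len e)) :
    coord e (ray u e t) ∈ Ioo 0 (Q.len e) := by
  rw [coord_mem_Ioo_iff u, depth_ray u e (Ioo_subset_Icc_self ht)]
  exact ht

theorem isRegular_ray {u : V} {e : Q.Arc} {t : ℝ} (ht : t ∈ Ioo 0 (Q.len e)) :
    IsRegular (ray u e t) := isRegular_iff.2 ⟨e, coord_ray_mem ht⟩

theorem not_isRegular_node (v : V) : ¬ IsRegular (.node v : Q.Point) := by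
  rintro ⟨e, s, h⟩
  cases h

/-! ### Leaves -/

theorem exists_arc_of_isLeaf {v : V} (hv : Q.IsLeaf v) : ∃ e : Q.Arc, v ∈ e.1 := by
  obtain ⟨w, hw⟩ := ncard_eq_one.1 hv
  have : Q.graph.Adj v w := by
    have : w ∈ Q.graph.neighborSet v := hw ▸ rfl
    exact this
  exact ⟨⟨s(v, w), this⟩, by simp⟩

theorem arc_unique_of_isLeaf {v : V} (hv : Q.IsLeaf v) {e f : Q.Arc} (he : v ∈ e.1)
    (hf : v ∈ f.1) : e = f := by
  obtain ⟨w, hw⟩ := ncard_eq_one.1 hv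
  have key : ∀ g : Q.Arc, v ∈ g.1 → g.1 = s(v, w) := by
    intro g hg
    obtain ⟨u, hu⟩ := hg
    have : Q.graph.Adj v u := by
      have h := g.2
      rw [hu] at h
      exact h
    have hu' : u ∈ Q.graph.neighborSet v := this
    rw [hw, mem_singleton_iff] at hu'
    rw [hu, hu']
  exact Subtype.ext ((key e he).trans (key f hf).symm)

theorem mem_branch_of_isLeaf {v : V} (hv : Q.IsLeaf v) {e : Q.Arc} (he : v ∈ e.1) {x : Q.Point}
    (hx : x ≠ .node v) : x ∈ branch v e := by
  obtain ⟨f, hf, hxf⟩ := exists_mem_branch hx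
  rwa [arc_unique_of_isLeaf hv he hf]

/-- A third node would be separated by `e` from both of its ends if both were leaves. But `e` has
only two sides, and its ends already lie on different ones. -/
theorem not_isLeaf_of_mem {v w : V} (hv : Q.IsLeaf v) {e : Q.Arc} (hve : v ∈ e.1) (hwe : w ∈ e.1)
    (h : w ≠ v) : ¬ Q.IsLeaf w := by
  intro hw
  classical
  obtain ⟨u, hu⟩ : ∃ u, u ∉ ({v, w} : Finset V) := by
    by_contra! hall
    have h1 : Fintype.card V ≤ ({v, w} : Finset V).card :=
      Finset.card_le_card fun u _ => hall u
    have h2 := Finset.card_le_two (a := v) (b := w)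
    have h3 := Q.two_lt_card
    omega
  simp only [Finset.mem_insert, Finset.mem_singleton, not_or] at hu
  have h1 : Point.node u ∈ branch v e := mem_branch_of_isLeaf hv hve (by simpa using hu.1)
  have h2 : Point.node u ∈ branch w e := mem_branch_of_isLeaf hw hwe (by simpa using hu.2)
  have h3 : Point.node w ∈ branch v e := mem_branch_of_isLeaf hv hve (by simpa using h)
  have hl := Q.len_pos e
  simp only [branch, mem_ofPred_eq, depth, abs_pos, coord_node, sub_ne_zero] at h1 h2 h3
  rcases nodeCoord_eq e u with a | a <;> rcases nodeCoord_eq e v with b | b <;>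
    rcases nodeCoord_eq e w with c | c <;> simp [a, b, c] at h1 h2 h3

theorem coord_mem_of_depth_lt {v : V} (hv : Q.IsLeaf v) {e : Q.Arc} (he : v ∈ e.1) {x : Q.Point}
    (hx : x ≠ .node v) (h : depth v e x < Q.len e) : coord e x ∈ Ioo 0 (Q.len e) :=
  (coord_mem_Ioo_iff v).2 ⟨mem_branch_of_isLeaf hv he hx, h⟩

/-! ### The length measure -/

theorem length_apply {A : Set Q.Point} (hA : MeasurableSet A) :
    Q.length A = ∑ e : Q.Arc, volume (onArc e ⁻¹' A ∩ Ioo 0 (Q.len e)) := by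
  rw [length, Measure.coe_finsetSum, Finset.sum_apply]
  refine Finset.sum_congr rfl fun e _ => ?_
  rw [Measure.map_apply (measurable_onArc e) hA, Measure.restrict_apply (measurable_onArc e hA)]

theorem length_univ : Q.length univ = ENNReal.ofReal (∑ e, Q.len e) := by
  rw [length_apply MeasurableSet.univ, ENNReal.ofReal_sum_of_nonneg fun e _ => (Q.len_pos e).le]
  simp

instance : IsFiniteMeasure Q.length := ⟨by rw [length_univ]; exact ENNReal.ofReal_lt_top⟩

theorem totalLength_eq : Q.totalLength = ∑ e, Q.len e := by
  rw [totalLength, measureReal_def, length_univ,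
    ENNReal.toReal_ofReal (Finset.sum_nonneg fun e _ => (Q.len_pos e).le)]

theorem length_univ_eq : Q.length univ = ENNReal.ofReal Q.totalLength := by
  rw [length_univ, totalLength_eq]

theorem len_le_totalLength (e : Q.Arc) : Q.len e ≤ Q.totalLength := by
  rw [totalLength_eq]
  exact Finset.single_le_sum (f := Q.len) (fun e _ => (Q.len_pos e).le) (Finset.mem_univ e)

instance : NullSingletonClass Q.length where
  measure_singleton x := by
    rw [length_apply (measurableSet_singleton x), Finset.sum_eq_zero]
    intro e _
    refine measure_mono_null (t := {coord e x}) ?_ (measure_singleton _)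
    rintro t ⟨h1, h2⟩
    rw [mem_singleton_iff, ← show onArc e t = x from h1, coord_onArc (Ioo_subset_Icc_self h2)]

theorem length_ray_image (u : V) (e : Q.Arc) {a b : ℝ} (ha : 0 ≤ a) (hb : b ≤ Q.len e) :
    MeasurableSet (ray u e '' Ioo a b) ∧ Q.length (ray u e '' Ioo a b) = ENNReal.ofReal (b - a) := by
  have hsub : Ioo a b ⊆ Ioo 0 (Q.len e) := Ioo_subset_Ioo ha hb
  have him : ray u e '' Ioo a b =
      {x | coord e x ∈ Ioo 0 (Q.len e)} ∩ {x | depth u e x ∈ Ioo a b} := by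
    ext x
    constructor
    · rintro ⟨t, ht, rfl⟩
      exact ⟨coord_ray_mem (hsub ht),
        by rwa [mem_ofPred_eq, depth_ray u e (Ioo_subset_Icc_self (hsub ht))]⟩
    · rintro ⟨h1, h2⟩
      exact ⟨_, h2, ray_depth h1⟩
  have hm : MeasurableSet (ray u e '' Ioo a b) := by
    rw [him]
    exact ((isOpen_Ioo.preimage (continuous_coord e)).inter
      (isOpen_Ioo.preimage (continuous_depth u e))).measurableSet
  refine ⟨hm, ?_⟩
  rw [length_apply hm, Finset.sum_eq_single e]
  · rw [him]
    by_cases hu : HeadSide e u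
    · have : onArc e ⁻¹' ({x | coord e x ∈ Ioo 0 (Q.len e)} ∩ {x | depth u e x ∈ Ioo a b}) ∩
          Ioo 0 (Q.len e) = Ioo (Q.len e - b) (Q.len e - a) := by
        ext t
        simp only [mem_inter_iff, mem_preimage, mem_ofPred_eq]
        constructor
        · rintro ⟨⟨-, h1⟩, h2⟩
          rw [depth, coord_onArc (Ioo_subset_Icc_self h2), nodeCoord, if_pos hu,
            abs_of_neg (by linarith [h2.2])] at h1
          exact ⟨by linarith [h1.2], by linarith [h1.1]⟩
        · rintro ⟨h1, h2⟩
          have h3 : t ∈ Ioo 0 (Q.len e) := ⟨by linarith, by linarith⟩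
          rw [depth, coord_onArc (Ioo_subset_Icc_self h3), nodeCoord, if_pos hu,
            abs_of_neg (by linarith [h3.2])]
          exact ⟨⟨h3, by linarith, by linarith⟩, h3⟩
      rw [this, Real.volume_Ioo]
      congr 1; ring
    · have : onArc e ⁻¹' ({x | coord e x ∈ Ioo 0 (Q.len e)} ∩ {x | depth u e x ∈ Ioo a b}) ∩
          Ioo 0 (Q.len e) = Ioo a b := by
        ext t
        simp only [mem_inter_iff, mem_preimage, mem_ofPred_eq]
        constructor
        · rintro ⟨⟨-, h1⟩, h2⟩
          rwa [depth, coord_onArc (Ioo_subset_Icc_self h2), nodeCoord, if_neg hu, sub_zero,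
            abs_of_pos h2.1] at h1
        · intro h1
          have h3 := hsub h1
          rw [depth, coord_onArc (Ioo_subset_Icc_self h3), nodeCoord, if_neg hu, sub_zero,
            abs_of_pos h3.1]
          exact ⟨⟨h3, h1⟩, h3⟩
      rw [this, Real.volume_Ioo]
  · intro f _ hne
    convert measure_empty (μ := (volume : Measure ℝ))
    rw [eq_empty_iff_forall_notMem]
    rintro t ⟨h1, h2⟩
    rw [mem_preimage, him] at h1
    refine hne (eq_of_coord_mem (x := onArc f t) ?_ h1.1)
    rwa [coord_onArc (Ioo_subset_Icc_self h2)]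
  · simp

/-! ### The arms at the leaf nodes -/

variable (Q) in
/-- The leaf nodes. -/
abbrev Leaf : Type _ := {v // Q.IsLeaf v}

/-- The leaf arc of a leaf node. -/
noncomputable def leafArc (v : Q.Leaf) : Q.Arc := (exists_arc_of_isLeaf v.2).choose

theorem mem_leafArc (v : Q.Leaf) : v.1 ∈ (leafArc v).1 := (exists_arc_of_isLeaf v.2).choose_spec

theorem leafArc_eq {v : Q.Leaf} {e : Q.Arc} (h : v.1 ∈ e.1) : leafArc v = e :=
  arc_unique_of_isLeaf v.2 (mem_leafArc v) h

theorem leafArc_injective : Function.Injective (leafArc : Q.Leaf → Q.Arc) := by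
  intro v v' h
  by_contra hne
  exact not_isLeaf_of_mem v.2 (mem_leafArc v) (h ▸ mem_leafArc v') (fun h' => hne (Subtype.ext h'.symm))
    v'.2

/-- The length of the part of the leaf arc of `v` at distance less than `α / 2` from `v`. -/
noncomputable def cut (α : ℝ) (v : Q.Leaf) : ℝ := min (Q.len (leafArc v)) (α / 2)

theorem cut_pos {α : ℝ} (hα : 0 < α) (v : Q.Leaf) : 0 < cut α v :=
  lt_min (Q.len_pos _) (by linarith)

theorem cut_le_len (α : ℝ) (v : Q.Leaf) : cut α v ≤ Q.len (leafArc v) := min_le_left _ _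

theorem cut_le (α : ℝ) (v : Q.Leaf) : cut α v ≤ α / 2 := min_le_right _ _

/-- The point of the leaf arc of `v` at distance `t` from `v`. -/
noncomputable def tip (v : Q.Leaf) (t : ℝ) : Q.Point := ray v.1 (leafArc v) t

theorem tip_zero (v : Q.Leaf) : tip v 0 = .node v.1 := ray_zero (mem_leafArc v)

theorem dist_tip (v : Q.Leaf) {s t : ℝ} (hs : s ∈ Icc 0 (Q.len (leafArc v)))
    (ht : t ∈ Icc 0 (Q.len (leafArc v))) : dist (tip v s) (tip v t) = |s - t| := dist_ray _ _ hs ht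

theorem exists_tip_len (v : Q.Leaf) :
    ∃ w, w ∈ (leafArc v).1 ∧ w ≠ v.1 ∧ ¬ Q.IsLeaf w ∧ tip v (Q.len (leafArc v)) = .node w := by
  obtain ⟨w, h1, h2, h3⟩ := exists_ray_len (mem_leafArc v)
  exact ⟨w, h1, h2, not_isLeaf_of_mem v.2 (mem_leafArc v) h1 h2, h3⟩

/-- The points of the leaf arc of `v` at distance in `(0, r)` from `v`. -/
def openArm (v : Q.Leaf) (r : ℝ) : Set Q.Point := tip v '' Ioo 0 r

/-- The points of the leaf arc of `v` at distance in `[0, r]` from `v`. -/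
def arm (v : Q.Leaf) (r : ℝ) : Set Q.Point := tip v '' Icc 0 r

theorem openArm_subset_arm (v : Q.Leaf) (r : ℝ) : openArm v r ⊆ arm v r :=
  image_mono Ioo_subset_Icc_self

theorem mem_openArm_iff {v : Q.Leaf} {r : ℝ} (hr : r ≤ Q.len (leafArc v)) {x : Q.Point} :
    x ∈ openArm v r ↔ coord (leafArc v) x ∈ Ioo 0 (Q.len (leafArc v)) ∧
      depth v.1 (leafArc v) x < r := by
  constructor
  · rintro ⟨t, ht, rfl⟩
    have h1 : t ∈ Ioo 0 (Q.len (leafArc v)) := ⟨ht.1, ht.2.trans_le hr⟩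
    exact ⟨coord_ray_mem h1, by rw [tip, depth_ray _ _ (Ioo_subset_Icc_self h1)]; exact ht.2⟩
  · rintro ⟨h1, h2⟩
    exact ⟨_, ⟨((coord_mem_Ioo_iff v.1).1 h1).1, h2⟩, ray_depth h1⟩

theorem isOpen_openArm {v : Q.Leaf} {r : ℝ} (hr : r ≤ Q.len (leafArc v)) : IsOpen (openArm v r) := by
  have : openArm v r = coord (leafArc v) ⁻¹' Ioo 0 (Q.len (leafArc v)) ∩
      {x | depth v.1 (leafArc v) x < r} := by
    ext x
    exact mem_openArm_iff hr
  rw [this]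
  exact (isOpen_Ioo.preimage (continuous_coord _)).inter
    (isOpen_lt (continuous_depth _ _) continuous_const)

theorem depth_lt_iff {v : Q.Leaf} {r : ℝ} (hr0 : 0 < r) (hr : r ≤ Q.len (leafArc v))
    {x : Q.Point} : depth v.1 (leafArc v) x < r ↔ x ∈ openArm v r ∨ x = .node v.1 := by
  constructor
  · intro h
    by_cases hx : x = .node v.1
    · exact Or.inr hx
    · exact Or.inl ((mem_openArm_iff hr).2
        ⟨coord_mem_of_depth_lt v.2 (mem_leafArc v) hx (h.trans_le hr), h⟩)
  · rintro (h | rfl)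
    · exact ((mem_openArm_iff hr).1 h).2
    · rwa [depth_node_self]

theorem isRegular_of_mem_openArm {v : Q.Leaf} {r : ℝ} (hr : r ≤ Q.len (leafArc v)) {x : Q.Point}
    (hx : x ∈ openArm v r) : IsRegular x := isRegular_iff.2 ⟨_, ((mem_openArm_iff hr).1 hx).1⟩

theorem openArm_disjoint {v v' : Q.Leaf} {r r' : ℝ} (hr : r ≤ Q.len (leafArc v))
    (hr' : r' ≤ Q.len (leafArc v')) (h : v ≠ v') : Disjoint (openArm v r) (openArm v' r') := by
  rw [disjoint_left]
  intro x hx hx'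
  exact h (leafArc_injective
    (eq_of_coord_mem ((mem_openArm_iff hr).1 hx).1 ((mem_openArm_iff hr').1 hx').1))

theorem isCompact_arm (v : Q.Leaf) (r : ℝ) : IsCompact (arm v r) :=
  isCompact_Icc.image (continuous_ray _ _)

theorem isPreconnected_arm (v : Q.Leaf) (r : ℝ) : IsPreconnected (arm v r) :=
  isPreconnected_Icc.image _ (continuous_ray _ _).continuousOn

/-- Arms can meet only at their inner ends: any other point of an arm is a leaf node or an interior
point of its leaf arc, so it lies on no other leaf arc. -/
theorem tip_eq_tip {v v' : Q.Leaf} (h : v ≠ v') {r t t' : ℝ} (hr : r ≤ Q.len (leafArc v))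
    (ht : t ∈ Icc 0 r) (ht' : t' ∈ Icc 0 (Q.len (leafArc v'))) (heq : tip v t = tip v' t') :
    t = r := by
  by_contra hne
  have htr := lt_of_le_of_ne ht.2 hne
  have hend : t' = 0 ∨ t' = Q.len (leafArc v') ∨ t' ∈ Ioo 0 (Q.len (leafArc v')) := by
    rcases ht'.1.eq_or_lt with h1 | h1
    · exact Or.inl h1.symm
    · rcases ht'.2.eq_or_lt with h2 | h2
      · exact Or.inr (Or.inl h2)
      · exact Or.inr (Or.inr ⟨h1, h2⟩)
  obtain ⟨w', -, -, hw', hlen'⟩ := exists_tip_len v'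
  rcases ht.1.eq_or_lt with h0 | h0
  · rw [← h0, tip_zero] at heq
    rcases hend with rfl | rfl | h1
    · rw [tip_zero] at heq
      injection heq with heq
      exact h (Subtype.ext heq)
    · rw [hlen'] at heq
      injection heq with heq
      exact hw' (heq ▸ v.2)
    · have := isRegular_ray (u := v'.1) h1
      rw [← tip, ← heq] at this
      exact not_isRegular_node _ this
  · have h2 : t ∈ Ioo 0 (Q.len (leafArc v)) := ⟨h0, htr.trans_le hr⟩
    have hreg := isRegular_ray (u := v.1) h2
    rw [← tip, heq] at hreg
    rcases hend with rfl | rfl | h1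
    · rw [tip_zero] at hreg
      exact not_isRegular_node _ hreg
    · rw [hlen'] at hreg
      exact not_isRegular_node _ hreg
    · have h3 := coord_ray_mem (u := v.1) h2
      have h4 := coord_ray_mem (u := v'.1) h1
      rw [← tip] at h3 h4
      rw [heq] at h3
      exact h (leafArc_injective (eq_of_coord_mem h3 h4))

/-- The inner end of the arm at `v`. -/
noncomputable def attach (α : ℝ) (v : Q.Leaf) : Q.Point := tip v (cut α v)

theorem attach_cases {α : ℝ} (hα : 0 < α) (v : Q.Leaf) :
    (cut α v = Q.len (leafArc v) ∧ ∃ w, w ∈ (leafArc v).1 ∧ w ≠ v.1 ∧ ¬ Q.IsLeaf w ∧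
      attach α v = .node w) ∨
    (cut α v = α / 2 ∧ cut α v < Q.len (leafArc v) ∧
      coord (leafArc v) (attach α v) ∈ Ioo 0 (Q.len (leafArc v))) := by
  rcases (cut_le_len α v).eq_or_lt with h | h
  · left
    refine ⟨h, ?_⟩
    rw [attach, h]
    exact exists_tip_len v
  · right
    refine ⟨?_, h, coord_ray_mem ⟨cut_pos hα v, h⟩⟩
    rcases min_choice (Q.len (leafArc v)) (α / 2) with h' | h'
    · exact absurd h' h.ne
    · exact h'

theorem attach_ne_leaf {α : ℝ} (hα : 0 < α) (v v' : Q.Leaf) : attach α v ≠ .node v'.1 := by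
  intro h
  rcases attach_cases hα v with ⟨-, w, -, -, h2, h1⟩ | ⟨-, -, h1⟩
  · rw [h1] at h
    injection h with h
    exact h2 (h ▸ v'.2)
  · rw [h] at h1
    exact not_isRegular_node _ (isRegular_iff.2 ⟨_, h1⟩)

theorem attach_mem_arm {α : ℝ} (hα : 0 < α) (v : Q.Leaf) : attach α v ∈ arm v (cut α v) :=
  ⟨_, ⟨(cut_pos hα v).le, le_rfl⟩, rfl⟩

theorem attach_eq_of_mem_arm {α : ℝ} {v v' : Q.Leaf} {x : Q.Point}
    (hx : x ∈ arm v (cut α v)) (hx' : x ∈ arm v' (cut α v')) : attach α v = attach α v' := by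
  by_cases h : v = v'
  · rw [h]
  · obtain ⟨t, ht, rfl⟩ := hx
    obtain ⟨t', ht', he⟩ := hx'
    have h1 := tip_eq_tip h (cut_le_len α v) ht ⟨ht'.1, ht'.2.trans (cut_le_len α v')⟩ he.symm
    have h2 := tip_eq_tip (Ne.symm h) (cut_le_len α v') ht'
      ⟨ht.1, ht.2.trans (cut_le_len α v)⟩ he
    rw [h1, h2] at he
    exact he.symm

theorem eq_attach_of_attach_mem_arm {α : ℝ} (hα : 0 < α) {v v' : Q.Leaf}
    (h : attach α v ∈ arm v' (cut α v')) : attach α v = attach α v' :=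
  attach_eq_of_mem_arm (attach_mem_arm hα v) h

theorem mem_arm_cases {α : ℝ} {v : Q.Leaf} {x : Q.Point} (hx : x ∈ arm v (cut α v)) :
    x = .node v.1 ∨ x ∈ openArm v (cut α v) ∨ x = attach α v := by
  obtain ⟨t, ht, rfl⟩ := hx
  rcases ht.1.eq_or_lt with h | h
  · exact Or.inl (by rw [← h, tip_zero])
  · rcases ht.2.eq_or_lt with h' | h'
    · exact Or.inr (Or.inr (by rw [h']; rfl))
    · exact Or.inr (Or.inl ⟨t, ⟨h, h'⟩, rfl⟩)

theorem length_openArm {α : ℝ} (v : Q.Leaf) :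
    Q.length (openArm v (cut α v)) = ENNReal.ofReal (cut α v) := by
  have := (length_ray_image v.1 (leafArc v) le_rfl (cut_le_len α v)).2
  rwa [sub_zero] at this

/-! ### The extremity set under the Leaf Condition -/

/-- From here on, `E` is a disjoint union of open segments. Its definition by components of
punctured `Q` is needed only in `half_le_length_sides`. -/
theorem extremitySet_eq {α : ℝ} (h : Q.LeafCondition α) :
    Q.extremitySet α = ⋃ v, openArm v (cut α v) := by
  rw [h]
  ext x
  simp only [mem_ofPred_eq, mem_iUnion]
  constructor
  · rintro ⟨v, e, s, hv, hve, rfl, hd⟩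
    refine ⟨⟨v, hv⟩, ?_⟩
    have he := leafArc_eq (v := ⟨v, hv⟩) hve
    rw [mem_openArm_iff (cut_le_len _ _), he, coord_inner_self]
    have hc : coord e (.inner e s) ∈ Ioo 0 (Q.len e) := by rw [coord_inner_self]; exact s.2
    have h1 := (coord_mem_Ioo_iff v).1 hc
    refine ⟨s.2, lt_min (he ▸ h1.2) ?_⟩
    rwa [← ray_depth (u := v) hc, ← ray_zero hve, dist_ray v e (Ioo_subset_Icc_self h1)
      ⟨le_rfl, (Q.len_pos e).le⟩, sub_zero, abs_of_pos h1.1] at hd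
  · rintro ⟨v, t, ht, rfl⟩
    have h1 : t ∈ Ioo 0 (Q.len (leafArc v)) := ⟨ht.1, ht.2.trans_le (cut_le_len α v)⟩
    obtain ⟨s, hs⟩ := exists_eq_inner_of_coord (coord_ray_mem (u := v.1) h1)
    refine ⟨v.1, leafArc v, s, v.2, mem_leafArc v, hs, ?_⟩
    rw [← tip_zero, dist_tip v (Ioo_subset_Icc_self h1) ⟨le_rfl, (Q.len_pos _).le⟩, sub_zero,
      abs_of_pos ht.1]
    exact ht.2.trans_le (cut_le α v)

theorem isOpen_extremitySet {α : ℝ} (h : Q.LeafCondition α) : IsOpen (Q.extremitySet α) := by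
  rw [extremitySet_eq h]
  exact isOpen_iUnion fun v => isOpen_openArm (cut_le_len α v)

theorem closure_openArm {α : ℝ} (hα : 0 < α) (v : Q.Leaf) :
    closure (openArm v (cut α v)) = arm v (cut α v) := by
  apply subset_antisymm
  · exact closure_minimal (openArm_subset_arm _ _) (isCompact_arm _ _).isClosed
  · have := image_closure_subset_closure_image (s := Ioo 0 (cut α v))
      (continuous_ray v.1 (leafArc v))
    rwa [closure_Ioo (cut_pos hα v).ne] at this

theorem closure_extremitySet {α : ℝ} (hα : 0 < α) (h : Q.LeafCondition α) :
    closure (Q.extremitySet α) = ⋃ v, arm v (cut α v) := by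
  rw [extremitySet_eq h, closure_iUnion_of_finite]
  exact iUnion_congr fun v => closure_openArm hα v

/-! ### Stars, the components of the closure of the extremity set. -/

/-- The union of the arms that share the inner end of the arm at `v`. -/
def star (α : ℝ) (v : Q.Leaf) : Set Q.Point :=
  ⋃ (v' : Q.Leaf) (_ : attach α v' = attach α v), arm v' (cut α v')

theorem mem_star {α : ℝ} {v : Q.Leaf} {x : Q.Point} :
    x ∈ star α v ↔ ∃ v', attach α v' = attach α v ∧ x ∈ arm v' (cut α v') := by
  simp [star]

theorem star_congr {α : ℝ} {v v' : Q.Leaf} (h : attach α v = attach α v') : star α v = star α v' := by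
  rw [star, star, h]

theorem arm_subset_star (α : ℝ) (v : Q.Leaf) : arm v (cut α v) ⊆ star α v :=
  fun _ hx => mem_star.2 ⟨v, rfl, hx⟩

theorem attach_mem_star {α : ℝ} (hα : 0 < α) (v : Q.Leaf) : attach α v ∈ star α v :=
  arm_subset_star α v (attach_mem_arm hα v)

theorem attach_eq_of_mem_star {α : ℝ} {v v' : Q.Leaf} {x : Q.Point}
    (h : x ∈ star α v) (h' : x ∈ star α v') : attach α v = attach α v' := by
  obtain ⟨u, hu, hx⟩ := mem_star.1 h
  obtain ⟨u', hu', hx'⟩ := mem_star.1 h'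
  rw [← hu, ← hu', attach_eq_of_mem_arm hx hx']

theorem isClosed_star (α : ℝ) (v : Q.Leaf) : IsClosed (star α v) := by
  unfold star
  exact isClosed_iUnion_of_finite fun v' => isClosed_iUnion_of_finite fun _ =>
    (isCompact_arm _ _).isClosed

theorem isPreconnected_star {α : ℝ} (hα : 0 < α) (v : Q.Leaf) : IsPreconnected (star α v) := by
  have : star α v = ⋃₀ {A | ∃ v', attach α v' = attach α v ∧ A = arm v' (cut α v')} := by
    ext x
    rw [mem_star, mem_sUnion]
    constructor
    · rintro ⟨v', h, hx⟩
      exact ⟨_, ⟨v', h, rfl⟩, hx⟩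
    · rintro ⟨_, ⟨v', h, rfl⟩, hx⟩
      exact ⟨v', h, hx⟩
  rw [this]
  refine isPreconnected_sUnion (attach α v) _ ?_ ?_
  · rintro _ ⟨v', h, rfl⟩
    exact h ▸ attach_mem_arm hα v'
  · rintro _ ⟨v', h, rfl⟩
    exact isPreconnected_arm _ _

theorem star_subset_closure {α : ℝ} (hα : 0 < α) (h : Q.LeafCondition α) (v : Q.Leaf) :
    star α v ⊆ closure (Q.extremitySet α) := by
  rw [closure_extremitySet hα h]
  intro x hx
  obtain ⟨v', -, hx⟩ := mem_star.1 hx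
  exact mem_iUnion.2 ⟨v', hx⟩

/-- Stars are connected through their common inner end. Different stars are disjoint, and there are
finitely many closed ones, so a connected set cannot leave its star. -/
theorem connectedComponentIn_closure {α : ℝ} (hα : 0 < α) (h : Q.LeafCondition α) {v : Q.Leaf}
    {x : Q.Point} (hx : x ∈ star α v) :
    connectedComponentIn (closure (Q.extremitySet α)) x = star α v := by
  have hsub := star_subset_closure hα h v
  apply subset_antisymm
  · set R : Set Q.Point := ⋃ (v' : Q.Leaf) (_ : attach α v' ≠ attach α v), star α v' with hR
    have hRc : IsClosed R := by
      refine isClosed_iUnion_of_finite fun v' => isClosed_iUnion_of_finite fun _ =>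
        isClosed_star _ _
    have hdisj : Disjoint (star α v) R := by
      rw [disjoint_left]
      intro y hy hyR
      simp only [hR, mem_iUnion] at hyR
      obtain ⟨v', hne, hy'⟩ := hyR
      exact hne (attach_eq_of_mem_star hy' hy)
    have hcov : closure (Q.extremitySet α) ⊆ star α v ∪ R := by
      rw [closure_extremitySet hα h]
      intro y hy
      obtain ⟨v', hy⟩ := mem_iUnion.1 hy
      by_cases h' : attach α v' = attach α v
      · exact Or.inl (mem_star.2 ⟨v', h', hy⟩)
      · exact Or.inr (mem_iUnion₂.2 ⟨v', h', arm_subset_star α v' hy⟩)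
    have h1 := isPreconnected_iff_subset_of_disjoint_closed.1
      (isPreconnected_connectedComponentIn (x := x) (F := closure (Q.extremitySet α)))
      (star α v) R (isClosed_star α v) hRc ((connectedComponentIn_subset _ _).trans hcov)
      (by rw [hdisj.inter_eq, inter_empty])
    rcases h1 with h1 | h1
    · exact h1
    · exact absurd (h1 (mem_connectedComponentIn (hsub hx))) (disjoint_left.1 hdisj hx)
  · exact (isPreconnected_star hα v).subset_connectedComponentIn hx hsub

theorem closureComponents_eq {α : ℝ} (hα : 0 < α) (h : Q.LeafCondition α) :
    Q.closureComponents α = range (star α) := by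
  ext K
  constructor
  · rintro ⟨x, hx, rfl⟩
    have hx' := hx
    rw [closure_extremitySet hα h, mem_iUnion] at hx'
    obtain ⟨v, hv⟩ := hx'
    exact ⟨v, (connectedComponentIn_closure hα h (arm_subset_star α v hv)).symm⟩
  · rintro ⟨v, rfl⟩
    exact ⟨attach α v, star_subset_closure hα h v (attach_mem_star hα v),
      (connectedComponentIn_closure hα h (attach_mem_star hα v)).symm⟩

/-- The inner ends do not belong to `E`, so arms that form one star in the closure are still
separate components of `E` itself. -/
theorem leafComponent_eq {α : ℝ} (hα : 0 < α) (h : Q.LeafCondition α) (v : Q.Leaf) :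
    Q.leafComponent α v.1 = openArm v (cut α v) := by
  have hcomp : ∀ (u : Q.Leaf) (x), x ∈ openArm u (cut α u) →
      connectedComponentIn (Q.extremitySet α) x = openArm u (cut α u) := by
    intro u x hx
    have hE := extremitySet_eq h
    have hsub : openArm u (cut α u) ⊆ Q.extremitySet α := by
      rw [hE]; exact subset_iUnion (fun v : Q.Leaf => openArm v (cut α v)) u
    apply subset_antisymm
    · refine IsPreconnected.subset_left_of_subset_union (isOpen_openArm (cut_le_len α u))
        (v := ⋃ (v' : Q.Leaf) (_ : v' ≠ u), openArm v' (cut α v'))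
        (isOpen_iUnion fun v' => isOpen_iUnion fun _ => isOpen_openArm (cut_le_len α v')) ?_ ?_
        ⟨x, mem_connectedComponentIn (hsub hx), hx⟩ isPreconnected_connectedComponentIn
      · simp only [disjoint_iUnion_right]
        exact fun v' hv' => openArm_disjoint (cut_le_len _ _) (cut_le_len _ _) hv'.symm
      · refine (connectedComponentIn_subset _ _).trans ?_
        rw [hE]
        refine iUnion_subset fun v' => ?_
        by_cases hv' : v' = u
        · rw [hv']; exact subset_union_left
        · intro y hy
          exact Or.inr (mem_iUnion₂.2 ⟨v', hv', hy⟩)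
    · exact (isPreconnected_Ioo.image _
        (continuous_ray _ _).continuousOn).subset_connectedComponentIn hx hsub
  ext x
  constructor
  · rintro ⟨hx, hv⟩
    rw [extremitySet_eq h, mem_iUnion] at hx
    obtain ⟨u, hu⟩ := hx
    rw [hcomp u x hu, closure_openArm hα] at hv
    rcases mem_arm_cases hv with h1 | h1 | h1
    · injection h1 with h1
      rwa [Subtype.ext h1]
    · exact absurd (isRegular_of_mem_openArm (cut_le_len _ _) h1) (not_isRegular_node _)
    · exact absurd h1.symm (attach_ne_leaf hα u v)
  · intro hx
    refine ⟨by rw [extremitySet_eq h]; exact mem_iUnion.2 ⟨v, hx⟩, ?_⟩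
    rw [hcomp v x hx, closure_openArm hα]
    exact ⟨0, ⟨le_rfl, (cut_pos hα v).le⟩, tip_zero v⟩

theorem leafLength_eq {α : ℝ} (hα : 0 < α) (h : Q.LeafCondition α) (v : Q.Leaf) :
    Q.leafLength α v.1 = cut α v := by
  rw [leafLength, leafComponent_eq hα h, measureReal_def, length_openArm,
    ENNReal.toReal_ofReal (cut_pos hα v).le]

theorem length_extremitySet {α : ℝ} (hα : 0 < α) (h : Q.LeafCondition α) :
    Q.length.real (Q.extremitySet α) = ∑ v : Q.Leaf, cut α v := by
  rw [extremitySet_eq h, measureReal_def, measure_iUnion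
    (fun v v' hv => openArm_disjoint (cut_le_len _ _) (cut_le_len _ _) hv)
    (fun v => (isOpen_openArm (cut_le_len α v)).measurableSet), tsum_fintype]
  simp only [length_openArm]
  rw [← ENNReal.ofReal_sum_of_nonneg fun v _ => (cut_pos hα v).le,
    ENNReal.toReal_ofReal (Finset.sum_nonneg fun v _ => (cut_pos hα v).le)]

-- Off the finitely many leaf nodes and inner ends, a star is a disjoint union of open arms.
open Classical in
theorem length_star {α : ℝ} (hα : 0 < α) (v : Q.Leaf) :
    Q.length.real (star α v) = ∑ v' : Q.Leaf with attach α v' = attach α v, cut α v' := by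
  have h1 : star α v =ᵐ[Q.length]
      ⋃ v' ∈ Finset.univ.filter fun v' : Q.Leaf => attach α v' = attach α v,
        openArm v' (cut α v') := by
    apply Filter.Eventually.set_eq
    have hfin : (range (fun v : Q.Leaf => Point.node v.1) ∪ range (attach α : Q.Leaf → Q.Point)).Finite :=
      (finite_range _).union (finite_range _)
    have h0 := hfin.measure_zero Q.length
    rw [measure_eq_zero_iff_ae_notMem] at h0
    filter_upwards [h0] with x hx
    rw [mem_star]
    simp only [mem_iUnion, Finset.mem_filter, Finset.mem_univ, true_and, exists_prop]
    refine exists_congr fun v' => and_congr_right fun _ => ⟨fun h => ?_, fun h =>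
      openArm_subset_arm _ _ h⟩
    rcases mem_arm_cases h with rfl | h | rfl
    · exact absurd (Or.inl ⟨v', rfl⟩) hx
    · exact h
    · exact absurd (Or.inr ⟨v', rfl⟩) hx
  rw [measureReal_congr h1, measureReal_def, measure_biUnion_finset
    (fun v _ v' _ hv => openArm_disjoint (cut_le_len _ _) (cut_le_len _ _) hv)
    (fun v _ => (isOpen_openArm (cut_le_len α v)).measurableSet)]
  simp only [length_openArm]
  rw [← ENNReal.ofReal_sum_of_nonneg fun v _ => (cut_pos hα v).le,
    ENNReal.toReal_ofReal (Finset.sum_nonneg fun v _ => (cut_pos hα v).le)]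

theorem finite_closureComponents {α : ℝ} (hα : 0 < α) (h : Q.LeafCondition α) :
    (Q.closureComponents α).Finite := by
  rw [closureComponents_eq hα h]
  exact finite_range _

/-- This is what the second copies cost: they lengthen the tour by 2λ(E) in total. -/
theorem finsum_closureComponents {α : ℝ} (hα : 0 < α) (h : Q.LeafCondition α) :
    ∑ᶠ K ∈ Q.closureComponents α, Q.length.real K = Q.length.real (Q.extremitySet α) := by
  classical
  have hinj : ∀ v v' : Q.Leaf, star α v = star α v' ↔ attach α v = attach α v' := fun v v' =>
    ⟨fun hs => attach_eq_of_mem_star (attach_mem_star hα v) (hs ▸ attach_mem_star hα v),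
      star_congr⟩
  have hr : range (star α (Q := Q)) = ↑(Finset.univ.image (star α (Q := Q))) := by simp
  rw [closureComponents_eq hα h, length_extremitySet hα h, hr, finsum_mem_coe_finset]
  refine Finset.sum_image' _ fun v _ => ?_
  rw [length_star hα v]
  simp only [hinj]

/-! ### Consequences of the Leaf Condition for the lengths of branches -/

theorem exists_regular_mem_of_isOpen {U : Set Q.Point} (hU : IsOpen U) (hne : U.Nonempty) :
    ∃ x ∈ U, IsRegular x := by
  obtain ⟨x, hx⟩ := hne
  cases x with
  | inner e s => exact ⟨_, hx, e, s, rfl⟩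
  | node v =>
    obtain ⟨u, hu⟩ : ∃ u, u ≠ v := by
      have := Q.two_lt_card
      exact Fintype.exists_ne_of_one_lt_card (by omega) v
    obtain ⟨e, ⟨he, -⟩, -⟩ := existsUnique_separating_arc (Q := Q) hu.symm
    have h1 : ∀ᶠ t in nhds (0 : ℝ), ray v e t ∈ U := by
      have := (continuous_ray v e).tendsto 0
      rw [ray_zero he] at this
      exact this (hU.mem_nhds hx)
    have h2 : ∀ᶠ t in nhdsWithin (0 : ℝ) (Ioi 0), t ∈ Ioo 0 (Q.len e) :=
      Ioo_mem_nhdsGT (Q.len_pos e)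
    obtain ⟨t, h3, h4⟩ := ((h1.filter_mono nhdsWithin_le_nhds).and h2).exists
    exact ⟨_, h3, isRegular_ray h4⟩

/-- Depth below `t` and depth above `t` split the complement of the point into two open sets. Each
contains a connected component, that of an end of `e`, and outside `E` every component has length at
least α/2. Connectedness of the two sides is not needed. -/
theorem half_le_length_sides {α : ℝ} {u : V} {e : Q.Arc} (hu : u ∈ e.1) {t : ℝ}
    (ht : t ∈ Ioo 0 (Q.len e)) (hE : ray u e t ∉ Q.extremitySet α) :
    α / 2 ≤ Q.length.real {x | depth u e x < t} ∧ α / 2 ≤ Q.length.real {x | t < depth u e x} := by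
  have hcomp : ∀ y, y ≠ ray u e t →
      α / 2 ≤ Q.length.real (connectedComponentIn {ray u e t}ᶜ y) := by
    intro y hy
    by_contra! hlt
    exact hE ⟨isRegular_ray ht, y, hy, hlt⟩
  have ho1 : IsOpen {x : Q.Point | depth u e x < t} :=
    isOpen_lt (continuous_depth u e) continuous_const
  have ho2 : IsOpen {x : Q.Point | t < depth u e x} :=
    isOpen_lt continuous_const (continuous_depth u e)
  have hd : Disjoint {x : Q.Point | depth u e x < t} {x | t < depth u e x} := by
    rw [disjoint_left]
    intro x (h1 : depth u e x < t) (h2 : t < depth u e x)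
    exact lt_asymm h1 h2
  have hcov : ({ray u e t}ᶜ : Set Q.Point) ⊆ {x | depth u e x < t} ∪ {x | t < depth u e x} := by
    intro x hx
    rcases lt_trichotomy (depth u e x) t with h | h | h
    · exact Or.inl h
    · have h1 : coord e x ∈ Ioo 0 (Q.len e) := (coord_mem_Ioo_iff u).2 (h ▸ ht)
      exact absurd ((ray_depth (u := u) h1).symm.trans (by rw [h])) hx
    · exact Or.inr h
  have hdt := depth_ray u e (Ioo_subset_Icc_self ht)
  obtain ⟨w, hw, hwu, -⟩ := exists_ray_len hu
  constructor
  · have hne : Point.node u ≠ ray u e t := fun h => by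
      rw [← h, depth_node_self] at hdt
      exact ht.1.ne hdt
    refine (hcomp _ hne).trans (measureReal_mono ?_)
    refine IsPreconnected.subset_left_of_subset_union ho1 ho2 hd
      ((connectedComponentIn_subset _ _).trans hcov) ⟨.node u, mem_connectedComponentIn hne, ?_⟩
      isPreconnected_connectedComponentIn
    rw [mem_ofPred_eq, depth_node_self]
    exact ht.1
  · have hdw := depth_node_of_mem hu hw hwu
    have hne : Point.node w ≠ ray u e t := fun h => by
      rw [← h, hdw] at hdt
      exact ht.2.ne' hdt
    refine (hcomp _ hne).trans (measureReal_mono ?_)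
    refine IsPreconnected.subset_right_of_subset_union ho1 ho2 hd
      ((connectedComponentIn_subset _ _).trans hcov) ⟨.node w, mem_connectedComponentIn hne, ?_⟩
      isPreconnected_connectedComponentIn
    rw [mem_ofPred_eq, hdw]
    exact ht.2

/-- A regular point off the closure of `E` has two disjoint sides, each of length at least α/2. -/
theorem le_totalLength {α : ℝ} (hE : closure (Q.extremitySet α) ≠ univ) : α ≤ Q.totalLength := by
  have hne : (closure (Q.extremitySet α))ᶜ.Nonempty := nonempty_compl.2 hE
  obtain ⟨x, hx, hreg⟩ := exists_regular_mem_of_isOpen isClosed_closure.isOpen_compl hne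
  obtain ⟨e, he⟩ := isRegular_iff.1 hreg
  have hx' : x ∉ Q.extremitySet α := fun h => hx (subset_closure h)
  have hd := (coord_mem_Ioo_iff (tail e)).1 he
  rw [← ray_depth (u := tail e) he] at hx'
  obtain ⟨h1, h2⟩ := half_le_length_sides (tail_mem e) hd hx'
  have h3 : Q.length.real ({y | depth (tail e) e y < depth (tail e) e x} ∪
      {y | depth (tail e) e x < depth (tail e) e y}) =
      Q.length.real {y | depth (tail e) e y < depth (tail e) e x} +
      Q.length.real {y | depth (tail e) e x < depth (tail e) e y} := by
    refine measureReal_union ?_ (isOpen_lt continuous_const (continuous_depth _ _)).measurableSet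
    rw [disjoint_left]
    intro y (h4 : depth (tail e) e y < depth (tail e) e x)
      (h5 : depth (tail e) e x < depth (tail e) e y)
    exact lt_asymm h4 h5
  have h4 : Q.length.real ({y | depth (tail e) e y < depth (tail e) e x} ∪
      {y | depth (tail e) e x < depth (tail e) e y}) ≤ Q.length.real univ :=
    measureReal_mono (subset_univ _)
  rw [totalLength]
  linarith

theorem depth_add_depth {u w : V} {e : Q.Arc} (hu : u ∈ e.1) (hw : w ∈ e.1) (h : w ≠ u)
    (x : Q.Point) : depth u e x + depth w e x = Q.len e := by
  have h1 := coord_mem_Icc e x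
  rcases mem_arc_iff.1 hu with rfl | rfl <;> rcases mem_arc_iff.1 hw with rfl | rfl
  · exact absurd rfl h
  · rw [depth, depth, nodeCoord_tail, nodeCoord_head, sub_zero, abs_of_nonneg h1.1,
      abs_of_nonpos (by linarith [h1.2])]
    ring
  · rw [depth, depth, nodeCoord_tail, nodeCoord_head, sub_zero, abs_of_nonneg h1.1,
      abs_of_nonpos (by linarith [h1.2])]
    ring
  · exact absurd rfl h

/-- The points of the arc `f` that are close to its end `w` are not in the extremity set. -/
def NearEndFree (α : ℝ) (w : V) (f : Q.Arc) : Prop :=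
  ∃ ε, 0 < ε ∧ ε ≤ Q.len f ∧ ∀ t ∈ Ioo 0 ε, ray w f t ∉ Q.extremitySet α

/-- An open arm starts at a leaf node, so it can reach the inner node `w` along `f` only by filling
the whole leaf arc. -/
theorem nearEndFree_or {α : ℝ} (hα : 0 < α) (h : Q.LeafCondition α) {w : V} (hw : ¬ Q.IsLeaf w)
    {f : Q.Arc} (hf : w ∈ f.1) :
    NearEndFree α w f ∨ ∃ v : Q.Leaf, leafArc v = f ∧ cut α v = Q.len f := by
  by_cases hv : ∃ v : Q.Leaf, leafArc v = f
  · obtain ⟨v, rfl⟩ := hv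
    have hwv : w ≠ v.1 := fun h' => hw (h' ▸ v.2)
    have hc0 := cut_pos hα v
    rcases (cut_le_len α v).eq_or_lt with hc | hc
    · exact Or.inr ⟨v, rfl, hc⟩
    · left
      refine ⟨Q.len (leafArc v) - cut α v, by linarith, by linarith, fun t ht hE => ?_⟩
      rw [extremitySet_eq h, mem_iUnion] at hE
      obtain ⟨v', hv'⟩ := hE
      have ht' : t ∈ Ioo 0 (Q.len (leafArc v)) := ⟨ht.1, by linarith [ht.2]⟩
      rw [mem_openArm_iff (cut_le_len _ _)] at hv'
      have he := leafArc_injective (eq_of_coord_mem hv'.1 (coord_ray_mem ht'))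
      subst he
      have h1 := depth_add_depth (mem_leafArc v') hf hwv (ray w (leafArc v') t)
      rw [depth_ray w _ (Ioo_subset_Icc_self ht')] at h1
      linarith [hv'.2, ht.2]
  · left
    refine ⟨Q.len f, Q.len_pos f, le_rfl, fun t ht hE => ?_⟩
    rw [extremitySet_eq h, mem_iUnion] at hE
    obtain ⟨v, hv'⟩ := hE
    exact hv ⟨v, eq_of_coord_mem ((mem_openArm_iff (cut_le_len _ _)).1 hv').1 (coord_ray_mem ht)⟩

theorem half_le_length_branch {α : ℝ} {w : V} {f : Q.Arc} (hf : w ∈ f.1)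
    (hnear : NearEndFree α w f) : α / 2 ≤ Q.length.real (branch w f) := by
  obtain ⟨ε, h0, h1, h2⟩ := hnear
  have ht : ε / 2 ∈ Ioo 0 ε := ⟨by linarith, by linarith⟩
  refine (half_le_length_sides hf ⟨ht.1, ht.2.trans_le h1⟩ (h2 _ ht)).2.trans (measureReal_mono ?_)
  intro x (hx : ε / 2 < depth w f x)
  exact ht.1.trans hx

/-- If points of `f` near `w` avoid `E`, let them tend to `w` in `half_le_length_sides`. Otherwise
the branch is a whole leaf arc of length at most α/2, while μ ≥ α. -/
theorem half_le_length_compl_branch {α : ℝ} (hα : 0 < α) (h : Q.LeafCondition α)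
    (hE : closure (Q.extremitySet α) ≠ univ) {w : V} (hw : ¬ Q.IsLeaf w) {f : Q.Arc}
    (hf : w ∈ f.1) : α / 2 ≤ Q.length.real (branch w f)ᶜ := by
  rcases nearEndFree_or hα h hw hf with ⟨ε, h0, h1, h2⟩ | ⟨v, rfl, hc⟩
  · refine le_of_forall_pos_le_add fun δ hδ => ?_
    -- The near side exceeds the complement of the branch by at most the length `t` ≤ `δ`.
    set t := min (ε / 2) δ with ht
    have ht0 : 0 < t := lt_min (by linarith) hδ
    have htε : t < ε := (min_le_left _ _).trans_lt (by linarith)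
    have h3 := (half_le_length_sides hf ⟨ht0, htε.trans_le h1⟩ (h2 _ ⟨ht0, htε⟩)).1
    have hsub : {x : Q.Point | depth w f x < t} ⊆ (branch w f)ᶜ ∪ ray w f '' Ioo 0 t := by
      intro x (hx : depth w f x < t)
      by_cases hb : x ∈ branch w f
      · refine Or.inr ⟨_, ⟨hb, hx⟩, ray_depth ((coord_mem_Ioo_iff w).2 ⟨hb, ?_⟩)⟩
        linarith
      · exact Or.inl hb
    have h4 := (measureReal_mono (μ := Q.length) hsub).trans (measureReal_union_le _ _)
    have h5 : Q.length.real (ray w f '' Ioo 0 t) = t := by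
      rw [measureReal_def, (length_ray_image w f le_rfl (htε.le.trans h1)).2, sub_zero,
        ENNReal.toReal_ofReal ht0.le]
    have h6 : t ≤ δ := min_le_right _ _
    linarith
  · have hwv : w ≠ v.1 := fun h' => hw (h' ▸ v.2)
    have hsub : branch w (leafArc v) ⊆ openArm v (cut α v) ∪ {.node v.1} := by
      intro x (hx : 0 < depth w (leafArc v) x)
      have h1 := depth_add_depth (mem_leafArc v) hf hwv x
      exact (depth_lt_iff (cut_pos hα v) (cut_le_len α v)).1 (by linarith)
    have h1 := (measureReal_mono (μ := Q.length) hsub).trans (measureReal_union_le _ _)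
    have h2 : Q.length.real (openArm v (cut α v)) = cut α v := by
      rw [measureReal_def, length_openArm, ENNReal.toReal_ofReal (cut_pos hα v).le]
    have h3 : Q.length.real {Point.node v.1} = 0 := by
      rw [measureReal_def, measure_singleton, ENNReal.toReal_zero]
    have h4 := measureReal_compl (μ := Q.length) (isOpen_branch w (leafArc v)).measurableSet
    have h5 := le_totalLength hE
    have h6 := cut_le α v
    rw [totalLength] at h5
    linarith

/-! ### Measurability of interception -/

instance : CompactSpace Q.Point where
  isCompact_univ := by
    have : (univ : Set Q.Point) =
        range (Point.node : V → Q.Point) ∪ ⋃ e : Q.Arc, onArc e '' Icc 0 (Q.len e) := by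
      refine (eq_univ_of_forall fun x => ?_).symm
      cases x with
      | node v => exact Or.inl ⟨v, rfl⟩
      | inner e s =>
        exact Or.inr (mem_iUnion.2 ⟨e, s, Ioo_subset_Icc_self s.2, onArc_of_mem s.2⟩)
    rw [this]
    exact (finite_range _).isCompact.union
      (isCompact_iUnion fun e => isCompact_Icc.image (continuous_onArc e))

instance : SecondCountableTopology Q.Point := UniformSpace.secondCountable_of_separable _

/-- Patrols carry the product σ-algebra. Evaluation is measurable in the patrol and continuous in
time, hence jointly measurable. -/
theorem measurable_eval_patrol : Measurable fun p : ℝ≥0 × Q.Patrol => p.2.1 p.1 :=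
  measurable_uncurry_of_continuous_of_measurable (u := fun (t : ℝ≥0) (S : Q.Patrol) => S.1 t)
    (fun S => S.2.continuous) fun t => (measurable_pi_apply t).comp measurable_subtype_coe

/-- By compactness of the attack interval, interception means coming arbitrarily close to the target
during it, and countably many times suffice to test this. -/
theorem measurableSet_intercepts {α : ℝ} (hα : 0 ≤ α) :
    MeasurableSet {p : Q.Patrol × Q.Attack | Intercepts α p.1 p.2} := by
  -- A dense sequence of `ℝ≥0`, truncated so that it lies in [0, α].
  set r : ℕ → ℝ≥0 := fun n => min (TopologicalSpace.denseSeq ℝ≥0 n) α.toNNReal with hr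
  have heq : {p : Q.Patrol × Q.Attack | Intercepts α p.1 p.2} =
      ⋂ k : ℕ, ⋃ n : ℕ, {p | dist (p.1.1 (p.2.2 + r n)) p.2.1 < 1 / ((k : ℝ) + 1)} := by
    ext ⟨S, x, τ⟩
    simp only [mem_ofPred_eq, mem_iInter, mem_iUnion]
    constructor
    · rintro ⟨t, h1, h2, h3⟩ k
      have hc : Continuous fun s : ℝ≥0 => dist (S.1 (τ + min s α.toNNReal)) x :=
        (S.2.continuous.comp (by fun_prop)).dist continuous_const
      have h1' : τ ≤ t := h1
      have hmem : t - τ ∈ {s : ℝ≥0 | dist (S.1 (τ + min s α.toNNReal)) x < 1 / ((k : ℝ) + 1)} := by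
        have h4 : t - τ ≤ α.toNNReal := by
          rw [← NNReal.coe_le_coe, NNReal.coe_sub h1', Real.coe_toNNReal _ hα]
          linarith
        rw [mem_ofPred_eq, min_eq_left h4, add_tsub_cancel_of_le h1', show S.1 t = x from h3,
          dist_self]
        positivity
      obtain ⟨n, hn⟩ := (TopologicalSpace.denseRange_denseSeq ℝ≥0).exists_mem_open
        (isOpen_lt hc continuous_const) ⟨_, hmem⟩
      exact ⟨n, hn⟩
    · intro h
      have hc : ContinuousOn (fun s : ℝ≥0 => dist (S.1 (τ + s)) x) (Icc 0 α.toNNReal) :=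
        ((S.2.continuous.comp (by fun_prop)).dist continuous_const).continuousOn
      obtain ⟨s, hs, hmin⟩ := isCompact_Icc.exists_isMinOn ⟨0, by simp⟩ hc
      refine ⟨τ + s, by simp, ?_, ?_⟩
      · have : (s : ℝ) ≤ α := by
          rw [← Real.coe_toNNReal α hα]
          exact_mod_cast hs.2
        push_cast
        linarith
      · refine dist_le_zero.1 (le_of_forall_pos_lt_add fun ε hε => ?_)
        obtain ⟨k, hk⟩ := exists_nat_one_div_lt hε
        obtain ⟨n, hn⟩ := h k
        have : dist (S.1 (τ + s)) x ≤ dist (S.1 (τ + r n)) x :=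
          hmin (show r n ∈ Icc 0 α.toNNReal from ⟨zero_le, min_le_right _ _⟩)
        rw [zero_add]
        exact (this.trans_lt hn).trans hk
  rw [heq]
  refine MeasurableSet.iInter fun k => MeasurableSet.iUnion fun n => measurableSet_lt ?_ measurable_const
  refine Measurable.dist (measurable_eval_patrol.comp
    (Measurable.prodMk ?_ measurable_fst)) (measurable_fst.comp measurable_snd)
  exact (measurable_snd.comp measurable_snd).add_const _

/-! ### Guarantees of mixed strategies -/

/-- Fubini reduces mixed attacks to pure ones; `attackGuarantee_le` does the same for patrols. -/
theorem le_patrolGuarantee {α : ℝ} (hα : 0 ≤ α) {σ : Measure Q.Patrol} [IsProbabilityMeasure σ]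
    {c : ℝ≥0∞} (h : ∀ a, c ≤ σ {S | Intercepts α S a}) : c ≤ patrolGuarantee α σ := by
  refine le_iInf fun ρ => ?_
  rw [payoff, Measure.prod_apply_symm (measurableSet_intercepts hα)]
  calc c = ∫⁻ _, c ∂(ρ : Measure Q.Attack) := by simp
    _ ≤ _ := lintegral_mono fun a => h a

theorem attackGuarantee_le {α : ℝ} (hα : 0 ≤ α) {ρ : Measure Q.Attack} [IsProbabilityMeasure ρ]
    {c : ℝ≥0∞} (h : ∀ S, ρ {a | Intercepts α S a} ≤ c) : attackGuarantee α ρ ≤ c := by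
  refine iSup_le fun σ => ?_
  rw [payoff, Measure.prod_apply (measurableSet_intercepts hα)]
  calc _ ≤ ∫⁻ _, c ∂(σ : Measure Q.Patrol) := lintegral_mono fun a => h a
    _ = c := by simp

/-- Weak duality. A patrol and an attack that guarantee the same number are therefore both optimal,
and that number is the value. -/
theorem patrolGuarantee_le_attackGuarantee (α : ℝ) (σ : ProbabilityMeasure Q.Patrol)
    (ρ : ProbabilityMeasure Q.Attack) :
    patrolGuarantee α (σ : Measure Q.Patrol) ≤ attackGuarantee α (ρ : Measure Q.Attack) :=
  (iInf_le _ ρ).trans (le_iSup (fun σ : ProbabilityMeasure Q.Patrol =>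
    payoff α (σ : Measure Q.Patrol) (ρ : Measure Q.Attack)) σ)

theorem patrollerOptimal_of_le {α : ℝ} {c : ℝ≥0∞} {σ : Measure Q.Patrol} [hσ : IsProbabilityMeasure σ]
    {ρ : Measure Q.Attack} [hρ : IsProbabilityMeasure ρ] (h1 : c ≤ patrolGuarantee α σ)
    (h2 : attackGuarantee α ρ ≤ c) : PatrollerOptimal α σ :=
  ⟨hσ, fun σ' => (patrolGuarantee_le_attackGuarantee α σ' ⟨ρ, hρ⟩).trans (h2.trans h1)⟩

theorem attackerOptimal_of_le {α : ℝ} {c : ℝ≥0∞} {σ : Measure Q.Patrol} [hσ : IsProbabilityMeasure σ]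
    {ρ : Measure Q.Attack} [hρ : IsProbabilityMeasure ρ] (h1 : c ≤ patrolGuarantee α σ)
    (h2 : attackGuarantee α ρ ≤ c) : AttackerOptimal α ρ :=
  ⟨hρ, fun ρ' => h2.trans (h1.trans (patrolGuarantee_le_attackGuarantee α ⟨σ, hσ⟩ ρ'))⟩

theorem isValue_of_le {α w : ℝ} {σ : Measure Q.Patrol} [hσ : IsProbabilityMeasure σ]
    {ρ : Measure Q.Attack} [hρ : IsProbabilityMeasure ρ]
    (h1 : ENNReal.ofReal w ≤ patrolGuarantee α σ) (h2 : attackGuarantee α ρ ≤ ENNReal.ofReal w) :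
    Q.IsValue α w := by
  constructor
  · refine le_antisymm (iSup_le fun σ' =>
      (patrolGuarantee_le_attackGuarantee α σ' ⟨ρ, hρ⟩).trans h2) (h1.trans ?_)
    exact le_iSup (fun σ : ProbabilityMeasure Q.Patrol => patrolGuarantee α (σ : Measure Q.Patrol))
      ⟨σ, hσ⟩
  · refine le_antisymm ((?_ : _ ≤ attackGuarantee α ρ).trans h2) (le_iInf fun ρ' =>
      h1.trans (patrolGuarantee_le_attackGuarantee α ⟨σ, hσ⟩ ρ'))
    exact iInf_le (fun ρ : ProbabilityMeasure Q.Attack => attackGuarantee α (ρ : Measure Q.Attack))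
      ⟨ρ, hρ⟩

/-! ### Lipschitz images -/

/-- Lebesgue measure on the line is one-dimensional Hausdorff measure. -/
theorem volume_image_le {f : ℝ → ℝ} {s : Set ℝ} (hf : LipschitzOnWith 1 f s) :
    volume (f '' s) ≤ volume s := by
  have := hf.hausdorffMeasure_image_le (d := 1) zero_le_one
  simpa [hausdorffMeasure_real] using this

/-- A unit speed path covers at most as much length as the time it takes. -/
theorem length_inter_image_le {f : ℝ → Q.Point} (hf : LipschitzWith 1 f) {B : Set Q.Point}
    (hB : MeasurableSet B) (a b : ℝ) :
    Q.length (B ∩ f '' Icc a b) ≤ volume (Icc a b ∩ f ⁻¹' B) := by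
  have hI : MeasurableSet (f '' Icc a b) := (isCompact_Icc.image hf.continuous).measurableSet
  rw [length_apply (hB.inter hI)]
  -- Times spent inside different arcs are disjoint, and on each arc the position is a 1-Lipschitz
  -- function of time.
  set T : Q.Arc → Set ℝ := fun e =>
    Icc a b ∩ f ⁻¹' B ∩ f ⁻¹' (coord e ⁻¹' Ioo 0 (Q.len e)) with hT
  have hTm : ∀ e, MeasurableSet (T e) := fun e =>
    (measurableSet_Icc.inter (hf.continuous.measurable hB)).inter
      ((isOpen_Ioo.preimage (continuous_coord e)).preimage hf.continuous).measurableSet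
  calc ∑ e, volume (onArc e ⁻¹' (B ∩ f '' Icc a b) ∩ Ioo 0 (Q.len e))
      ≤ ∑ e, volume (T e) := by
        refine Finset.sum_le_sum fun e _ => ?_
        have hlip : LipschitzOnWith 1 (fun s => coord e (f s)) (T e) := by
          have := (lipschitz_coord e).comp hf
          rw [one_mul] at this
          exact this.lipschitzOnWith
        refine (measure_mono ?_).trans (volume_image_le hlip)
        rintro t ⟨⟨h1, s, h2, h3⟩, h4⟩
        have h5 : coord e (f s) = t := by rw [h3, coord_onArc (Ioo_subset_Icc_self h4)]
        refine ⟨s, ⟨⟨h2, ?_⟩, ?_⟩, h5⟩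
        · rw [mem_preimage, h3]; exact h1
        · rw [mem_preimage, mem_preimage, h5]; exact h4
    _ = volume (⋃ e ∈ (Finset.univ : Finset Q.Arc), T e) := by
        refine (measure_biUnion_finset ?_ fun e _ => hTm e).symm
        intro e _ e' _ hne
        refine disjoint_left.2 fun s h1 h2 => hne (eq_of_coord_mem h1.2 h2.2)
    _ ≤ volume (Icc a b ∩ f ⁻¹' B) :=
        measure_mono (iUnion₂_subset fun e _ => inter_subset_left)

/-! ### The attack strategy -/

/-- `F` is the set of visits to a leaf node. On the left are the starting times of intercepted
attacks, on the right the times of [M, M + α] within `e` of a visit. -/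
theorem volume_gain_le {F : Set ℝ} (hF : IsClosed F) {e α M : ℝ} (he : 0 < e) (heα : 2 * e ≤ α) :
    volume (Icc (M - e) (M + e) ∩ {τ | ∃ t ∈ F, τ ≤ t ∧ t ≤ τ + α}) ≤
      volume {s | s ∈ Icc M (M + α) ∧ ∃ t ∈ F, |s - t| < e} := by
  set H := {s | s ∈ Icc M (M + α) ∧ ∃ t ∈ F, |s - t| < e} with hH
  have hG : volume (Icc (M - e) (M + e) ∩ {τ | ∃ t ∈ F, τ ≤ t ∧ t ≤ τ + α}) ≤
      ENNReal.ofReal (2 * e) := by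
    refine (measure_mono inter_subset_left).trans ?_
    rw [Real.volume_Icc]
    exact ENNReal.ofReal_le_ofReal (by linarith)
  -- A visit at such a time has its whole `e`-neighbourhood inside [M, M + α]; this already provides
  -- 2e, the most that can be gained.
  by_cases hmid : ∃ t ∈ F, t ∈ Icc (M + e) (M + α - e)
  · obtain ⟨t, htF, ht⟩ := hmid
    refine hG.trans ?_
    have : Ioo (t - e) (t + e) ⊆ H := fun s hs =>
      ⟨⟨by linarith [hs.1, ht.1], by linarith [hs.2, ht.2]⟩, t, htF,
        abs_lt.2 ⟨by linarith [hs.1], by linarith [hs.2]⟩⟩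
    refine le_trans ?_ (measure_mono this)
    rw [Real.volume_Ioo]
    exact ENNReal.ofReal_le_ofReal (by linarith)
  · push Not at hmid
    -- Now only the last early visit `t₁` and the first late visit `t₂` matter. In the absence of
    -- such visits, the values M - e and M + α + e make the corresponding intervals trivial.
    obtain ⟨t₁, h1, h1F, h1H⟩ : ∃ t₁, t₁ ∈ Icc (M - e) (M + e) ∧
        (∀ t ∈ F, t ∈ Icc (M - e) (M + e) → t ≤ t₁) ∧ Ioo M (t₁ + e) ⊆ H := by
      by_cases hne : (F ∩ Icc (M - e) (M + e)).Nonempty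
      · obtain ⟨t₁, h1, h2⟩ := (isCompact_Icc.inter_left hF).exists_isGreatest hne
        refine ⟨t₁, h1.2, fun t htF ht => h2 ⟨htF, ht⟩, ?_⟩
        have hlt : t₁ < M + e := by
          refine lt_of_le_of_ne h1.2.2 fun h => hmid t₁ h1.1 ⟨h.ge, by linarith⟩
        by_contra hsub
        obtain ⟨s, hs, hsH⟩ := not_subset.1 hsub
        exact hsH ⟨⟨hs.1.le, by linarith [hs.2]⟩, t₁, h1.1,
          abs_lt.2 ⟨by linarith [hs.1], by linarith [hs.2]⟩⟩
      · refine ⟨M - e, ⟨le_rfl, by linarith⟩, fun t htF ht => absurd ⟨t, htF, ht⟩ hne, ?_⟩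
        simp
    obtain ⟨t₂, h2, h2F, h2H⟩ : ∃ t₂, t₂ ∈ Icc (M + α - e) (M + α + e) ∧
        (∀ t ∈ F, t ∈ Icc (M + α - e) (M + α + e) → t₂ ≤ t) ∧ Ioo (t₂ - e) (M + α) ⊆ H := by
      by_cases hne : (F ∩ Icc (M + α - e) (M + α + e)).Nonempty
      · obtain ⟨t₂, h1, h2⟩ := (isCompact_Icc.inter_left hF).exists_isLeast hne
        refine ⟨t₂, h1.2, fun t htF ht => h2 ⟨htF, ht⟩, ?_⟩
        have hlt : M + α - e < t₂ := by
          refine lt_of_le_of_ne h1.2.1 fun h => hmid t₂ h1.1 ⟨by linarith, h.ge⟩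
        by_contra hsub
        obtain ⟨s, hs, hsH⟩ := not_subset.1 hsub
        exact hsH ⟨⟨by linarith [hs.1], hs.2.le⟩, t₂, h1.1,
          abs_lt.2 ⟨by linarith [hs.1], by linarith [hs.2]⟩⟩
      · refine ⟨M + α + e, ⟨by linarith, le_rfl⟩, fun t htF ht => absurd ⟨t, htF, ht⟩ hne, ?_⟩
        simp
    by_cases hcase : t₁ + e ≤ t₂ - e
    -- Early visits catch the starts up to `t₁`, late ones the starts from `t₂ - α`. These two
    -- intervals have the lengths of the disjoint intervals (M, t₁ + e) and (t₂ - e, M + α).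
    · have hsub : Icc (M - e) (M + e) ∩ {τ | ∃ t ∈ F, τ ≤ t ∧ t ≤ τ + α} ⊆
          Icc (M - e) t₁ ∪ Icc (t₂ - α) (M + e) := by
        rintro τ ⟨h3, t, htF, h4, h5⟩
        rcases lt_or_ge t (M + e) with h6 | h6
        · exact Or.inl ⟨h3.1, h4.trans (h1F t htF ⟨by linarith [h3.1], h6.le⟩)⟩
        · have h7 : M + α - e < t := by
            by_contra! h8
            exact hmid t htF ⟨h6, h8⟩
          exact Or.inr ⟨by linarith [h2F t htF ⟨h7.le, by linarith [h3.2]⟩], h3.2⟩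
      have hdisj : Disjoint (Ioo M (t₁ + e)) (Ioo (t₂ - e) (M + α)) :=
        disjoint_left.2 fun s hs hs' => by linarith [hs.2, hs'.1]
      calc _ ≤ volume (Icc (M - e) t₁) + volume (Icc (t₂ - α) (M + e)) :=
            (measure_mono hsub).trans (measure_union_le _ _)
        _ = volume (Ioo M (t₁ + e)) + volume (Ioo (t₂ - e) (M + α)) := by
            rw [Real.volume_Icc, Real.volume_Icc, Real.volume_Ioo, Real.volume_Ioo]
            congr 2 <;> ring
        _ = volume (Ioo M (t₁ + e) ∪ Ioo (t₂ - e) (M + α)) :=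
            (measure_union hdisj measurableSet_Ioo).symm
        _ ≤ _ := measure_mono (union_subset h1H h2H)
    · refine hG.trans ?_
      -- The neighbourhoods of the two visits overlap and fill (M, M + α), of length α ≥ 2e.
      have : Ioo M (M + α) ⊆ H := by
        intro s hs
        rcases lt_or_ge s (t₁ + e) with h3 | h3
        · exact h1H ⟨hs.1, h3⟩
        · exact h2H ⟨by linarith, hs.2⟩
      refine le_trans ?_ (measure_mono this)
      rw [Real.volume_Ioo]
      exact ENNReal.ofReal_le_ofReal (by linarith)

/-- The time that the patrol `f` spends in `Eᶜ` and near the leaf nodes during `[M, M + α]`. -/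
theorem attack_gain_le {α : ℝ} (hα : 0 < α) (h : Q.LeafCondition α) {f : ℝ → Q.Point}
    (hf : LipschitzWith 1 f) (M : ℝ) :
    Q.length ((Q.extremitySet α)ᶜ ∩ f '' Icc M (M + α)) +
      ∑ v : Q.Leaf, volume (Icc (M - cut α v) (M + cut α v) ∩
        {τ | ∃ t ∈ f ⁻¹' {.node v.1}, τ ≤ t ∧ t ≤ τ + α}) ≤ ENNReal.ofReal α := by
  -- `D v` is the open arm together with its leaf node: exactly the points that a unit speed path
  -- can occupy within time less than e_v of being at `v`.
  set D : Q.Leaf → Set Q.Point := fun v => {x | depth v.1 (leafArc v) x < cut α v} with hD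
  have hDo : ∀ v, IsOpen (D v) := fun v => isOpen_lt (continuous_depth _ _) continuous_const
  have hDmem : ∀ v x, x ∈ D v ↔ x ∈ openArm v (cut α v) ∨ x = .node v.1 := fun v x =>
    depth_lt_iff (cut_pos hα v) (cut_le_len α v)
  set B : Set Q.Point := (⋃ v, D v)ᶜ with hBdef
  have hB : MeasurableSet B := (isOpen_iUnion hDo).measurableSet.compl
  have h1 : Q.length ((Q.extremitySet α)ᶜ ∩ f '' Icc M (M + α)) ≤
      volume (Icc M (M + α) ∩ f ⁻¹' B) := by
    refine le_trans ?_ (length_inter_image_le hf hB M (M + α))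
    refine measure_mono_ae ?_
    have h0 := (finite_range fun v : Q.Leaf => Point.node (Q := Q) v.1).measure_zero Q.length
    rw [measure_eq_zero_iff_ae_notMem] at h0
    filter_upwards [h0] with x hx
    rintro ⟨h2, h3⟩
    refine ⟨fun hx' => ?_, h3⟩
    obtain ⟨v, hv⟩ := mem_iUnion.1 hx'
    rcases (hDmem v x).1 hv with h4 | rfl
    · exact h2 (by rw [extremitySet_eq h]; exact mem_iUnion.2 ⟨v, h4⟩)
    · exact hx ⟨v, rfl⟩
  have h2 : ∀ v : Q.Leaf, volume (Icc (M - cut α v) (M + cut α v) ∩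
        {τ | ∃ t ∈ f ⁻¹' {.node v.1}, τ ≤ t ∧ t ≤ τ + α}) ≤
      volume (Icc M (M + α) ∩ f ⁻¹' D v) := by
    intro v
    refine (volume_gain_le (isClosed_singleton.preimage hf.continuous) (cut_pos hα v)
      (by linarith [cut_le α v])).trans (measure_mono ?_)
    rintro s ⟨hs, t, ht, hst⟩
    refine ⟨hs, ?_⟩
    have h3 := (lipschitz_depth v.1 (leafArc v)).dist_le_mul (f s) (f t)
    have h4 := hf.dist_le_mul s t
    rw [show f t = .node v.1 from ht, Real.dist_eq, depth_node_self, sub_zero,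
      abs_of_nonneg (depth_nonneg _ _ _)] at h3
    rw [show f t = .node v.1 from ht] at h4
    rw [NNReal.coe_one, one_mul] at h3 h4
    exact (h3.trans h4).trans_lt hst
  have hDd : ∀ v v', v ≠ v' → Disjoint (D v) (D v') := by
    intro v v' hne
    refine disjoint_left.2 fun x hx hx' => ?_
    rcases (hDmem v x).1 hx with h3 | rfl <;> rcases (hDmem v' _).1 hx' with h4 | h4
    · exact disjoint_left.1 (openArm_disjoint (cut_le_len _ _) (cut_le_len _ _) hne) h3 h4
    · exact not_isRegular_node _ (h4 ▸ isRegular_of_mem_openArm (cut_le_len _ _) h3)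
    · exact not_isRegular_node _ (isRegular_of_mem_openArm (cut_le_len _ _) h4)
    · injection h4 with h4
      exact hne (Subtype.ext h4)
  have hDm : ∀ v, MeasurableSet (Icc M (M + α) ∩ f ⁻¹' D v) := fun v =>
    measurableSet_Icc.inter ((hDo v).preimage hf.continuous).measurableSet
  calc _ ≤ volume (Icc M (M + α) ∩ f ⁻¹' B) + ∑ v, volume (Icc M (M + α) ∩ f ⁻¹' D v) :=
        add_le_add h1 (Finset.sum_le_sum fun v _ => h2 v)
    _ = volume (Icc M (M + α) ∩ f ⁻¹' B) +
        volume (⋃ v ∈ (Finset.univ : Finset Q.Leaf), Icc M (M + α) ∩ f ⁻¹' D v) := by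
        rw [measure_biUnion_finset _ fun v _ => hDm v]
        intro v _ v' _ hne
        exact ((hDd v v' hne).preimage f).mono inter_subset_right inter_subset_right
    _ = volume ((Icc M (M + α) ∩ f ⁻¹' B) ∪
        ⋃ v ∈ (Finset.univ : Finset Q.Leaf), Icc M (M + α) ∩ f ⁻¹' D v) := by
        refine (measure_union ?_ (Finset.measurableSet_biUnion _ fun v _ => hDm v)).symm
        refine disjoint_left.2 fun s hs hs' => ?_
        simp only [mem_iUnion] at hs'
        obtain ⟨v, -, hv⟩ := hs'
        exact hs.2 (mem_iUnion.2 ⟨v, hv.2⟩)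
    _ ≤ volume (Icc M (M + α)) := by
        refine measure_mono (union_subset inter_subset_left (iUnion₂_subset fun v _ =>
          inter_subset_left))
    _ = ENNReal.ofReal α := by rw [Real.volume_Icc, add_sub_cancel_left]

theorem length_extremitySet_compl {α : ℝ} (h : Q.LeafCondition α) :
    Q.length.real (Q.extremitySet α)ᶜ = Q.totalLength - Q.length.real (Q.extremitySet α) :=
  measureReal_compl (isOpen_extremitySet h).measurableSet

theorem length_extremitySet_le (α : ℝ) : Q.length.real (Q.extremitySet α) ≤ Q.totalLength :=
  measureReal_mono (subset_univ _)

/-- The normalization of the uniform law cancels its weight. An inequality also covers a null set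
`A`, where the conditional measure is zero. -/
theorem ofReal_mul_cond_le {Ω : Type*} [MeasurableSpace Ω] (μ : Measure Ω) {A B : Set Ω}
    (hA : MeasurableSet A) {m N : ℝ} (hN : 0 < N) (hm : μ A = ENNReal.ofReal m) :
    ENNReal.ofReal (m / N) * ProbabilityTheory.cond μ A B ≤ μ (A ∩ B) / ENNReal.ofReal N := by
  rw [ProbabilityTheory.cond_apply hA, hm, ENNReal.ofReal_div_of_pos hN, ENNReal.div_eq_inv_mul,
    ENNReal.div_eq_inv_mul, mul_assoc, ← mul_assoc (ENNReal.ofReal m)]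
  gcongr
  calc _ ≤ 1 * μ (A ∩ B) := by gcongr; exact ENNReal.mul_inv_le_one _
    _ = _ := one_mul _

theorem cond_univ_of_pos {Ω : Type*} [MeasurableSpace Ω] (μ : Measure Ω) {A : Set Ω} {m : ℝ}
    (h0 : 0 < m) (hm : μ A = ENNReal.ofReal m) : ProbabilityTheory.cond μ A univ = 1 := by
  have h1 : μ A ≠ 0 := by rw [hm]; simpa using h0
  have h2 : μ A ≠ ⊤ := by rw [hm]; exact ENNReal.ofReal_ne_top
  rw [ProbabilityTheory.cond, Measure.smul_apply, Measure.restrict_apply_univ, smul_eq_mul,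
    ENNReal.inv_mul_cancel h1 h2]

section

variable {α : ℝ}

theorem volume_attack_window (v : Q.Leaf) (M : ℝ) :
    volume (Icc (M - cut α v) (M + cut α v)) = ENNReal.ofReal (2 * cut α v) := by
  rw [Real.volume_Icc]
  congr 1
  ring

theorem totalLength_pos (hα : 0 < α) (hα' : α < 2 * Q.totalLength) : 0 < Q.totalLength := by
  linarith

theorem isProbabilityMeasure_eAttack (hα : 0 < α) (hα' : α < 2 * Q.totalLength)
    (h : Q.LeafCondition α) : IsProbabilityMeasure (Q.eAttack α) := by
  constructor
  set N := Q.totalLength + Q.length.real (Q.extremitySet α) with hN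
  have hN0 : 0 < N := add_pos_of_pos_of_nonneg (totalLength_pos hα hα') measureReal_nonneg
  rw [eAttack]
  simp only [Measure.add_apply, Measure.smul_apply, Measure.coe_finsetSum, Finset.sum_apply,
    smul_eq_mul, leafLength_eq hα h, ← hN]
  have h1 : ENNReal.ofReal (Q.length.real (Q.extremitySet α)ᶜ / N) *
      ((ProbabilityTheory.cond Q.length (Q.extremitySet α)ᶜ).prod
        (Measure.dirac (Q.maxLeafLength α).toNNReal)) univ =
      ENNReal.ofReal (Q.length.real (Q.extremitySet α)ᶜ / N) := by
    -- If λ(Eᶜ) = 0 the conditional measure is not a probability, but its weight vanishes.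
    rcases (measureReal_nonneg (μ := Q.length) (s := (Q.extremitySet α)ᶜ)).eq_or_lt with h0 | h0
    · rw [← h0]; simp
    · rw [← univ_prod_univ, Measure.prod_prod, cond_univ_of_pos _ h0 (by simp)]
      simp
  have h2 : ∀ v : Q.Leaf, ENNReal.ofReal (2 * cut α v / N) *
      ((Measure.dirac (Point.node (Q := Q) v.1)).prod
        ((ProbabilityTheory.cond volume (Icc (Q.maxLeafLength α - cut α v)
          (Q.maxLeafLength α + cut α v))).map Real.toNNReal)) univ =
      ENNReal.ofReal (2 * cut α v / N) := by
    intro v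
    have h0 := cut_pos hα v
    rw [← univ_prod_univ, Measure.prod_prod, Measure.map_apply measurable_real_toNNReal
      MeasurableSet.univ, preimage_univ, cond_univ_of_pos _ (by linarith : 0 < 2 * cut α v)
      (volume_attack_window v _)]
    simp
  rw [h1, Finset.sum_congr rfl fun v _ => h2 v, ← ENNReal.ofReal_sum_of_nonneg fun v _ => ?_,
    ← ENNReal.ofReal_add (div_nonneg measureReal_nonneg hN0.le) (Finset.sum_nonneg fun v _ => ?_)]
  · rw [← ENNReal.ofReal_one]
    congr 1
    rw [← Finset.sum_div, ← Finset.mul_sum, ← length_extremitySet hα h, ← add_div,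
      length_extremitySet_compl h, div_eq_one_iff_eq hN0.ne']
    ring
  all_goals exact div_nonneg (by linarith [cut_pos hα v]) hN0.le

/-- Hence all starting times of the attack are nonnegative, and `Real.toNNReal` does not truncate
them. -/
theorem cut_le_maxLeafLength (hα : 0 < α) (h : Q.LeafCondition α) (v : Q.Leaf) :
    cut α v ≤ Q.maxLeafLength α := by
  rw [← leafLength_eq hα h v, maxLeafLength]
  exact le_ciSup (f := fun v : Q.Leaf => Q.leafLength α v.1) (finite_range _).bddAbove v

theorem maxLeafLength_nonneg (α : ℝ) : 0 ≤ Q.maxLeafLength α :=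
  Real.iSup_nonneg fun _ => measureReal_nonneg

theorem eAttack_intercepts_le (hα : 0 < α) (hα' : α < 2 * Q.totalLength)
    (h : Q.LeafCondition α) (S : Q.Patrol) :
    Q.eAttack α {a | Intercepts α S a} ≤
      ENNReal.ofReal (α / (Q.totalLength + Q.length.real (Q.extremitySet α))) := by
  set N := Q.totalLength + Q.length.real (Q.extremitySet α) with hN
  have hN0 : 0 < N := add_pos_of_pos_of_nonneg (totalLength_pos hα hα') measureReal_nonneg
  set M := Q.maxLeafLength α with hM
  have hM0 : 0 ≤ M := maxLeafLength_nonneg α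
  set f : ℝ → Q.Point := fun t => S.1 t.toNNReal with hf
  have hlip : LipschitzWith 1 f := by
    have := S.2.comp (LipschitzWith.of_dist_le_mul (K := 1) (f := Real.toNNReal) fun x y => by
      rw [NNReal.dist_eq, Real.coe_toNNReal', Real.coe_toNNReal', Real.dist_eq, NNReal.coe_one,
        one_mul]
      exact abs_max_sub_max_le_abs x y 0)
    rwa [one_mul] at this
  have hint : ∀ (x : Q.Point) (τ : ℝ), 0 ≤ τ → Intercepts α S (x, τ.toNNReal) →
      ∃ t ∈ f ⁻¹' {x}, τ ≤ t ∧ t ≤ τ + α := by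
    rintro x τ hτ ⟨t, h1, h2, h3⟩
    rw [Real.coe_toNNReal τ hτ] at h1 h2
    refine ⟨t, ?_, h1, h2⟩
    rw [mem_preimage, hf, mem_singleton_iff]
    simpa using h3
  have hA : MeasurableSet {a : Q.Attack | Intercepts α S a} :=
    measurableSet_intercepts hα.le |>.preimage (measurable_const.prodMk measurable_id)
  rw [eAttack]
  simp only [Measure.add_apply, Measure.smul_apply, Measure.coe_finsetSum, Finset.sum_apply,
    smul_eq_mul, leafLength_eq hα h, ← hN, ← hM]
  have h1 : ENNReal.ofReal (Q.length.real (Q.extremitySet α)ᶜ / N) *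
      ((ProbabilityTheory.cond Q.length (Q.extremitySet α)ᶜ).prod
        (Measure.dirac M.toNNReal)) {a | Intercepts α S a} ≤
      Q.length ((Q.extremitySet α)ᶜ ∩ f '' Icc M (M + α)) / ENNReal.ofReal N := by
    rw [Measure.prod_dirac, Measure.map_apply (by fun_prop) hA]
    refine (ofReal_mul_cond_le _ (isOpen_extremitySet h).measurableSet.compl hN0
      (by simp)).trans ?_
    gcongr
    intro x hx
    obtain ⟨t, ht, h2, h3⟩ := hint x M hM0 hx
    exact ⟨t, ⟨h2, h3⟩, ht⟩
  have h2 : ∀ v : Q.Leaf, ENNReal.ofReal (2 * cut α v / N) *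
      ((Measure.dirac (Point.node (Q := Q) v.1)).prod
        ((ProbabilityTheory.cond volume (Icc (M - cut α v) (M + cut α v))).map Real.toNNReal))
        {a | Intercepts α S a} ≤
      volume (Icc (M - cut α v) (M + cut α v) ∩
        {τ | ∃ t ∈ f ⁻¹' {.node v.1}, τ ≤ t ∧ t ≤ τ + α}) / ENNReal.ofReal N := by
    intro v
    rw [Measure.dirac_prod, Measure.map_apply (by fun_prop) hA,
      Measure.map_apply measurable_real_toNNReal (hA.preimage (by fun_prop))]
    refine (ofReal_mul_cond_le _ measurableSet_Icc hN0 (volume_attack_window v M)).trans ?_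
    gcongr 1
    refine measure_mono fun τ hτ => ⟨hτ.1, hint _ τ ?_ hτ.2⟩
    linarith [hτ.1.1, cut_le_maxLeafLength hα h v]
  calc _ ≤ Q.length ((Q.extremitySet α)ᶜ ∩ f '' Icc M (M + α)) / ENNReal.ofReal N +
        ∑ v : Q.Leaf, volume (Icc (M - cut α v) (M + cut α v) ∩
        {τ | ∃ t ∈ f ⁻¹' {.node v.1}, τ ≤ t ∧ t ≤ τ + α}) / ENNReal.ofReal N :=
        add_le_add h1 (Finset.sum_le_sum fun v _ => h2 v)
    _ = (Q.length ((Q.extremitySet α)ᶜ ∩ f '' Icc M (M + α)) +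
        ∑ v : Q.Leaf, volume (Icc (M - cut α v) (M + cut α v) ∩
        {τ | ∃ t ∈ f ⁻¹' {.node v.1}, τ ≤ t ∧ t ≤ τ + α})) / ENNReal.ofReal N := by
        simp only [div_eq_mul_inv, add_mul, Finset.sum_mul]
    _ ≤ ENNReal.ofReal α / ENNReal.ofReal N := by
        gcongr
        exact attack_gain_le hα h hlip M
    _ = _ := (ENNReal.ofReal_div_of_pos hN0).symm

end

/-! ### Time spent by a tour in a part of the network -/

/-- Half-open intervals of length `L` are fundamental domains for the translations by multiples of
`L`. -/
theorem volume_inter_Ioc_periodic {P : Set ℝ} (hP : MeasurableSet P) {L : ℝ} (hL : 0 < L)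
    (hper : ∀ t, t + L ∈ P ↔ t ∈ P) (a b : ℝ) :
    volume (P ∩ Ioc a (a + L)) = volume (P ∩ Ioc b (b + L)) := by
  refine (isAddFundamentalDomain_Ioc hL a).measure_set_eq (isAddFundamentalDomain_Ioc hL b) hP ?_
  intro g
  obtain ⟨n, hn⟩ := AddSubgroup.mem_zmultiples_iff.1 g.2
  have hp : Function.Periodic (fun t => t ∈ P) L := fun t => propext (hper t)
  ext t
  have := hp.zsmul n t
  simp only [eq_iff_iff] at this
  rw [mem_preimage, AddSubgroup.vadd_def, vadd_eq_add, add_comm, ← hn]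
  exact this

/-- By the intermediate value theorem `g` attains every value of `J` on the interval, and a
1-Lipschitz map does not increase measure. -/
theorem volume_le_rising {g : ℝ → ℝ} (hg : LipschitzWith 1 g) {a b c d : ℝ} (hab : a ≤ b)
    (ha : g a ≤ c) (hb : d ≤ g b) {J : Set ℝ} (hJ : J ⊆ Ioo c d) :
    volume J ≤ volume (g ⁻¹' J ∩ Ioo a b) := by
  refine (measure_mono ?_).trans (volume_image_le (f := g) (hg.lipschitzOnWith))
  intro y hy
  have hy' : y ∈ Ioo (g a) (g b) := ⟨ha.trans_lt (hJ hy).1, (hJ hy).2.trans_le hb⟩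
  obtain ⟨t, ht, rfl⟩ := intermediate_value_Ioo hab hg.continuous.continuousOn hy'
  exact ⟨t, ⟨hy, ht⟩, rfl⟩

theorem volume_le_falling {g : ℝ → ℝ} (hg : LipschitzWith 1 g) {a b c d : ℝ} (hab : a ≤ b)
    (ha : d ≤ g a) (hb : g b ≤ c) {J : Set ℝ} (hJ : J ⊆ Ioo c d) :
    volume J ≤ volume (g ⁻¹' J ∩ Ioo a b) := by
  refine (measure_mono ?_).trans (volume_image_le (f := g) (hg.lipschitzOnWith))
  intro y hy
  have hy' : y ∈ Ioo (g b) (g a) := ⟨hb.trans_lt (hJ hy).1, (hJ hy).2.trans_le ha⟩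
  obtain ⟨t, ht, rfl⟩ := intermediate_value_Ioo' hab hg.continuous.continuousOn hy'
  exact ⟨t, ⟨hy, ht⟩, rfl⟩

namespace ClosedPath

theorem IsTour.exists_time {T : Q.ClosedPath} (hT : T.IsTour) (x : Q.Point) (a : ℝ) :
    ∃ t ∈ Ico a (a + T.L), T.toFun t = x := by
  obtain ⟨s, hs⟩ : x ∈ range T.toFun := by rw [show range T.toFun = univ from hT]; trivial
  obtain ⟨t, ht, h⟩ := T.periodic.exists_mem_Ico T.L_pos s a
  exact ⟨t, ht, h ▸ hs⟩

theorem volume_preimage_shift (T : Q.ClosedPath) {A : Set Q.Point} (hA : MeasurableSet A)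
    (a b : ℝ) : volume (T.toFun ⁻¹' A ∩ Ioc a (a + T.L)) =
      volume (T.toFun ⁻¹' A ∩ Ioc b (b + T.L)) := by
  refine volume_inter_Ioc_periodic (T.lipschitz.continuous.measurable hA) T.L_pos (fun t => ?_) a b
  rw [mem_preimage, mem_preimage, T.periodic]

/-- A tour spends in every part of the network at least twice its length. -/
theorem IsTour.two_mul_length_le {T : Q.ClosedPath} (hT : T.IsTour) {A : Set Q.Point}
    (hA : MeasurableSet A) (a : ℝ) :
    2 * Q.length A ≤ volume (T.toFun ⁻¹' A ∩ Ioc a (a + T.L)) := by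
  set U : Q.Arc → Set ℝ := fun e =>
    T.toFun ⁻¹' (A ∩ coord e ⁻¹' Ioo 0 (Q.len e)) ∩ Ioc a (a + T.L) with hU
  have hAm : ∀ e : Q.Arc, MeasurableSet (A ∩ coord e ⁻¹' Ioo 0 (Q.len e)) := fun e =>
    hA.inter (isOpen_Ioo.preimage (continuous_coord e)).measurableSet
  have hUm : ∀ e, MeasurableSet (U e) := fun e =>
    (T.lipschitz.continuous.measurable (hAm e)).inter measurableSet_Ioc
  have harc : ∀ e : Q.Arc, 2 * volume (onArc e ⁻¹' A ∩ Ioo 0 (Q.len e)) ≤ volume (U e) := by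
    intro e
    set J := onArc e ⁻¹' A ∩ Ioo 0 (Q.len e) with hJ
    have hg : LipschitzWith 1 fun t => coord e (T.toFun t) := by
      have := (lipschitz_coord e).comp T.lipschitz
      rwa [one_mul] at this
    -- Starting a period at the tail of the arc, the tour reaches the head at time `q` and is back
    -- by `p + L`: two passages through every position of the arc.
    obtain ⟨p, -, hp⟩ := hT.exists_time (.node (tail e)) 0
    obtain ⟨q, hq, hq'⟩ := hT.exists_time (.node (head e)) p
    have hcp : coord e (T.toFun p) ≤ 0 := by rw [hp, coord_node, nodeCoord_tail]
    have hcq : Q.len e ≤ coord e (T.toFun q) := by rw [hq', coord_node, nodeCoord_head]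
    have hcp' : coord e (T.toFun (p + T.L)) ≤ 0 := by rw [T.periodic]; exact hcp
    have h1 := volume_le_rising hg hq.1 hcp hcq (J := J) inter_subset_right
    have h2 := volume_le_falling hg hq.2.le hcq hcp' (J := J) inter_subset_right
    have hsub : (fun t => coord e (T.toFun t)) ⁻¹' J ⊆
        T.toFun ⁻¹' (A ∩ coord e ⁻¹' Ioo 0 (Q.len e)) := by
      rintro t ⟨h3, h4⟩
      refine ⟨?_, h4⟩
      rw [mem_preimage, onArc_coord h4] at h3
      exact h3
    have hd : Disjoint ((fun t => coord e (T.toFun t)) ⁻¹' J ∩ Ioo p q)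
        ((fun t => coord e (T.toFun t)) ⁻¹' J ∩ Ioo q (p + T.L)) :=
      disjoint_left.2 fun t ht ht' => lt_asymm ht.2.2 ht'.2.1
    have hJm : MeasurableSet J := (measurable_onArc e hA).inter measurableSet_Ioo
    rw [hU, volume_preimage_shift T (hAm e) a p, two_mul]
    refine (add_le_add h1 h2).trans ?_
    rw [← measure_union hd ((hg.continuous.measurable hJm).inter measurableSet_Ioo)]
    refine measure_mono (union_subset ?_ ?_)
    · exact fun t ht => ⟨hsub ht.1, ht.2.1, ht.2.2.le.trans hq.2.le⟩
    · exact fun t ht => ⟨hsub ht.1, hq.1.trans_lt ht.2.1, ht.2.2.le⟩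
  rw [length_apply hA, Finset.mul_sum]
  calc _ ≤ ∑ e, volume (U e) := Finset.sum_le_sum fun e _ => harc e
    _ = volume (⋃ e ∈ (Finset.univ : Finset Q.Arc), U e) := by
        refine (measure_biUnion_finset ?_ fun e _ => hUm e).symm
        intro e _ e' _ hne
        exact disjoint_left.2 fun s h1 h2 => hne (eq_of_coord_mem h1.1.2 h2.1.2)
    _ ≤ _ := measure_mono (iUnion₂_subset fun e _ =>
        inter_subset_inter_left _ (preimage_mono inter_subset_left))

theorem IsTour.two_mul_totalLength_le {T : Q.ClosedPath} (hT : T.IsTour) :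
    2 * Q.totalLength ≤ T.L := by
  have h := hT.two_mul_length_le MeasurableSet.univ 0
  rw [preimage_univ, univ_inter, Real.volume_Ioc, zero_add, sub_zero, length_univ_eq,
    ← ENNReal.ofReal_ofNat, ← ENNReal.ofReal_mul (by norm_num)] at h
  exact (ENNReal.ofReal_le_ofReal_iff T.L_pos.le).1 h

/-- A tour of length `2 μ` spends in every part of the network exactly twice its length. -/
theorem IsTour.volume_eq {T : Q.ClosedPath} (hT : T.IsTour) (hL : T.L = 2 * Q.totalLength)
    {A : Set Q.Point} (hA : MeasurableSet A) (a : ℝ) :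
    volume (T.toFun ⁻¹' A ∩ Ioc a (a + T.L)) = 2 * Q.length A := by
  refine le_antisymm ?_ (hT.two_mul_length_le hA a)
  -- Excess time in `A` would leave too little for the complement, as the lower bounds for both
  -- already add up to `L`.
  have h1 := hT.two_mul_length_le hA.compl a
  have hm : MeasurableSet (T.toFun ⁻¹' A) := T.lipschitz.continuous.measurable hA
  have h2 : volume (T.toFun ⁻¹' A ∩ Ioc a (a + T.L)) +
      volume (T.toFun ⁻¹' Aᶜ ∩ Ioc a (a + T.L)) = 2 * Q.length A + 2 * Q.length Aᶜ := by
    rw [← mul_add, measure_add_measure_compl hA, length_univ_eq, inter_comm, preimage_compl,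
      inter_comm _ (Ioc _ _), ← sdiff_eq, measure_inter_add_sdiff _ hm, Real.volume_Ioc,
      add_sub_cancel_left, hL, ENNReal.ofReal_mul (by norm_num), ENNReal.ofReal_ofNat]
  have hfin : 2 * Q.length Aᶜ ≠ ⊤ := ENNReal.mul_ne_top (by norm_num) (measure_ne_top _ _)
  refine ENNReal.le_of_add_le_add_right hfin ?_
  rw [← h2]
  gcongr

/-- A tour of length `2 μ` visits each branch at a node in a single excursion. -/
theorem IsTour.ordConnected_excursion {T : Q.ClosedPath} (hT : T.IsTour)
    (hL : T.L = 2 * Q.totalLength) {w : V} {f : Q.Arc} {a : ℝ} (ha : T.toFun a ∉ branch w f) :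
    OrdConnected {t | t ∈ Ioo a (a + T.L) ∧ T.toFun t ∈ branch w f} := by
  refine ⟨fun p hp q hq z hz => ?_⟩
  have hzI : z ∈ Ioo a (a + T.L) := ⟨hp.1.1.trans_le hz.1, hz.2.trans_lt hq.1.2⟩
  refine ⟨hzI, ?_⟩
  by_contra hzb
  set h : ℝ → ℝ := fun t => depth w f (T.toFun t) with hh
  have hlip : LipschitzWith 1 h := by
    have := (lipschitz_depth w f).comp T.lipschitz
    rwa [one_mul] at this
  have hza : h z ≤ 0 := not_lt.1 hzb
  have haa : h a ≤ 0 := not_lt.1 ha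
  have haL : h (a + T.L) ≤ 0 := by rw [hh]; simp only [T.periodic a]; exact haa
  have hp0 : 0 < h p := hp.2
  have hq0 : 0 < h q := hq.2
  -- Two excursions, through `p` and through `q` with a gap at `z`, would make four passages through
  -- the depths (0, δ). That takes time 4δ, but a tour of length 2μ spends at most 2δ there.
  set δ := min (h p) (h q) with hδ
  have hδ0 : 0 < δ := lt_min hp0 hq0
  have hδl : δ ≤ Q.len f := (min_le_left _ _).trans (depth_le _ _ _)
  have h1 := volume_le_rising hlip hp.1.1.le haa (min_le_left (h p) (h q)) (J := Ioo 0 δ) subset_rfl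
  have h2 := volume_le_falling hlip hz.1 (min_le_left (h p) (h q)) hza (J := Ioo 0 δ) subset_rfl
  have h3 := volume_le_rising hlip hz.2 hza (min_le_right (h p) (h q)) (J := Ioo 0 δ) subset_rfl
  have h4 := volume_le_falling hlip hq.1.2.le (min_le_right (h p) (h q)) haL (J := Ioo 0 δ)
    subset_rfl
  set P := h ⁻¹' Ioo 0 δ with hP
  have hPm : MeasurableSet P := (isOpen_Ioo.preimage hlip.continuous).measurableSet
  have hA : MeasurableSet {x : Q.Point | depth w f x ∈ Ioo 0 δ} :=
    (isOpen_Ioo.preimage (continuous_depth w f)).measurableSet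
  have h5 := hT.volume_eq hL hA a
  have h6 : Q.length {x : Q.Point | depth w f x ∈ Ioo 0 δ} ≤ ENNReal.ofReal δ := by
    have := (length_ray_image w f le_rfl hδl).2
    rw [sub_zero] at this
    rw [← this]
    refine measure_mono fun x hx => ⟨_, hx, ray_depth ((coord_mem_Ioo_iff w).2 ⟨hx.1, ?_⟩)⟩
    exact hx.2.trans_le hδl
  have hd : ∀ {x y z w : ℝ}, y ≤ z → Disjoint (P ∩ Ioo x y) (P ∩ Ioo z w) := fun hyz =>
    disjoint_left.2 fun t ht ht' => absurd (ht.2.2.trans_le hyz) (not_lt.2 ht'.2.1.le)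
  have hm : ∀ {x y : ℝ}, MeasurableSet (P ∩ Ioo x y) := hPm.inter measurableSet_Ioo
  have h7 : volume (P ∩ Ioo a p) + volume (P ∩ Ioo p z) + volume (P ∩ Ioo z q) +
      volume (P ∩ Ioo q (a + T.L)) ≤
      volume (T.toFun ⁻¹' {x : Q.Point | depth w f x ∈ Ioo 0 δ} ∩ Ioc a (a + T.L)) := by
    rw [← measure_union (hd le_rfl) hm, ← measure_union
      (disjoint_union_left.2 ⟨hd hz.1, hd le_rfl⟩) hm, ← measure_union
      (disjoint_union_left.2 ⟨disjoint_union_left.2 ⟨hd (hz.1.trans hz.2), hd hz.2⟩, hd le_rfl⟩) hm]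
    refine measure_mono ?_
    have key : ∀ {x y : ℝ}, a ≤ x → y ≤ a + T.L → P ∩ Ioo x y ⊆
        T.toFun ⁻¹' {x : Q.Point | depth w f x ∈ Ioo 0 δ} ∩ Ioc a (a + T.L) :=
      fun hx hy t ht => ⟨ht.1, hx.trans_lt ht.2.1, ht.2.2.le.trans hy⟩
    exact union_subset (union_subset (union_subset (key le_rfl hp.1.2.le)
      (key hp.1.1.le hzI.2.le)) (key hzI.1.le hq.1.2.le)) (key hq.1.1.le le_rfl)
  rw [h5] at h7
  have h8 := (add_le_add (add_le_add (add_le_add h1 h2) h3) h4).trans (h7.trans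
    (mul_le_mul_right h6 2))
  rw [Real.volume_Ioo, sub_zero, ← ENNReal.ofReal_add hδ0.le hδ0.le,
    ← ENNReal.ofReal_add (by linarith) hδ0.le, ← ENNReal.ofReal_add (by linarith) hδ0.le,
    ← ENNReal.ofReal_ofNat, ← ENNReal.ofReal_mul (by norm_num),
    ENNReal.ofReal_le_ofReal_iff (by linarith)] at h8
  linarith

/-! ### Attacks intercepted by the translates of a closed path -/

/-- The starting times of attacks at `x` that the closed path `T` intercepts. -/
def hitting (T : Q.ClosedPath) (α : ℝ) (x : Q.Point) : Set ℝ :=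
  {s | ∃ t ∈ Icc s (s + α), T.toFun t = x}

theorem isClosed_hitting (T : Q.ClosedPath) (α : ℝ) (x : Q.Point) : IsClosed (T.hitting α x) := by
  have hF : IsClosed (T.toFun ⁻¹' {x}) := isClosed_singleton.preimage T.lipschitz.continuous
  -- The hitting set is the sum of the closed set of visits and the compact interval [-α, 0].
  have h := hF.add_right_of_isCompact (isCompact_Icc (a := -α) (b := 0))
  convert h using 1
  ext s
  rw [mem_add]
  constructor
  · rintro ⟨t, ht, hx⟩
    exact ⟨t, hx, s - t, ⟨by linarith [ht.2], by linarith [ht.1]⟩, by ring⟩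
  · rintro ⟨t, hx, r, hr, rfl⟩
    exact ⟨t, ⟨by linarith [hr.2], by linarith [hr.1]⟩, hx⟩

theorem add_mem_hitting (T : Q.ClosedPath) (α : ℝ) (x : Q.Point) (s : ℝ) :
    s + T.L ∈ T.hitting α x ↔ s ∈ T.hitting α x := by
  constructor
  · rintro ⟨t, ht, hx⟩
    refine ⟨t - T.L, ⟨by linarith [ht.1], by linarith [ht.2]⟩, ?_⟩
    rwa [T.periodic.sub_eq]
  · rintro ⟨t, ht, hx⟩
    exact ⟨t + T.L, ⟨by linarith [ht.1], by linarith [ht.2]⟩, by rwa [T.periodic]⟩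

theorem volume_hitting_shift (T : Q.ClosedPath) (α : ℝ) (x : Q.Point) (a b : ℝ) :
    volume (T.hitting α x ∩ Ioc a (a + T.L)) = volume (T.hitting α x ∩ Ioc b (b + T.L)) :=
  volume_inter_Ioc_periodic (T.isClosed_hitting α x).measurableSet T.L_pos
    (T.add_mem_hitting α x) a b

theorem measurable_patrol (T : Q.ClosedPath) : Measurable T.patrol := by
  refine Measurable.subtype_mk (measurable_pi_lambda _ fun t => ?_)
  exact (T.lipschitz.continuous.comp (by fun_prop : Continuous fun Δ : ℝ => (t : ℝ) + Δ)).measurable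

theorem volume_period (T : Q.ClosedPath) : volume (Icc 0 T.L) = ENNReal.ofReal T.L := by
  rw [Real.volume_Icc, sub_zero]

instance (T : Q.ClosedPath) : IsProbabilityMeasure T.randomExtension := by
  constructor
  rw [randomExtension, Measure.map_apply T.measurable_patrol MeasurableSet.univ, preimage_univ,
    cond_univ_of_pos _ T.L_pos T.volume_period]

/-- The translate by `Δ` intercepts the attack exactly when `τ + Δ` is a hitting time. By
periodicity the starting time `τ` drops out. -/
theorem randomExtension_intercepts (T : Q.ClosedPath) {α : ℝ} (hα : 0 ≤ α) (x : Q.Point)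
    (τ : ℝ≥0) : T.randomExtension {S | Intercepts α S (x, τ)} =
      volume (T.hitting α x ∩ Ioc 0 (0 + T.L)) / ENNReal.ofReal T.L := by
  have hA : MeasurableSet {S : Q.Patrol | Intercepts α S (x, τ)} :=
    (measurableSet_intercepts hα).preimage (measurable_id.prodMk measurable_const)
  have heq : T.patrol ⁻¹' {S | Intercepts α S (x, τ)} =
      (fun Δ : ℝ => (τ : ℝ) + Δ) ⁻¹' T.hitting α x := by
    ext Δ
    constructor
    · rintro ⟨t, h1, h2, h3⟩
      exact ⟨t + Δ, ⟨by simpa using h1, by dsimp only at h2 ⊢; linarith⟩, h3⟩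
    · rintro ⟨t, ht, h3⟩
      have h0 : 0 ≤ t - Δ := by
        have := ht.1
        have hτ : (0 : ℝ) ≤ τ := τ.2
        dsimp only at this
        linarith
      refine ⟨⟨t - Δ, h0⟩, ?_, ?_, ?_⟩
      · have := ht.1
        change (τ : ℝ) ≤ t - Δ
        dsimp only at this
        linarith
      · have := ht.2
        change t - Δ ≤ τ + α
        dsimp only at this
        linarith
      · change T.toFun (t - Δ + Δ) = x
        rwa [sub_add_cancel]
  rw [randomExtension, Measure.map_apply T.measurable_patrol hA, heq,
    ProbabilityTheory.cond_apply measurableSet_Icc, T.volume_period, ENNReal.div_eq_inv_mul]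
  congr 1
  rw [measure_congr (Ioc_ae_eq_Icc.symm.inter (Filter.EventuallyEq.refl _ _) :
    (Icc 0 T.L ∩ (fun Δ : ℝ => (τ : ℝ) + Δ) ⁻¹' T.hitting α x : Set ℝ) =ᵐ[volume] _),
    T.volume_hitting_shift α x 0 τ, ← measure_preimage_add volume (τ : ℝ)
      (T.hitting α x ∩ Ioc (τ : ℝ) (τ + T.L)), preimage_inter, inter_comm]
  congr 2
  ext Δ
  simp

/-- Two visits at distance at least `α` from each other, in both directions of the cycle. -/
theorem two_mul_le_volume_hitting (T : Q.ClosedPath) {α : ℝ} (hα : 0 ≤ α) {x : Q.Point} {p q : ℝ}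
    (hp : T.toFun p = x) (hq : T.toFun q = x) (h1 : α ≤ q - p) (h2 : α ≤ T.L - (q - p)) :
    ENNReal.ofReal (2 * α) ≤ volume (T.hitting α x ∩ Ioc 0 (0 + T.L)) := by
  rw [T.volume_hitting_shift α x 0 (p - α)]
  have hsub : Ioc (p - α) p ∪ Ioc (q - α) q ⊆ T.hitting α x ∩ Ioc (p - α) (p - α + T.L) := by
    rintro s (hs | hs)
    · exact ⟨⟨p, ⟨hs.2, by linarith [hs.1]⟩, hp⟩, hs.1, by linarith [hs.2]⟩
    · exact ⟨⟨q, ⟨hs.2, by linarith [hs.1]⟩, hq⟩, by linarith [hs.1], by linarith [hs.2]⟩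
  refine le_trans ?_ (measure_mono hsub)
  rw [measure_union _ measurableSet_Ioc, Real.volume_Ioc, Real.volume_Ioc, sub_sub_cancel,
    sub_sub_cancel, ← ENNReal.ofReal_add hα hα, two_mul]
  exact disjoint_left.2 fun s hs hs' => by linarith [hs.2, hs'.1]

/-- From a missed time `s` in `C`, the next visit to `x` comes more than α later. Until then the
path cannot leave `C`, and its last α units of time are hitting times. -/
theorem le_volume_hitting_of_not_mem {T : Q.ClosedPath} (hT : T.IsTour) {α : ℝ}
    {x : Q.Point} {C C' : Set Q.Point} (hC : IsOpen C) (hC' : IsOpen C') (hd : Disjoint C C')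
    (hcov : {x}ᶜ ⊆ C ∪ C') {s : ℝ} (hsC : T.toFun s ∈ C) (hs : s ∉ T.hitting α x) (a : ℝ) :
    ENNReal.ofReal α ≤ volume (T.hitting α x ∩ T.toFun ⁻¹' C ∩ Ioc a (a + T.L)) := by
  have hF : IsClosed (T.toFun ⁻¹' {x}) := isClosed_singleton.preimage T.lipschitz.continuous
  obtain ⟨t, ht, htx⟩ := hT.exists_time x s
  obtain ⟨u, hu, hmin⟩ := (isCompact_Icc.inter_left hF).exists_isLeast
    (⟨t, htx, ht.1, ht.2.le⟩ : (T.toFun ⁻¹' {x} ∩ Icc s (s + T.L)).Nonempty)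
  have hsu : s + α < u := by
    by_contra! hle
    exact hs ⟨u, ⟨hu.2.1, hle⟩, hu.1⟩
  have hαL : α ≤ T.L := by linarith [hu.2.2]
  have hIco : T.toFun '' Ico s u ⊆ C := by
    by_cases hsu' : s < u
    · refine IsPreconnected.subset_left_of_subset_union hC hC' hd ?_
        ⟨_, ⟨s, ⟨le_rfl, hsu'⟩, rfl⟩, hsC⟩
        (isPreconnected_Ico.image _ T.lipschitz.continuous.continuousOn)
      rintro _ ⟨r, hr, rfl⟩
      refine hcov fun hrx => ?_
      have := hmin ⟨hrx, hr.1, hr.2.le.trans hu.2.2⟩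
      exact absurd hr.2 (not_lt.2 this)
    · rw [Ico_eq_empty hsu', image_empty]
      exact empty_subset _
  have hshift := volume_inter_Ioc_periodic
    (((T.isClosed_hitting α x).measurableSet.inter
      (T.lipschitz.continuous.measurable hC.measurableSet))) T.L_pos
    (fun t => by
      rw [mem_inter_iff, mem_inter_iff, add_mem_hitting, mem_preimage, mem_preimage, T.periodic])
    a (u - T.L)
  rw [hshift]
  have hsub : Ioo (u - α) u ⊆ T.hitting α x ∩ T.toFun ⁻¹' C ∩ Ioc (u - T.L) (u - T.L + T.L) := by
    intro r hr
    refine ⟨⟨⟨u, ⟨hr.2.le, by linarith [hr.1]⟩, hu.1⟩, hIco ⟨r, ⟨by linarith [hr.1], hr.2⟩, rfl⟩⟩,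
      by linarith [hr.1], by linarith [hr.2]⟩
  refine le_trans ?_ (measure_mono hsub)
  rw [Real.volume_Ioo, sub_sub_cancel]

/-- Either all the time spent in `C`, at least twice its length, is hitting, or some time is missed
and the previous lemma applies. -/
theorem le_volume_hitting_of_le_volume {T : Q.ClosedPath} (hT : T.IsTour) {α : ℝ}
    {x : Q.Point} {C C' : Set Q.Point} (hC : IsOpen C) (hC' : IsOpen C') (hd : Disjoint C C')
    (hcov : {x}ᶜ ⊆ C ∪ C') (hlen : α / 2 ≤ Q.length.real C) (a : ℝ) :
    ENNReal.ofReal α ≤ volume (T.hitting α x ∩ T.toFun ⁻¹' C ∩ Ioc a (a + T.L)) := by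
  by_cases hsub : T.toFun ⁻¹' C ⊆ T.hitting α x
  · rw [inter_eq_right.2 hsub]
    refine le_trans ?_ (hT.two_mul_length_le hC.measurableSet a)
    rw [← ofReal_measureReal (measure_ne_top _ _), ← ENNReal.ofReal_ofNat,
      ← ENNReal.ofReal_mul (by norm_num)]
    exact ENNReal.ofReal_le_ofReal (by linarith)
  · obtain ⟨s, hs, hs'⟩ := not_subset.1 hsub
    exact le_volume_hitting_of_not_mem hT hC hC' hd hcov hs hs' a

theorem volume_hitting_add_le (T : Q.ClosedPath) {α : ℝ} (x : Q.Point) {C C' : Set Q.Point}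
    (hC' : IsOpen C') (hd : Disjoint C C') (a : ℝ) :
    volume (T.hitting α x ∩ T.toFun ⁻¹' C ∩ Ioc a (a + T.L)) +
      volume (T.hitting α x ∩ T.toFun ⁻¹' C' ∩ Ioc a (a + T.L)) ≤
      volume (T.hitting α x ∩ Ioc a (a + T.L)) := by
  rw [← measure_union _ (((T.isClosed_hitting α x).measurableSet.inter
    (T.lipschitz.continuous.measurable hC'.measurableSet)).inter measurableSet_Ioc)]
  · exact measure_mono (union_subset (inter_subset_inter_left _ inter_subset_left)
      (inter_subset_inter_left _ inter_subset_left))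
  · refine disjoint_left.2 fun t ht ht' => disjoint_left.1 hd ht.1.2 ht'.1.2

/-- Points outside the extremity set, other than leaf nodes, are well covered by every tour. -/
theorem IsTour.volume_hitting_of_not_mem {T : Q.ClosedPath} (hT : T.IsTour) {α : ℝ} (hα : 0 < α)
    (h : Q.LeafCondition α) (hE : closure (Q.extremitySet α) ≠ univ) {x : Q.Point}
    (hx : x ∉ Q.extremitySet α) (hleaf : ∀ v, Q.IsLeaf v → x ≠ .node v) :
    T.hitting α x = univ ∨
      ENNReal.ofReal (2 * α) ≤ volume (T.hitting α x ∩ Ioc 0 (0 + T.L)) := by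
  have hαα : ENNReal.ofReal (2 * α) = ENNReal.ofReal α + ENNReal.ofReal α := by
    rw [← ENNReal.ofReal_add hα.le hα.le, two_mul]
  by_cases hreg : IsRegular x
  · right
    obtain ⟨e, he⟩ := isRegular_iff.1 hreg
    set u := tail e
    set t := depth u e x with ht
    have htm : t ∈ Ioo 0 (Q.len e) := (coord_mem_Ioo_iff u).1 he
    have hxr : ray u e t = x := ray_depth he
    have hs := half_le_length_sides (tail_mem e) htm (hxr.symm ▸ hx)
    have ho1 : IsOpen {y : Q.Point | depth u e y < t} :=
      isOpen_lt (continuous_depth u e) continuous_const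
    have ho2 : IsOpen {y : Q.Point | t < depth u e y} :=
      isOpen_lt continuous_const (continuous_depth u e)
    have hd : Disjoint {y : Q.Point | depth u e y < t} {y | t < depth u e y} :=
      disjoint_left.2 fun y (h1 : depth u e y < t) (h2 : t < depth u e y) => lt_asymm h1 h2
    have hcov : ({x}ᶜ : Set Q.Point) ⊆ {y | depth u e y < t} ∪ {y | t < depth u e y} := by
      intro y hy
      rcases lt_trichotomy (depth u e y) t with h1 | h1 | h1
      · exact Or.inl h1
      · have h2 : coord e y ∈ Ioo 0 (Q.len e) := (coord_mem_Ioo_iff u).2 (h1 ▸ htm)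
        exact absurd ((ray_depth (u := u) h2).symm.trans (by rw [h1, hxr])) hy
      · exact Or.inr h1
    rw [hαα]
    refine (add_le_add
      (le_volume_hitting_of_le_volume hT ho1 ho2 hd hcov hs.1 0)
      (le_volume_hitting_of_le_volume hT ho2 ho1 hd.symm (by rwa [union_comm]) hs.2 0)).trans
      (T.volume_hitting_add_le x ho2 hd 0)
  · have hnode : ∃ w, x = .node w := by
      cases x with
      | node w => exact ⟨w, rfl⟩
      | inner e s => exact absurd ⟨e, s, rfl⟩ hreg
    obtain ⟨w, rfl⟩ := hnode
    have hw : ¬ Q.IsLeaf w := fun hw => hleaf w hw rfl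
    by_cases hall : T.hitting α (.node w) = univ
    · exact Or.inl hall
    · right
      -- A single branch at `w` may be a leaf arc shorter than α/2. The cut is therefore made at the
      -- branch `f` that holds a missed time, which needs no length bound, and the rest `C'` is long
      -- enough.
      obtain ⟨s, hs⟩ := (ne_univ_iff_exists_notMem _).1 hall
      have hsw : T.toFun s ≠ .node w := fun h' => hs ⟨s, ⟨le_rfl, by linarith⟩, h'⟩
      obtain ⟨f, hf, hsf⟩ := exists_mem_branch hsw
      set C' : Set Q.Point := ⋃ (g : Q.Arc) (_ : w ∈ g.1 ∧ g ≠ f), branch w g with hC'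
      have hC'o : IsOpen C' := isOpen_iUnion fun g => isOpen_iUnion fun _ => isOpen_branch w g
      have hd : Disjoint (branch w f) C' := by
        refine disjoint_left.2 fun y hy hy' => ?_
        simp only [hC', mem_iUnion] at hy'
        obtain ⟨g, ⟨hg, hne⟩, hy'⟩ := hy'
        exact hne (branch_unique hg hf hy' hy)
      have hcov : ({.node w}ᶜ : Set Q.Point) ⊆ branch w f ∪ C' := by
        intro y hy
        obtain ⟨g, hg, hyg⟩ := exists_mem_branch hy
        by_cases hgf : g = f
        · exact Or.inl (hgf ▸ hyg)
        · exact Or.inr (mem_iUnion₂.2 ⟨g, ⟨hg, hgf⟩, hyg⟩)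
      have hlen : α / 2 ≤ Q.length.real C' := by
        refine (half_le_length_compl_branch hα h hE hw hf).trans ?_
        have hsub : (branch w f)ᶜ ⊆ C' ∪ {.node w} := by
          intro y hy
          by_cases hyw : y = .node w
          · exact Or.inr hyw
          · exact Or.inl ((hcov hyw).resolve_left hy)
        refine ((measureReal_mono hsub).trans (measureReal_union_le _ _)).trans ?_
        have : Q.length.real {Point.node w} = 0 := by
          rw [measureReal_def, measure_singleton, ENNReal.toReal_zero]
        rw [this, add_zero]
      rw [hαα]
      exact (add_le_add
        (le_volume_hitting_of_not_mem hT (isOpen_branch w f) hC'o hd hcov hsf hs 0)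
        (le_volume_hitting_of_le_volume hT hC'o (isOpen_branch w f) hd.symm
          (by rwa [union_comm]) hlen 0)).trans
        (T.volume_hitting_add_le _ hC'o hd 0)

end ClosedPath

/-! ### Stretching time by insertions -/

section

variable {ι : Type*} (F : Finset ι) (τ ℓ : ι → ℝ)

open Classical in
/-- The time `t`, delayed by insertions of length `ℓ i` at the times `τ i < t`, for `i ∈ F`. -/
noncomputable def stretch (t : ℝ) : ℝ := t + ∑ i ∈ F with τ i < t, ℓ i

variable {F τ ℓ}

theorem sub_le_stretch_sub (hℓ : ∀ i ∈ F, 0 ≤ ℓ i) {s t : ℝ} (hst : s ≤ t) :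
    t - s ≤ stretch F τ ℓ t - stretch F τ ℓ s := by
  classical
  have : ∑ i ∈ F with τ i < s, ℓ i ≤ ∑ i ∈ F with τ i < t, ℓ i := by
    refine Finset.sum_le_sum_of_subset_of_nonneg ?_ fun i hi _ =>
      hℓ i (Finset.mem_of_mem_filter i hi)
    intro i hi
    rw [Finset.mem_filter] at hi ⊢
    exact ⟨hi.1, hi.2.trans_le hst⟩
  unfold stretch
  linarith

theorem le_stretch (hℓ : ∀ i ∈ F, 0 ≤ ℓ i) (t : ℝ) : t ≤ stretch F τ ℓ t := by
  classical
  have : 0 ≤ ∑ i ∈ F with τ i < t, ℓ i :=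
    Finset.sum_nonneg fun i hi => hℓ i (Finset.mem_of_mem_filter i hi)
  unfold stretch
  linarith

theorem stretch_le (hℓ : ∀ i ∈ F, 0 ≤ ℓ i) (t : ℝ) : stretch F τ ℓ t ≤ t + ∑ i ∈ F, ℓ i := by
  classical
  exact add_le_add_right (Finset.sum_le_sum_of_subset_of_nonneg (Finset.filter_subset _ _)
    fun i hi _ => hℓ i hi) t

theorem add_le_stretch (hℓ : ∀ i ∈ F, 0 ≤ ℓ i) {i : ι} (hi : i ∈ F) {t : ℝ} (h : τ i < t) :
    t + ℓ i ≤ stretch F τ ℓ t := by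
  classical
  unfold stretch
  gcongr
  exact Finset.single_le_sum (f := ℓ) (fun j hj => hℓ j (Finset.mem_of_mem_filter j hj))
    (Finset.mem_filter.2 ⟨hi, h⟩)

theorem stretch_eq_add {s t : ℝ} (hst : s ≤ t) (h : ∀ i ∈ F, τ i ∉ Ico s t) :
    stretch F τ ℓ t = stretch F τ ℓ s + (t - s) := by
  classical
  have : Finset.filter (fun i => τ i < t) F = Finset.filter (fun i => τ i < s) F := by
    refine Finset.filter_congr fun i hi => ⟨fun h1 => ?_, fun h1 => h1.trans_le hst⟩
    by_contra! h2
    exact h i hi ⟨h2, h1⟩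
  unfold stretch
  rw [this]
  ring

theorem finsum_eq_stretch (A : Set ι) (hA : A.Finite) (t : ℝ) :
    t + ∑ᶠ i ∈ {i ∈ A | τ i < t}, ℓ i = stretch hA.toFinset τ ℓ t := by
  classical
  unfold stretch
  rw [← finsum_mem_coe_finset]
  congr 2
  ext i
  simp

end

/-! ### Components of small length -/

theorem depth_tip_of_ne {v : Q.Leaf} {w : V} (hw : w ∈ (leafArc v).1) (hwv : w ≠ v.1) {t : ℝ}
    (ht : t ∈ Icc 0 (Q.len (leafArc v))) :
    depth w (leafArc v) (tip v t) = Q.len (leafArc v) - t := by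
  have h1 := depth_add_depth (mem_leafArc v) hw hwv (tip v t)
  rw [tip, depth_ray _ _ ht] at h1
  rw [tip]
  linarith

/-- A component of length less than `α / 2` of the closure of the extremity set is a union of whole
leaf arcs at a common node. -/
theorem exists_center_of_length_lt {α : ℝ} (hα : 0 < α) (h : Q.LeafCondition α) {v : Q.Leaf}
    (hlt : Q.length.real (star α v) < α / 2) :
    ∃ w, ¬ Q.IsLeaf w ∧ attach α v = .node w ∧ ∀ f : Q.Arc, w ∈ f.1 →
      (NearEndFree α w f ∧ Disjoint (branch w f) (star α v)) ∨ branch w f ⊆ star α v := by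
  classical
  have hcut : ∀ v' : Q.Leaf, attach α v' = attach α v → cut α v' < α / 2 := by
    intro v' hv'
    refine lt_of_le_of_lt ?_ hlt
    rw [length_star hα]
    exact Finset.single_le_sum (f := cut α) (fun u _ => (cut_pos hα u).le)
      (Finset.mem_filter.2 ⟨Finset.mem_univ _, hv'⟩)
  obtain ⟨w, hw, hvw⟩ : ∃ w, ¬ Q.IsLeaf w ∧ attach α v = .node w := by
    -- Every arm of the star is shorter than α/2, so it is a whole leaf arc and its inner end is a
    -- node.
    rcases attach_cases hα v with ⟨-, w, -, -, h1, h2⟩ | ⟨h1, -⟩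
    · exact ⟨w, h1, h2⟩
    · exact absurd h1 (hcut v rfl).ne
  have hfull : ∀ v' : Q.Leaf, attach α v' = attach α v →
      cut α v' = Q.len (leafArc v') ∧ w ∈ (leafArc v').1 ∧ w ≠ v'.1 := by
    intro v' hv'
    rcases attach_cases hα v' with ⟨h0, w', h1, h2, -, h3⟩ | ⟨h1, -⟩
    · rw [hv', hvw] at h3
      injection h3 with h3
      exact ⟨h0, h3 ▸ h1, h3 ▸ h2⟩
    · exact absurd h1 (hcut v' hv').ne
  refine ⟨w, hw, hvw, fun f hf => ?_⟩
  rcases nearEndFree_or hα h hw hf with hnear | ⟨v', rfl, hc⟩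
  · refine Or.inl ⟨hnear, disjoint_left.2 fun x hxf hx => ?_⟩
    obtain ⟨v', hv', t, ht, rfl⟩ := mem_star.1 hx
    obtain ⟨hc, hwv, hne⟩ := hfull v' hv'
    have htl : t ∈ Icc 0 (Q.len (leafArc v')) := ⟨ht.1, ht.2.trans_eq hc⟩
    have hd := depth_tip_of_ne hwv hne htl
    have hb : tip v' t ∈ branch w (leafArc v') := by
      rcases htl.2.eq_or_lt with h1 | h1
      · have : tip v' t = .node w := by
          rw [h1, ← hc]
          exact hv'.trans hvw
        rw [this] at hxf
        exact absurd hxf (node_not_mem_branch w f)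
      · rw [branch, mem_ofPred_eq, hd]
        linarith
    have hfe := branch_unique hf hwv hxf hb
    subst hfe
    obtain ⟨ε, h0, h1, h2⟩ := hnear
    have hε : ε / 2 ∈ Ioo 0 (Q.len (leafArc v')) := ⟨by linarith, by linarith⟩
    refine h2 (ε / 2) ⟨by linarith, by linarith⟩ ?_
    rw [extremitySet_eq h]
    refine mem_iUnion.2 ⟨v', (mem_openArm_iff (cut_le_len _ _)).2 ⟨coord_ray_mem hε, ?_⟩⟩
    have h3 := depth_add_depth (mem_leafArc v') hwv hne (ray w (leafArc v') (ε / 2))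
    rw [depth_ray w _ (Ioo_subset_Icc_self hε)] at h3
    rw [hc]
    linarith
  · right
    have hne : w ≠ v'.1 := fun h' => hw (h' ▸ v'.2)
    have hatt : attach α v' = attach α v := by
      rcases attach_cases hα v' with ⟨-, w', h1, h2, -, h3⟩ | ⟨-, h1, -⟩
      · rw [h3, hvw]
        congr 1
        have hd := depth_add_depth (mem_leafArc v') hf hne (.node w')
        have h4 := depth_node_of_mem (mem_leafArc v') h1 h2
        by_contra hww
        have h5 := depth_node_of_mem hf h1 hww
        have := Q.len_pos (leafArc v')
        linarith
      · exact absurd hc h1.ne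
    intro x (hx : 0 < depth w (leafArc v') x)
    have h1 := depth_add_depth (mem_leafArc v') hf hne x
    refine mem_star.2 ⟨v', hatt, ?_⟩
    rcases (depth_lt_iff (cut_pos hα v') (cut_le_len α v') (x := x)).1 (by linarith) with h2 | rfl
    · exact openArm_subset_arm _ _ h2
    · exact ⟨0, ⟨le_rfl, (cut_pos hα v').le⟩, tip_zero v'⟩

namespace ClosedPath

/-- The window containing all visits to `A` in one period lasts at least 2λ(A) ≥ α. -/
theorem IsTour.alpha_le_of_excursion {T : Q.ClosedPath} (hT : T.IsTour) {α : ℝ} {A : Set Q.Point}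
    (hA : MeasurableSet A) (hlen : α / 2 ≤ Q.length.real A) {a b c : ℝ} (hbc : b ≤ c)
    (hsub : T.toFun ⁻¹' A ∩ Ioc a (a + T.L) ⊆ Icc b c) : α ≤ c - b := by
  have h1 := (hT.two_mul_length_le hA a).trans (measure_mono hsub)
  rw [Real.volume_Icc, ← ofReal_measureReal (measure_ne_top _ _), ← ENNReal.ofReal_ofNat,
    ← ENNReal.ofReal_mul (by norm_num), ENNReal.ofReal_le_ofReal_iff (by linarith)] at h1
  linarith

theorem apply_L (T : Q.ClosedPath) : T.toFun T.L = T.toFun 0 := by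
  have := T.periodic 0
  rwa [zero_add] at this

/-- An arrival at a component centred at the node `w` takes place at `w`. -/
theorem arrival_eq {S : Q.ClosedPath} {K : Set Q.Point} {w : V} {a t : ℝ} (hat : a < t)
    (hw : ∀ f : Q.Arc, w ∈ f.1 → Disjoint (branch w f) K ∨ branch w f ⊆ K)
    (hout : ∀ r ∈ Ioo a t, S.toFun r ∉ K) (ht : S.toFun t ∈ K) : S.toFun t = .node w := by
  by_contra hne
  obtain ⟨f, hf, hb⟩ := exists_mem_branch hne
  have hK : branch w f ⊆ K := by
    rcases hw f hf with h1 | h1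
    · exact absurd ht (disjoint_left.1 h1 hb)
    · exact h1
  have h1 : ∀ᶠ r in nhds t, S.toFun r ∈ branch w f :=
    S.lipschitz.continuous.continuousAt ((isOpen_branch w f).mem_nhds hb)
  have h2 : ∀ᶠ r in nhdsWithin t (Iio t), r ∈ Ioo a t := Ioo_mem_nhdsLT hat
  obtain ⟨r, h3, h4⟩ := ((h1.filter_mono nhdsWithin_le_nhds).and h2).exists
  exact hout r h4 (hK h3)

/-- The return time to a small component is far from the first arrival, in both directions. -/
theorem IsTour.return_time {S : Q.ClosedPath} (hS : S.IsTour) (hL : S.L = 2 * Q.totalLength)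
    {α : ℝ} {K : Set Q.Point} {w : V} (h0 : S.toFun 0 ∉ K) (hwK : Point.node w ∈ K)
    (hw : ∀ f : Q.Arc, w ∈ f.1 → (NearEndFree α w f ∧ Disjoint (branch w f) K) ∨ branch w f ⊆ K)
    {t₁ s₁ τ : ℝ} (ht₁ : 0 ≤ t₁) (hts : t₁ ≤ s₁) (h1 : S.toFun t₁ = .node w)
    (h2 : S.toFun s₁ = .node w)
    (hτ : IsLeast {t | s₁ < t ∧ t ≤ S.L ∧ S.toFun t ∈ K} τ) : α ≤ τ - t₁ ∧ α ≤ S.L - (τ - t₁) := by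
  have hτs : s₁ < τ := hτ.1.1
  have hτL : τ < S.L := lt_of_le_of_ne hτ.1.2.1 fun h' => h0 (S.apply_L ▸ h' ▸ hτ.1.2.2)
  have ht0 : 0 < t₁ := lt_of_le_of_ne ht₁ fun h' => h0 (by rw [h', h1]; exact hwK)
  constructor
  -- Just before `m` fits no visit to `K`: at `m` the tour is in a branch `f` at `w` that misses
  -- `K`. Its single excursion there must end before `τ`, so it fits between `s₁` and `τ`.
  · set m := (s₁ + τ) / 2 with hm
    have hmK : S.toFun m ∉ K := fun h' => by
      have := hτ.2 ⟨by linarith, by linarith, h'⟩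
      linarith
    obtain ⟨f, hf, hb⟩ := exists_mem_branch (w := w) (fun h' => hmK (h' ▸ hwK) : S.toFun m ≠ _)
    obtain ⟨hn, hd⟩ := (hw f hf).resolve_right fun h' => hmK (h' hb)
    have hoc := hS.ordConnected_excursion hL (a := s₁) (h2 ▸ node_not_mem_branch w f)
    have := hS.alpha_le_of_excursion (isOpen_branch w f).measurableSet
      (half_le_length_branch hf hn) (a := s₁) (b := s₁) (c := τ) hτs.le ?_
    · linarith
    · rintro r ⟨hr, hrI⟩
      refine ⟨hrI.1.le, ?_⟩
      by_contra! hτr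
      have hrL : r < s₁ + S.L := lt_of_le_of_ne hrI.2 fun h' => by
        rw [mem_preimage, h', S.periodic, h2] at hr
        exact node_not_mem_branch w f hr
      have := hoc.out ⟨⟨by linarith, by linarith⟩, hb⟩ ⟨⟨hrI.1, hrL⟩, hr⟩
        (⟨by linarith, hτr.le⟩ : τ ∈ Icc m r)
      exact disjoint_left.1 hd this.2 hτ.1.2.2
  -- The other way round the cycle, use the branch that contains the starting point. Its excursion
  -- contains time `S.L` and therefore lies between `τ` and `t₁ + S.L`.
  · obtain ⟨f, hf, hb⟩ := exists_mem_branch (w := w) (fun h' => h0 (h' ▸ hwK) : S.toFun 0 ≠ _)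
    obtain ⟨hn, hd⟩ := (hw f hf).resolve_right fun h' => h0 (h' hb)
    have hoc := hS.ordConnected_excursion hL (a := t₁) (h1 ▸ node_not_mem_branch w f)
    have := hS.alpha_le_of_excursion (isOpen_branch w f).measurableSet
      (half_le_length_branch hf hn) (a := t₁) (b := τ) (c := t₁ + S.L) (by linarith) ?_
    · linarith
    · rintro r ⟨hr, hrI⟩
      refine ⟨?_, hrI.2⟩
      by_contra! hτr
      have := hoc.out ⟨⟨hrI.1, by linarith⟩, hr⟩
        (⟨⟨by linarith, by linarith⟩, S.apply_L.symm ▸ hb⟩ :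
          S.L ∈ {t | t ∈ Ioo t₁ (t₁ + S.L) ∧ S.toFun t ∈ branch w f})
        (⟨hτr.le, hτL.le⟩ : τ ∈ Icc r S.L)
      exact disjoint_left.1 hd this.2 hτ.1.2.2

end ClosedPath

/-! ### The guarantee of the patrolling strategies -/

section

variable {α : ℝ}

theorem totalLength_add_pos (hα : 0 < α) (hα' : α < 2 * Q.totalLength) :
    0 < Q.totalLength + Q.length.real (Q.extremitySet α) :=
  add_pos_of_pos_of_nonneg (totalLength_pos hα hα') measureReal_nonneg

theorem IsEExpansion.guarantee (hα : 0 < α) (hα' : α < 2 * Q.totalLength)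
    (h : Q.LeafCondition α) (hE : closure (Q.extremitySet α) ≠ univ) {S T : Q.ClosedPath}
    (hST : IsEExpansion α S T) (hL : S.L = 2 * Q.totalLength) :
    T.L ≤ 2 * (Q.totalLength + Q.length.real (Q.extremitySet α)) ∧
    ∀ x, T.hitting α x = univ ∨
      ENNReal.ofReal (2 * α) ≤ volume (T.hitting α x ∩ Ioc 0 (0 + T.L)) := by
  obtain ⟨hcpt, -, h0E, t₁, τ, hK, θ, hθ, hTL, hTθ, hTK⟩ := hST
  have hS := hcpt.1
  set ℓ : Set Q.Point → ℝ := fun K => 2 * Q.length.real K with hℓdef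
  set F := (finite_closureComponents hα h).toFinset with hF
  have hFm : ∀ {K}, K ∈ F ↔ K ∈ Q.closureComponents α := by simp [hF]
  have hℓ : ∀ K ∈ F, 0 ≤ ℓ K := fun K _ => mul_nonneg zero_le_two measureReal_nonneg
  have hθ' : ∀ t, θ t = stretch F τ ℓ t := fun t => by rw [hθ t, finsum_eq_stretch]
  have hTtour : T.IsTour := by
    refine eq_univ_of_forall fun x => ?_
    obtain ⟨t, ht, hx⟩ := hS.exists_time x 0
    rw [zero_add] at ht
    exact ⟨θ t, by rw [hTθ t ⟨ht.1, ht.2.le⟩, hx]⟩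
  refine ⟨?_, fun x => ?_⟩
  · rw [hTL, hθ', mul_add, ← hL]
    refine (stretch_le hℓ _).trans (add_le_add_right (le_of_eq ?_) _)
    rw [← finsum_closureComponents hα h, hℓdef, ← Finset.mul_sum,
      finsum_mem_eq_finite_toFinset_sum _ (finite_closureComponents hα h)]
  · by_cases hx : x ∉ Q.extremitySet α ∧ ∀ v, Q.IsLeaf v → x ≠ .node v
    · exact hTtour.volume_hitting_of_not_mem hα h hE hx.1 hx.2
    right
    obtain ⟨v, hxv⟩ : ∃ v, x ∈ star α v := by
      rw [not_and_or, not_not] at hx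
      rcases hx with hx | hx
      · rw [extremitySet_eq h, mem_iUnion] at hx
        obtain ⟨v, hv⟩ := hx
        exact ⟨v, arm_subset_star α v (openArm_subset_arm _ _ hv)⟩
      · push Not at hx
        obtain ⟨v, hv, rfl⟩ := hx
        exact ⟨⟨v, hv⟩, arm_subset_star α _ ⟨0, ⟨le_rfl, (cut_pos hα _).le⟩, tip_zero _⟩⟩
    set K := star α v with hKdef
    have hKc : K ∈ Q.closureComponents α := by
      rw [closureComponents_eq hα h]; exact ⟨v, rfl⟩
    obtain ⟨hleast, himg, hend, hlarge, hsmall⟩ := hK K hKc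
    have hKE : K ⊆ closure (Q.extremitySet α) := star_subset_closure hα h v
    have h0K : S.toFun 0 ∉ K := fun h' => h0E (hKE h')
    have hnn : 0 ≤ Q.length.real K := measureReal_nonneg
    have ht₁0 := hleast.1.1
    have ht₁L : t₁ K ≤ S.L := by
      obtain ⟨t, ht, htx⟩ := hS.exists_time x 0
      rw [zero_add] at ht
      exact (hleast.2 ⟨ht.1, htx ▸ hxv⟩).trans ht.2.le
    have hsK : ∀ t ∈ Icc (t₁ K) (t₁ K + 2 * Q.length.real K), S.toFun t ∈ K := fun t ht => by
      have := mem_image_of_mem S.toFun ht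
      rwa [himg] at this
    have hs₁L : t₁ K + 2 * Q.length.real K < S.L := by
      by_contra! hle
      exact h0K (S.apply_L ▸ hsK S.L ⟨ht₁L, hle⟩)
    obtain ⟨r, hr, hrx⟩ : x ∈ S.toFun '' Icc (t₁ K) (t₁ K + 2 * Q.length.real K) := by
      rw [himg]; exact hxv
    have hτmem : ∀ K' ∈ F, S.toFun (τ K') ∈ K' := by
      intro K' hK'
      obtain ⟨h1, -, h2, h3, h4⟩ := hK K' (hFm.1 hK')
      rcases le_or_gt (α / 2) (Q.length.real K') with h5 | h5
      · rw [h3 h5, h2]; exact h1.1.2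
      · exact (h4 h5).1.2.2
    have hτK : t₁ K + 2 * Q.length.real K ≤ τ K := by
      rcases le_or_gt (α / 2) (Q.length.real K) with h5 | h5
      · exact (hlarge h5).ge
      · exact (hsmall h5).1.1.le
    -- No copy is inserted during the first tour of `K`: the insertion for another component happens
    -- in that component, which is disjoint from `K`, and the one for `K` comes afterwards. So `T`
    -- reproduces the first tour of `K` unbroken.
    have hnoτ : ∀ t, t ≤ t₁ K + 2 * Q.length.real K → ∀ K' ∈ F, τ K' ∉ Ico (t₁ K) t := by
      intro t ht K' hK' hτ'
      have h1 := hsK (τ K') ⟨hτ'.1, hτ'.2.le.trans ht⟩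
      have h2 := hτmem K' hK'
      rw [hFm, closureComponents_eq hα h] at hK'
      obtain ⟨v', rfl⟩ := hK'
      have h3 := star_congr (attach_eq_of_mem_star h1 h2)
      rw [← h3] at hτ'
      linarith [hτ'.2]
    -- The two visits to `x` occur at the same phase `r - t₁ K` of the two copies, so they are
    -- exactly `θ (τ K) - θ (t₁ K)` apart.
    have hp : T.toFun (θ (t₁ K) + (r - t₁ K)) = x := by
      rw [hθ', ← stretch_eq_add hr.1 (hnoτ r hr.2), ← hθ', hTθ r ⟨by linarith [hr.1], by
        linarith [hr.2]⟩, hrx]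
    have hq : T.toFun (θ (τ K) + (r - t₁ K)) = x := by
      rw [hTK K hKc _ ⟨by linarith [hr.1], by linarith [hr.2]⟩, add_sub_cancel, hrx]
    rcases le_or_gt (α / 2) (Q.length.real K) with h5 | h5
    -- The copies are consecutive, so the visits are 2λ(K) ≥ α apart; the rest of the cycle lasts at
    -- least S.L = 2μ > α.
    · have hτe := hlarge h5
      have h6 : θ (τ K) = θ (t₁ K) + 2 * Q.length.real K := by
        rw [hθ', hθ', hτe, stretch_eq_add (by linarith) (hnoτ _ le_rfl), add_sub_cancel_left]
      have h7 : S.L + 2 * Q.length.real K ≤ T.L := by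
        rw [hTL, hθ']
        exact add_le_stretch hℓ (hFm.2 hKc) (hτe ▸ hs₁L)
      refine T.two_mul_le_volume_hitting hα.le hp hq ?_ ?_
      · linarith
      · linarith
    -- The gaps are at least α already in `S`, and insertions only lengthen them.
    · obtain ⟨w, -, hvw, hw⟩ := exists_center_of_length_lt hα h h5
      have h6 : S.toFun (t₁ K) = .node w :=
        ClosedPath.arrival_eq (lt_of_le_of_ne ht₁0 fun h' => h0K (h' ▸ hleast.1.2))
          (fun f hf => (hw f hf).imp_left And.right)
          (fun r hr hrK => absurd (hleast.2 ⟨hr.1.le, hrK⟩) (not_le.2 hr.2)) hleast.1.2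
      obtain ⟨h7, h8⟩ := hS.return_time hL h0K (hvw ▸ attach_mem_star hα v) hw ht₁0
        (by linarith) h6 (hend.trans h6) (hsmall h5)
      have h9 : τ K ≤ S.L := (hsmall h5).1.2.1
      have h10 := sub_le_stretch_sub (τ := τ) hℓ (by linarith : t₁ K ≤ τ K)
      have h11 := sub_le_stretch_sub (τ := τ) hℓ h9
      have h12 := le_stretch (τ := τ) hℓ (t₁ K)
      refine T.two_mul_le_volume_hitting hα.le hp hq ?_ ?_
      · rw [hθ', hθ']; linarith
      · rw [hTL, hθ', hθ', hθ']; linarith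

/-- Taking the closure adds only leaf nodes and inner ends, which are finitely many points. -/
theorem length_extremitySet_of_closure (hα : 0 < α) (h : Q.LeafCondition α)
    (hE : closure (Q.extremitySet α) = univ) :
    Q.length.real (Q.extremitySet α) = Q.totalLength := by
  have hsub : (univ : Set Q.Point) ⊆ Q.extremitySet α ∪
      (range (fun v : Q.Leaf => Point.node v.1) ∪ range (attach α)) := by
    rw [← hE, closure_extremitySet hα h, extremitySet_eq h]
    refine iUnion_subset fun v x hx => ?_
    rcases mem_arm_cases hx with rfl | h1 | rfl
    · exact Or.inr (Or.inl ⟨v, rfl⟩)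
    · exact Or.inl (mem_iUnion.2 ⟨v, h1⟩)
    · exact Or.inr (Or.inr ⟨v, rfl⟩)
  have h1 := (measureReal_mono (μ := Q.length) hsub).trans (measureReal_union_le _ _)
  have h2 : Q.length.real (range (fun v : Q.Leaf => Point.node v.1) ∪ range (attach α)) = 0 := by
    rw [measureReal_def, ((finite_range _).union (finite_range _)).measure_zero, ENNReal.toReal_zero]
  rw [h2, add_zero] at h1
  exact le_antisymm (length_extremitySet_le α) h1

theorem IsEPatrollingTour.le_patrolGuarantee (hα : 0 < α) (hα' : α < 2 * Q.totalLength)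
    (h : Q.LeafCondition α) (htour : ∃ S₀ : Q.ClosedPath, S₀.IsTour ∧ S₀.L = 2 * Q.totalLength)
    {T : Q.ClosedPath} (hT : IsEPatrollingTour α T) :
    ENNReal.ofReal (α / (Q.totalLength + Q.length.real (Q.extremitySet α))) ≤
      patrolGuarantee α T.randomExtension := by
  obtain ⟨S₀, hS₀, hS₀L⟩ := htour
  set N := Q.totalLength + Q.length.real (Q.extremitySet α) with hN
  have hN0 : 0 < N := totalLength_add_pos hα hα'
  refine TreeNetwork.le_patrolGuarantee hα.le fun a => ?_
  obtain ⟨x, τ⟩ := a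
  rw [T.randomExtension_intercepts hα.le]
  have hcpt : ∀ S : Q.ClosedPath, S.IsCPT → S.L = 2 * Q.totalLength := fun S hS =>
    le_antisymm (hS₀L ▸ hS.2 S₀ hS₀) hS.1.two_mul_totalLength_le
  have hLpos : 0 < T.L := T.L_pos
  -- If every starting time is hitting, the interception probability is 1.
  have hone : α ≤ N → T.hitting α x = univ → ENNReal.ofReal (α / N) ≤
      volume (T.hitting α x ∩ Ioc 0 (0 + T.L)) / ENNReal.ofReal T.L := by
    intro hαN hu
    rw [hu, univ_inter, Real.volume_Ioc, zero_add, sub_zero,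
      ← ENNReal.ofReal_div_of_pos hLpos, div_self hLpos.ne']
    exact ENNReal.ofReal_le_ofReal ((div_le_one hN0).2 hαN)
  by_cases hE : closure (Q.extremitySet α) = univ
  · have hT' := hT.1 hE
    have hTL := hcpt T hT'
    have hNμ : N = T.L := by rw [hN, length_extremitySet_of_closure hα h hE, hTL, two_mul]
    -- Here N = 2μ is the length of the tour, so the α hitting times before a single visit are
    -- enough.
    obtain ⟨t, -, ht⟩ := hT'.1.exists_time x 0
    rw [T.volume_hitting_shift α x 0 (t - α), hNμ, ENNReal.ofReal_div_of_pos hLpos]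
    gcongr
    have hsub : Ioc (t - α) t ⊆ T.hitting α x ∩ Ioc (t - α) (t - α + T.L) := fun s hs =>
      ⟨⟨t, ⟨hs.2, by linarith [hs.1]⟩, ht⟩, hs.1, by linarith [hs.2]⟩
    refine le_trans ?_ (measure_mono hsub)
    rw [Real.volume_Ioc, sub_sub_cancel]
  · obtain ⟨S, hST⟩ := hT.2 hE
    obtain ⟨hTL, hx⟩ := hST.guarantee hα hα' h hE (hcpt S hST.1)
    rcases hx x with hu | hge
    · refine hone ((le_totalLength hE).trans ?_) hu
      exact le_add_of_nonneg_right measureReal_nonneg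
    · refine le_trans ?_ (ENNReal.div_le_div_right hge _)
      rw [← ENNReal.ofReal_div_of_pos hLpos]
      -- α / N ≤ 2α / T.L because T.L ≤ 2N.
      refine ENNReal.ofReal_le_ofReal ((div_le_div_iff₀ hN0 hLpos).2 ?_)
      nlinarith

end

end TreeNetwork

/-! ### Loops and insertion of loops -/

section Loop

variable {X : Type*}

/-- The path `f` with the loop `C` of length `ℓ` inserted at time `t₀`. -/
noncomputable def splice (f : ℝ → X) (t₀ : ℝ) (C : ℝ → X) (ℓ t : ℝ) : X :=
  if t ≤ t₀ then f t else if t ≤ t₀ + ℓ then C (t - t₀) else f (t - ℓ)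

variable {f C : ℝ → X} {L ℓ t₀ : ℝ} {x : X}

theorem splice_before {t : ℝ} (h : t ≤ t₀) : splice f t₀ C ℓ t = f t := by
  simp [splice, h]

theorem splice_image_before {p q : ℝ} (hq : q ≤ t₀) :
    splice f t₀ C ℓ '' Icc p q = f '' Icc p q :=
  image_congr fun _ ht => splice_before (ht.2.trans hq)

variable [MetricSpace X]

/-- `f` is a unit speed path on `[0, L]` from `x` to `x`. -/
structure IsLoop (f : ℝ → X) (L : ℝ) (x : X) : Prop where
  nonneg : 0 ≤ L
  left : f 0 = x
  right : f L = x
  dist_le : ∀ s t, 0 ≤ s → s ≤ t → t ≤ L → dist (f s) (f t) ≤ t - s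

theorem IsLoop.continuousOn (hf : IsLoop f L x) : ContinuousOn f (Icc 0 L) := by
  have : LipschitzOnWith 1 f (Icc 0 L) := LipschitzOnWith.of_dist_le_mul fun s hs t ht => by
    rw [NNReal.coe_one, one_mul, Real.dist_eq]
    rcases le_total s t with h | h
    · rw [abs_sub_comm, abs_of_nonneg (by linarith)]
      exact hf.dist_le s t hs.1 h ht.2
    · rw [dist_comm, abs_of_nonneg (by linarith)]
      exact hf.dist_le t s ht.1 h hs.2
  exact this.continuousOn

theorem splice_mid (hC : IsLoop C ℓ (f t₀)) {s : ℝ} (h0 : 0 ≤ s) (h1 : s ≤ ℓ) :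
    splice f t₀ C ℓ (t₀ + s) = C s := by
  rcases h0.eq_or_lt with rfl | h0
  · rw [add_zero, splice_before le_rfl, hC.left]
  · rw [splice, if_neg (by linarith), if_pos (by linarith), add_sub_cancel_left]

theorem splice_after (hC : IsLoop C ℓ (f t₀)) {t : ℝ} (h : t₀ ≤ t) :
    splice f t₀ C ℓ (t + ℓ) = f t := by
  rcases h.eq_or_lt with rfl | h
  · rw [splice_mid hC hC.nonneg le_rfl, hC.right]
  · have := hC.nonneg
    rw [splice, if_neg (by linarith), if_neg (by linarith), add_sub_cancel_right]

theorem dist_le_of_glue {g : ℝ → X} {a b c : ℝ}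
    (h1 : ∀ s t, a ≤ s → s ≤ t → t ≤ b → dist (g s) (g t) ≤ t - s)
    (h2 : ∀ s t, b ≤ s → s ≤ t → t ≤ c → dist (g s) (g t) ≤ t - s) (s t : ℝ) (hs : a ≤ s)
    (hst : s ≤ t) (ht : t ≤ c) : dist (g s) (g t) ≤ t - s := by
  rcases le_total t b with h | h
  · exact h1 s t hs hst h
  · rcases le_total b s with h' | h'
    · exact h2 s t h' hst ht
    · have := dist_triangle (g s) (g b) (g t)
      have := h1 s b hs h' le_rfl
      have := h2 b t le_rfl h ht
      linarith

theorem IsLoop.splice (hf : IsLoop f L x) (h0 : 0 ≤ t₀) (hL : t₀ ≤ L) (hC : IsLoop C ℓ (f t₀)) :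
    IsLoop (splice f t₀ C ℓ) (L + ℓ) x := by
  refine ⟨add_nonneg hf.nonneg hC.nonneg, by rw [splice_before h0, hf.left],
    by rw [splice_after hC hL, hf.right], ?_⟩
  refine dist_le_of_glue (b := t₀) ?_ (dist_le_of_glue (b := t₀ + ℓ) ?_ ?_)
  · intro s t hs hst ht
    rw [splice_before ht, splice_before (hst.trans ht)]
    exact hf.dist_le s t hs hst (ht.trans hL)
  · intro s t hs hst ht
    have h1 := splice_mid hC (s := s - t₀) (by linarith) (by linarith)
    have h2 := splice_mid hC (s := t - t₀) (by linarith) (by linarith)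
    rw [add_sub_cancel] at h1 h2
    rw [h1, h2]
    exact (hC.dist_le _ _ (by linarith) (by linarith) (by linarith)).trans_eq (by ring)
  · intro s t hs hst ht
    have h1 := splice_after hC (t := s - ℓ) (by linarith)
    have h2 := splice_after hC (t := t - ℓ) (by linarith)
    rw [sub_add_cancel] at h1 h2
    rw [h1, h2]
    exact (hf.dist_le _ _ (by linarith) (by linarith) (by linarith)).trans_eq (by ring)

theorem splice_image (hC : IsLoop C ℓ (f t₀)) {p q : ℝ} (hp : p ≤ t₀) (hq : t₀ ≤ q) :
    splice f t₀ C ℓ '' Icc p (q + ℓ) = f '' Icc p q ∪ C '' Icc 0 ℓ := by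
  have hl := hC.nonneg
  apply subset_antisymm
  · rintro _ ⟨t, ht, rfl⟩
    rcases le_total t t₀ with h | h
    · rw [splice_before h]
      exact Or.inl ⟨t, ⟨ht.1, h.trans hq⟩, rfl⟩
    · rcases le_total t (t₀ + ℓ) with h' | h'
      · have := splice_mid hC (s := t - t₀) (by linarith) (by linarith)
        rw [add_sub_cancel] at this
        rw [this]
        exact Or.inr ⟨t - t₀, ⟨by linarith, by linarith⟩, rfl⟩
      · have := splice_after hC (t := t - ℓ) (by linarith)
        rw [sub_add_cancel] at this
        rw [this]
        exact Or.inl ⟨t - ℓ, ⟨by linarith, by linarith [ht.2]⟩, rfl⟩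
  · rintro y (⟨t, ht, rfl⟩ | ⟨s, hs, rfl⟩)
    · rcases le_total t t₀ with h | h
      · exact ⟨t, ⟨ht.1, by linarith [ht.2]⟩, splice_before h⟩
      · exact ⟨t + ℓ, ⟨by linarith [ht.1], by linarith [ht.2]⟩, splice_after hC h⟩
    · exact ⟨t₀ + s, ⟨by linarith [hs.1], by linarith [hs.2]⟩, splice_mid hC hs.1 hs.2⟩

theorem splice_image_after (hC : IsLoop C ℓ (f t₀)) {p q : ℝ} (hp : t₀ ≤ p) :
    splice f t₀ C ℓ '' Icc (p + ℓ) (q + ℓ) = f '' Icc p q := by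
  apply subset_antisymm
  · rintro _ ⟨t, ht, rfl⟩
    have := splice_after hC (t := t - ℓ) (by linarith [ht.1])
    rw [sub_add_cancel] at this
    exact ⟨t - ℓ, ⟨by linarith [ht.1], by linarith [ht.2]⟩, this.symm⟩
  · rintro _ ⟨t, ht, rfl⟩
    exact ⟨t + ℓ, ⟨by linarith [ht.1], by linarith [ht.2]⟩, splice_after hC (hp.trans ht.1)⟩

/-- The loop from `γ c` along `γ` to one end of `[a, b]`, back to the other end, and back. -/
theorem exists_zigzag {γ : ℝ → X} {a b c : ℝ}
    (hγ : ∀ s ∈ Icc a b, ∀ t ∈ Icc a b, dist (γ s) (γ t) ≤ |s - t|) (hc : c ∈ Icc a b) :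
    ∃ C, IsLoop C (2 * (b - a)) (γ c) ∧ C '' Icc 0 (2 * (b - a)) = γ '' Icc a b := by
  obtain ⟨h1, h2⟩ := hc
  -- `g` runs from `c` up to `b`, down to `a`, and up to `c` again.
  set g : ℝ → ℝ := fun t => a + |b - a - (|t - (b - c)|)| with hg
  have hmem : ∀ t, 0 ≤ t → t ≤ 2 * (b - a) → g t ∈ Icc a b := by
    intro t h3 h4
    have h5 : |t - (b - c)| ≤ 2 * (b - a) := abs_le.2 ⟨by linarith, by linarith⟩
    have h6 := abs_nonneg (t - (b - c))
    have h7 : |b - a - (|t - (b - c)|)| ≤ b - a := abs_le.2 ⟨by linarith, by linarith⟩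
    exact ⟨le_add_of_nonneg_right (abs_nonneg _), by simp only [hg]; linarith⟩
  refine ⟨fun t => γ (g t), ⟨by linarith, ?_, ?_, ?_⟩, ?_⟩
  · simp only [hg]
    rw [zero_sub, abs_neg, abs_of_nonneg (by linarith : 0 ≤ b - c),
      abs_of_nonneg (by linarith : 0 ≤ b - a - (b - c))]
    congr 1; ring
  · simp only [hg]
    rw [abs_of_nonneg (by linarith : 0 ≤ 2 * (b - a) - (b - c)),
      abs_of_nonpos (by linarith : b - a - (2 * (b - a) - (b - c)) ≤ 0)]
    congr 1; ring
  · intro s t hs hst ht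
    refine (hγ _ (hmem s hs (hst.trans ht)) _ (hmem t (hs.trans hst) ht)).trans ?_
    have h3 := abs_abs_sub_abs_le_abs_sub (b - a - |s - (b - c)|) (b - a - |t - (b - c)|)
    have h4 := abs_abs_sub_abs_le_abs_sub (t - (b - c)) (s - (b - c))
    rw [sub_sub_sub_cancel_left] at h3
    rw [sub_sub_sub_cancel_right, abs_of_nonneg (sub_nonneg.2 hst)] at h4
    simp only [hg]
    rw [add_sub_add_left_eq_sub]
    exact h3.trans h4
  · apply subset_antisymm
    · rintro _ ⟨t, ht, rfl⟩
      exact ⟨g t, hmem t ht.1 ht.2, rfl⟩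
    · rintro _ ⟨y, hy, rfl⟩
      -- The position `y` is met on the way down.
      refine ⟨b - c + (b - y), ⟨by linarith [hy.2], by linarith [hy.1]⟩, ?_⟩
      simp only [hg]
      rw [add_sub_cancel_left, abs_of_nonneg (sub_nonneg.2 hy.2),
        abs_of_nonneg (by linarith [hy.1] : 0 ≤ b - a - (b - y))]
      congr 1; ring

open TreeNetwork in
theorem stretch_insert {ι : Type*} [DecidableEq ι] {F : Finset ι} {τ ℓ : ι → ℝ} {j : ι}
    (hj : j ∉ F) (t : ℝ) : stretch (insert j F) τ ℓ t =
      stretch F τ ℓ t + if τ j < t then ℓ j else 0 := by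
  classical
  unfold stretch
  simp only [Finset.sum_filter]
  rw [Finset.sum_insert hj]
  ring

-- `stretch` counts insertions strictly before `t`, so `stretch F τ ℓ (τ i)` is the start of the
-- inserted loop `i`. That loop is over before the image of any later time.
open TreeNetwork in
theorem stretch_add_le {ι : Type*} {F : Finset ι} {τ ℓ : ι → ℝ} (hℓ : ∀ i ∈ F, 0 ≤ ℓ i) {i : ι}
    (hi : i ∈ F) {t : ℝ} (h : τ i < t) : stretch F τ ℓ (τ i) + ℓ i ≤ stretch F τ ℓ t := by
  classical
  obtain ⟨F', hi', rfl⟩ : ∃ F', i ∉ F' ∧ F = insert i F' :=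
    ⟨F.erase i, Finset.notMem_erase i F, (Finset.insert_erase hi).symm⟩
  rw [stretch_insert hi', stretch_insert hi', if_neg (lt_irrefl _), if_pos h]
  have := sub_le_stretch_sub (F := F') (τ := τ)
    (fun j hj => hℓ j (Finset.mem_insert_of_mem hj)) h.le
  linarith

open TreeNetwork in
/-- Insertion of finitely many loops at different times. -/
theorem IsLoop.exists_insertions {ι : Type*} (hf : IsLoop f L x) (F : Finset ι) {τ ℓ : ι → ℝ}
    {C : ι → ℝ → X} (hτ : ∀ i ∈ F, 0 ≤ τ i ∧ τ i < L) (hinj : InjOn τ F)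
    (hC : ∀ i ∈ F, IsLoop (C i) (ℓ i) (f (τ i))) :
    ∃ g, IsLoop g (stretch F τ ℓ L) x ∧ (∀ t ∈ Icc 0 L, g (stretch F τ ℓ t) = f t) ∧
      ∀ i ∈ F, ∀ s ∈ Icc 0 (ℓ i), g (stretch F τ ℓ (τ i) + s) = C i s := by
  classical
  induction F using Finset.induction_on with
  | empty => exact ⟨f, by simpa [stretch] using hf, fun t _ => by simp [stretch], by simp⟩
  | insert j F hj ih =>
    have hF : ∀ i ∈ F, i ∈ insert j F := fun i hi => Finset.mem_insert_of_mem hi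
    obtain ⟨g, hg, hgf, hgC⟩ := ih (fun i hi => hτ i (hF i hi))
      (hinj.mono (by simp)) (fun i hi => hC i (hF i hi))
    have hℓ : ∀ i ∈ F, 0 ≤ ℓ i := fun i hi => (hC i (hF i hi)).nonneg
    obtain ⟨h0, hL⟩ := hτ j (Finset.mem_insert_self j F)
    have hmono : ∀ {s t}, s ≤ t → stretch F τ ℓ s ≤ stretch F τ ℓ t := fun hst => by
      have := sub_le_stretch_sub (τ := τ) hℓ hst
      linarith
    have hCj : IsLoop (C j) (ℓ j) (g (stretch F τ ℓ (τ j))) := by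
      rw [hgf _ ⟨h0, hL.le⟩]
      exact hC j (Finset.mem_insert_self j F)
    -- Loop `j` goes in where the earlier insertions have carried the time `τ j`. The loops at later
    -- times are shifted by `ℓ j`, those at earlier times stay in place; equal times are excluded by
    -- `hinj`.
    refine ⟨_root_.splice g (stretch F τ ℓ (τ j)) (C j) (ℓ j), ?_, ?_, ?_⟩
    · rw [stretch_insert hj, if_pos hL]
      exact hg.splice (h0.trans (le_stretch hℓ _)) (hmono hL.le) hCj
    · intro t ht
      rw [stretch_insert hj]
      split_ifs with h
      · rw [splice_after hCj (hmono h.le), hgf t ht]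
      · rw [add_zero, splice_before (hmono (not_lt.1 h)), hgf t ht]
    · intro i hi s hs
      rw [stretch_insert hj]
      rcases Finset.mem_insert.1 hi with rfl | hi
      · rw [if_neg (lt_irrefl _), add_zero, splice_mid hCj hs.1 hs.2]
      · have hne : τ i ≠ τ j := fun h =>
          hj (hinj (by simp [hi]) (by simp) h ▸ hi)
        split_ifs with h
        · rw [add_right_comm, splice_after hCj
            (le_add_of_le_of_nonneg (hmono h.le) hs.1), hgC i hi s hs]
        · have h' := stretch_add_le hℓ hi (lt_of_le_of_ne (not_lt.1 h) hne)
          rw [add_zero, splice_before (by linarith [hs.2]), hgC i hi s hs]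

/-- Insertion of loops at the first arrival at their base points. -/
theorem IsLoop.exists_first_arrival_insertions {ι : Type*} (hf : IsLoop f L x) {y : ι → X}
    {C : ι → ℝ → X} {ℓ : ι → ℝ} (hC : ∀ i, IsLoop (C i) (ℓ i) (y i)) {G : Set X} {A : ι → Set X}
    (hA : ∀ i, C i '' Icc 0 (ℓ i) = A i) (hG : f '' Icc 0 L = G) (hyG : ∀ i, y i ∈ G)
    (hGA : ∀ i, ∀ z ∈ G, z ∈ A i → z = y i) (hyA : ∀ i j, y i ∈ A j → y i = y j)
    (hAA : ∀ i j z, z ∈ A i → z ∈ A j → y i = y j) [DecidableEq X] (F : Finset ι) :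
    ∃ g, IsLoop g (L + ∑ i ∈ F, ℓ i) x ∧
      g '' Icc 0 (L + ∑ i ∈ F, ℓ i) = G ∪ ⋃ i ∈ F, A i ∧
      ∀ k, ∃ t₁, 0 ≤ t₁ ∧ t₁ + ∑ i ∈ F with y i = y k, ℓ i ≤ L + ∑ i ∈ F, ℓ i ∧
        (∀ t, 0 ≤ t → t < t₁ → g t ∉ insert (y k) (⋃ i ∈ F.filter fun i => y i = y k, A i)) ∧
        g t₁ = y k ∧ g (t₁ + ∑ i ∈ F with y i = y k, ℓ i) = y k ∧
        g '' Icc t₁ (t₁ + ∑ i ∈ F with y i = y k, ℓ i) =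
          insert (y k) (⋃ i ∈ F.filter fun i => y i = y k, A i) := by
  classical
  induction F using Finset.induction_on with
  -- With nothing inserted the block at `y k` is the single point `y k`; the `insert` in the
  -- invariant keeps it meaningful when no loop is based there yet.
  | empty =>
    refine ⟨f, by simpa using hf, by simpa using hG, fun k => ?_⟩
    have hk := hyG k
    rw [← hG] at hk
    obtain ⟨t, ht, htk⟩ := hk
    have hcl : IsCompact {t | t ∈ Icc 0 L ∧ f t ∈ ({y k} : Set X)} := by
      have := hf.continuousOn.preimage_isClosed_of_isClosed isClosed_Icc
        (isClosed_singleton (x := y k))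
      exact isCompact_Icc.of_isClosed_subset this inter_subset_left
    obtain ⟨t₁, ⟨h1, h2⟩, h3⟩ := hcl.exists_isLeast ⟨t, ht, htk⟩
    refine ⟨t₁, h1.1, by simpa using h1.2, fun t h4 h5 h6 => ?_, h2, by simpa using h2,
      by simpa using h2⟩
    have h6' : f t = y k := by simpa using h6
    exact absurd (h3 ⟨⟨h4, h5.le.trans h1.2⟩, h6'⟩) (not_le.2 h5)
  | insert a F ha ih =>
    obtain ⟨g, hg, himg, hk⟩ := ih
    obtain ⟨t₀, h0, h0L, h0f, h0a, h0e, h0i⟩ := hk a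
    set m := ∑ i ∈ F with y i = y a, ℓ i with hm
    have hm0 : 0 ≤ m := Finset.sum_nonneg fun i _ => (hC i).nonneg
    have hCa : IsLoop (C a) (ℓ a) (g t₀) := h0a.symm ▸ hC a
    have hla := (hC a).nonneg
    have hsum : L + ∑ i ∈ insert a F, ℓ i = L + ∑ i ∈ F, ℓ i + ℓ a := by
      rw [Finset.sum_insert ha]; ring
    refine ⟨_root_.splice g t₀ (C a) (ℓ a), ?_, ?_, fun k => ?_⟩
    · rw [hsum]
      exact hg.splice h0 (by linarith) hCa
    · rw [hsum, splice_image hCa h0 (by linarith), himg, hA, Finset.set_biUnion_insert, union_assoc,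
        union_comm (A a)]
    -- A loop with the same base point is put in front of the block already there, at the same first
    -- arrival time, so the block stays contiguous.
    · by_cases hka : y k = y a
      · have hfil : (insert a F).filter (fun i => y i = y k) =
            insert a (F.filter fun i => y i = y a) := by
          rw [Finset.filter_insert, if_pos hka.symm, hka]
        have haf : a ∉ F.filter fun i => y i = y a := fun h => ha (Finset.mem_filter.1 h).1
        rw [hfil, Finset.sum_insert haf, ← hm, Finset.set_biUnion_insert, hka, add_comm (ℓ a) m]
        simp only [← add_assoc]
        refine ⟨t₀, h0, by linarith, fun t ht htt hmem => ?_, ?_, ?_, ?_⟩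
        · rw [splice_before htt.le] at hmem
          refine h0f t ht htt ?_
          rcases hmem with hmem | hmem | hmem
          · exact Or.inl hmem
          · have hgt : g t ∈ G ∪ ⋃ i ∈ F, A i := by
              rw [← himg]
              exact ⟨t, ⟨ht, by linarith⟩, rfl⟩
            rcases hgt with hgt | hgt
            · exact Or.inl (hGA a _ hgt hmem)
            · obtain ⟨i, hi, hgi⟩ := mem_iUnion₂.1 hgt
              exact Or.inr (mem_iUnion₂.2 ⟨i, Finset.mem_filter.2 ⟨hi, hAA i a _ hgi hmem⟩, hgi⟩)
          · exact Or.inr hmem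
        · rw [splice_before le_rfl, h0a]
        · rw [splice_after hCa (by linarith), h0e]
        · rw [splice_image hCa le_rfl (by linarith), h0i, hA, insert_union, union_comm (A a)]
      · have hfil : (insert a F).filter (fun i => y i = y k) = F.filter fun i => y i = y k := by
          rw [Finset.filter_insert, if_neg fun h => hka h.symm]
        obtain ⟨t₁, h1, h1L, h1f, h1k, h1e, h1i⟩ := hk k
        rw [hfil]
        set K := insert (y k) (⋃ i ∈ F.filter fun i => y i = y k, A i) with hK
        set n := ∑ i ∈ F with y i = y k, ℓ i with hn
        have hn0 : 0 ≤ n := Finset.sum_nonneg fun i _ => (hC i).nonneg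
        have hKa : ∀ z ∈ K, z ∉ A a := by
          rintro z (rfl | hz) hza
          · exact hka (hyA k a hza)
          · obtain ⟨i, hi, hzi⟩ := mem_iUnion₂.1 hz
            exact hka ((Finset.mem_filter.1 hi).2.symm.trans (hAA i a z hzi hza))
        have hyaA : y a ∈ A a := by
          rw [← hA a]
          exact ⟨0, ⟨le_rfl, hla⟩, (hC a).left⟩
        -- The new loop avoids the block at `y k`, so it is inserted entirely before or entirely
        -- after it. In the first case the block is delayed by `ℓ a`.
        have ht₀ : t₀ ∉ Icc t₁ (t₁ + n) := by
          intro ht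
          have : g t₀ ∈ K := h1i ▸ mem_image_of_mem g ht
          rw [h0a] at this
          exact hKa _ this hyaA
        rw [mem_Icc, not_and_or, not_le, not_le] at ht₀
        rcases ht₀ with ht₀ | ht₀
        · refine ⟨t₁ + ℓ a, by linarith, by linarith, fun t ht htt hmem => ?_, ?_, ?_, ?_⟩
          · rcases le_total t t₀ with h | h
            · rw [splice_before h] at hmem
              exact h1f t ht (by linarith) hmem
            · rcases le_total t (t₀ + ℓ a) with h' | h'
              · have := splice_mid hCa (s := t - t₀) (by linarith) (by linarith)
                rw [add_sub_cancel] at this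
                rw [this] at hmem
                refine hKa _ hmem ?_
                rw [← hA a]
                exact ⟨t - t₀, ⟨by linarith, by linarith⟩, rfl⟩
              · have := splice_after hCa (t := t - ℓ a) (by linarith)
                rw [sub_add_cancel] at this
                rw [this] at hmem
                exact h1f _ (by linarith) (by linarith) hmem
          · rw [splice_after hCa ht₀.le, h1k]
          · rw [add_right_comm, splice_after hCa (by linarith), h1e]
          · rw [add_right_comm, splice_image_after hCa ht₀.le, h1i]
        · refine ⟨t₁, h1, by linarith, fun t ht htt => ?_, ?_, ?_, ?_⟩
          · rw [splice_before (by linarith)]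
            exact h1f t ht htt
          · rw [splice_before (by linarith), h1k]
          · rw [splice_before ht₀.le, h1e]
          · rw [splice_image_before ht₀.le, h1i]

end Loop

namespace TreeNetwork

variable {V : Type*} [Fintype V] {Q : TreeNetwork V}

/-- The closed path that repeats a loop. -/
theorem exists_closedPath {f : ℝ → Q.Point} {L : ℝ} {x : Q.Point} (hf : IsLoop f L x)
    (hL : 0 < L) : ∃ S : Q.ClosedPath, S.L = L ∧ ∀ t ∈ Icc 0 L, S.toFun t = f t := by
  set r : ℝ → ℝ := fun t => toIcoMod hL 0 t with hr
  have hrm : ∀ t, r t ∈ Ico 0 L := fun t => by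
    have := toIcoMod_mem_Ico hL 0 t
    rwa [zero_add] at this
  have hdist : ∀ s t, s ≤ t → dist (f (r s)) (f (r t)) ≤ t - s := by
    intro s t hst
    have hs := toIcoMod_add_toIcoDiv_zsmul hL 0 s
    have ht := toIcoMod_add_toIcoDiv_zsmul hL 0 t
    set m := toIcoDiv hL 0 s
    set n := toIcoDiv hL 0 t
    rw [zsmul_eq_mul] at hs ht
    have hrs := hrm s
    have hrt := hrm t
    change r s + m * L = s at hs
    change r t + n * L = t at ht
    -- `m` and `n` count the completed periods. Times in different periods are compared through the
    -- base point `x`.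
    rcases lt_trichotomy m n with hmn | hmn | hmn
    · have h1 : (m : ℝ) + 1 ≤ n := by exact_mod_cast hmn
      have h2 : (m : ℝ) * L + L ≤ n * L := by nlinarith
      have h3 := hf.dist_le (r s) L hrs.1 hrs.2.le le_rfl
      have h4 := hf.dist_le 0 (r t) le_rfl hrt.1 hrt.2.le
      have h5 := dist_triangle (f (r s)) x (f (r t))
      rw [hf.right] at h3
      rw [hf.left] at h4
      linarith
    · rw [hmn] at hs
      exact (hf.dist_le _ _ hrs.1 (by linarith) hrt.2.le).trans_eq (by linarith)
    · have h1 : (n : ℝ) + 1 ≤ m := by exact_mod_cast hmn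
      have h2 : (n : ℝ) * L + L ≤ m * L := by nlinarith
      linarith [hrs.1, hrt.2]
  refine ⟨⟨L, hL, fun t => f (r t), ?_, ?_⟩, rfl, ?_⟩
  · refine LipschitzWith.of_dist_le_mul fun s t => ?_
    rw [NNReal.coe_one, one_mul, Real.dist_eq]
    rcases le_total s t with h | h
    · rw [abs_sub_comm, abs_of_nonneg (by linarith)]
      exact hdist s t h
    · rw [dist_comm, abs_of_nonneg (by linarith)]
      exact hdist t s h
  · intro t
    simp only [hr, toIcoMod_add_right]
  · intro t ht
    change f (r t) = f t
    rcases ht.2.eq_or_lt with h | h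
    · have : r t = 0 := by
        have := toIcoMod_apply_right hL 0
        rw [zero_add] at this
        rw [h]
        exact this
      rw [this, h, hf.left, hf.right]
    · have : r t = t := by
        simp only [hr]
        rw [toIcoMod_eq_self]
        simpa using ⟨ht.1, h⟩
      rw [this]

/-! ### Tours of the core -/

theorem onArc_zigzag {e : Q.Arc} {a b c : ℝ} (ha : 0 ≤ a) (hb : b ≤ Q.len e) (hc : c ∈ Icc a b) :
    ∃ C : ℝ → Q.Point, IsLoop C (2 * (b - a)) (onArc e c) ∧
      C '' Icc 0 (2 * (b - a)) = onArc e '' Icc a b :=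
  exists_zigzag (fun _ hs _ ht => (dist_onArc e ⟨ha.trans hs.1, hs.2.trans hb⟩
    ⟨ha.trans ht.1, ht.2.trans hb⟩).le) hc

/-- A proper nonempty set of arcs can be extended by an adjacent arc. -/
theorem exists_adjacent_arc {F : Finset Q.Arc} {f₀ : Q.Arc} (hf₀ : f₀ ∈ F) (hF : ∃ e, e ∉ F) :
    ∃ e ∉ F, ∃ g ∈ F, ∃ u, u ∈ e.1 ∧ u ∈ g.1 := by
  by_contra! hno
  -- If no arc outside `F` touched `F`, the set of nodes touched by `F` would be closed under walks,
  -- hence would contain all nodes.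
  have hclosed : ∀ {u w : V}, Q.graph.Walk u w → (∃ g ∈ F, u ∈ g.1) → ∃ g ∈ F, w ∈ g.1 := by
    intro u w p
    induction p with
    | nil => exact id
    | @cons u u' w hadj p ih =>
      rintro ⟨g, hg, hug⟩
      apply ih
      set e : Q.Arc := ⟨s(u, u'), hadj⟩ with he
      refine ⟨e, ?_, by simp [he]⟩
      by_contra heF
      exact hno e heF g hg u (by simp [he]) hug
  obtain ⟨e, he⟩ := hF
  obtain ⟨p⟩ := Q.isTree.connected.preconnected (tail f₀) (tail e)
  obtain ⟨g, hg, hu⟩ := hclosed p ⟨f₀, hf₀, tail_mem f₀⟩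
  exact hno e he g hg (tail e) (tail_mem e) hu

/-- A closed path that covers the part `[lo e, hi e]` of each arc `e` twice, where arcs are shortened
only at leaf nodes. -/
theorem exists_core_loop {lo hi : Q.Arc → ℝ} (hlo : ∀ e, 0 ≤ lo e) (hhi : ∀ e, hi e ≤ Q.len e)
    (hlohi : ∀ e, lo e ≤ hi e) (htail : ∀ e, ¬ Q.IsLeaf (tail e) → lo e = 0)
    (hhead : ∀ e, ¬ Q.IsLeaf (head e) → hi e = Q.len e) {f₀ : Q.Arc} {c : ℝ}
    (hc : c ∈ Icc (lo f₀) (hi f₀)) :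
    ∃ f : ℝ → Q.Point, IsLoop f (∑ e, 2 * (hi e - lo e)) (onArc f₀ c) ∧
      f '' Icc 0 (∑ e, 2 * (hi e - lo e)) = ⋃ e, onArc e '' Icc (lo e) (hi e) := by
  classical
  set P : Finset Q.Arc → Prop := fun F => f₀ ∈ F ∧ ∃ f : ℝ → Q.Point,
    IsLoop f (∑ e ∈ F, 2 * (hi e - lo e)) (onArc f₀ c) ∧
      f '' Icc 0 (∑ e ∈ F, 2 * (hi e - lo e)) = ⋃ e ∈ F, onArc e '' Icc (lo e) (hi e) with hP
  have hnode : ∀ (e : Q.Arc) (u : V), u ∈ e.1 → ¬ Q.IsLeaf u →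
      ∃ s ∈ Icc (lo e) (hi e), onArc e s = .node u := by
    intro e u hu hleaf
    rcases mem_arc_iff.1 hu with rfl | rfl
    · exact ⟨0, ⟨(htail e hleaf).le, (hlo e).trans (hlohi e)⟩, onArc_zero e⟩
    · exact ⟨Q.len e, ⟨(hlohi e).trans (hhi e), (hhead e hleaf).ge⟩, onArc_len e⟩
  have hne : ({F | P F} : Set (Finset Q.Arc)).Nonempty := by
    refine ⟨{f₀}, Finset.mem_singleton_self _, ?_⟩
    simpa using onArc_zigzag (hlo f₀) (hhi f₀) hc
  obtain ⟨F, hF⟩ := (toFinite {F | P F}).exists_maximal hne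
  obtain ⟨hf₀, f, hf, himg⟩ := hF.prop
  have hall : F = Finset.univ := by
    by_contra hFu
    have hex : ∃ e, e ∉ F := by
      by_contra! h
      exact hFu (Finset.eq_univ_iff_forall.2 h)
    obtain ⟨e, he, g, hg, u, hue, hug⟩ := exists_adjacent_arc hf₀ hex
    -- Two arcs meet at `u`, so it is not a leaf node, and neither arc has been shortened there.
    have hu : ¬ Q.IsLeaf u := fun h => he (arc_unique_of_isLeaf h hue hug ▸ hg)
    obtain ⟨s, hs, hsu⟩ := hnode g u hug hu
    obtain ⟨s', hs', hsu'⟩ := hnode e u hue hu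
    obtain ⟨t₀, ht₀, hft⟩ : Point.node u ∈ f '' Icc 0 (∑ e ∈ F, 2 * (hi e - lo e)) := by
      rw [himg]
      exact mem_iUnion₂.2 ⟨g, hg, s, hs, hsu⟩
    obtain ⟨C, hC, hCimg⟩ := onArc_zigzag (hlo e) (hhi e) hs'
    rw [hsu', ← hft] at hC
    have hins : P (insert e F) := by
      refine ⟨Finset.mem_insert_of_mem hf₀, splice f t₀ C (2 * (hi e - lo e)), ?_, ?_⟩
      · rw [Finset.sum_insert he, add_comm]
        exact hf.splice ht₀.1 ht₀.2 hC
      · rw [Finset.sum_insert he, add_comm, splice_image hC ht₀.1 ht₀.2, himg, hCimg,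
          Finset.set_biUnion_insert, union_comm]
    exact he (hF.le_of_ge hins (Finset.subset_insert e F) (Finset.mem_insert_self e F))
  subst hall
  exact ⟨f, hf, by rw [himg]; simp⟩

theorem exists_onArc_eq (x : Q.Point) : ∃ e, ∃ t ∈ Icc 0 (Q.len e), onArc e t = x := by
  cases x with
  | inner e s => exact ⟨e, s, Ioo_subset_Icc_self s.2, onArc_of_mem s.2⟩
  | node w =>
    obtain ⟨u, hu⟩ : ∃ u, u ≠ w := by
      have := Q.two_lt_card
      exact Fintype.exists_ne_of_one_lt_card (by omega) w
    obtain ⟨e, ⟨he, -⟩, -⟩ := existsUnique_separating_arc (Q := Q) hu.symm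
    have hl := (Q.len_pos e).le
    rcases mem_arc_iff.1 he with rfl | rfl
    · exact ⟨e, 0, ⟨le_rfl, hl⟩, onArc_zero e⟩
    · exact ⟨e, Q.len e, ⟨hl, le_rfl⟩, onArc_len e⟩

/-- The core loop with nothing cut off. Combined with `two_mul_totalLength_le`, it shows that
Chinese Postman Tours have length exactly 2μ. -/
theorem exists_tour (Q : TreeNetwork V) :
    ∃ S : Q.ClosedPath, S.IsTour ∧ S.L = 2 * Q.totalLength := by
  obtain ⟨v⟩ : Nonempty V := by
    have := Q.two_lt_card
    exact Fintype.card_pos_iff.1 (by omega)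
  obtain ⟨f₀, -⟩ := exists_onArc_eq (Q := Q) (.node v)
  obtain ⟨f, hf, himg⟩ := exists_core_loop (Q := Q) (lo := fun _ => 0) (hi := Q.len)
    (fun _ => le_rfl) (fun _ => le_rfl) (fun e => (Q.len_pos e).le) (fun _ _ => rfl)
    (fun _ _ => rfl) (f₀ := f₀) (c := 0) ⟨le_rfl, (Q.len_pos f₀).le⟩
  have hsum : ∑ e, 2 * (Q.len e - 0) = 2 * Q.totalLength := by
    rw [totalLength_eq, Finset.mul_sum]
    simp
  rw [hsum] at hf himg
  have hpos : 0 < 2 * Q.totalLength := by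
    have := (Q.len_pos f₀).trans_le (len_le_totalLength f₀)
    linarith
  obtain ⟨S, hSL, hS⟩ := exists_closedPath hf hpos
  refine ⟨S, eq_univ_of_forall fun x => ?_, hSL⟩
  obtain ⟨e, t, ht, rfl⟩ := exists_onArc_eq x
  have : onArc e t ∈ f '' Icc 0 (2 * Q.totalLength) := by
    rw [himg]
    exact mem_iUnion.2 ⟨e, t, ht, rfl⟩
  obtain ⟨s, hs, hfs⟩ := this
  exact ⟨s, (hS s hs).trans hfs⟩

theorem ClosedPath.IsTour.isCPT {S : Q.ClosedPath} (hS : S.IsTour)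
    (hL : S.L = 2 * Q.totalLength) : S.IsCPT :=
  ⟨hS, fun _ hS' => hL ▸ hS'.two_mul_totalLength_le⟩

/-! ### The arcs without the arms -/

open Classical in
/-- The length that the arms cut from the arcs at their end `w`. -/
noncomputable def cutAt (α : ℝ) (w : V) : ℝ := ∑ v : Q.Leaf, if v.1 = w then cut α v else 0

section

variable {α : ℝ}

theorem cutAt_leaf (v : Q.Leaf) : cutAt (Q := Q) α v.1 = cut α v := by
  classical
  unfold cutAt
  rw [Finset.sum_eq_single v (fun u _ hu => if_neg fun h => hu (Subtype.ext h)) (by simp), if_pos rfl]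

theorem cutAt_of_not_isLeaf {w : V} (hw : ¬ Q.IsLeaf w) : cutAt (Q := Q) α w = 0 := by
  classical
  unfold cutAt
  exact Finset.sum_eq_zero fun v _ => if_neg fun h : v.1 = w => hw (h ▸ v.2)

theorem cutAt_nonneg (hα : 0 < α) (w : V) : 0 ≤ cutAt (Q := Q) α w := by
  by_cases hw : Q.IsLeaf w
  · rw [cutAt_leaf ⟨w, hw⟩]
    exact (cut_pos hα _).le
  · rw [cutAt_of_not_isLeaf hw]

/-- Every leaf node is an end of exactly one arc. -/
theorem sum_cutAt (α : ℝ) :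
    ∑ e : Q.Arc, (cutAt (Q := Q) α (tail e) + cutAt (Q := Q) α (head e)) = ∑ v : Q.Leaf, cut α v := by
  classical
  unfold cutAt
  simp only [← Finset.sum_add_distrib]
  rw [Finset.sum_comm]
  refine Finset.sum_congr rfl fun v _ => ?_
  rw [Finset.sum_eq_single (leafArc v)]
  · have hne := (adj_tail_head (leafArc v)).ne
    rcases mem_arc_iff.1 (mem_leafArc v) with h | h
    · rw [if_pos h, if_neg (fun h' => hne (h.symm.trans h')), add_zero]
    · rw [if_pos h, if_neg (fun h' => hne (h'.symm.trans h)), zero_add]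
  · intro e _ he
    have hv : v.1 ∉ e.1 := fun h => he (leafArc_eq h).symm
    rw [mem_arc_iff, not_or] at hv
    rw [if_neg hv.1, if_neg hv.2, add_zero]
  · simp

theorem tip_eq_onArc_of_tail {v : Q.Leaf} (h : v.1 = tail (leafArc v)) (t : ℝ) :
    tip v t = onArc (leafArc v) t := by
  rw [tip, ray, if_neg]
  rw [h]
  exact not_headSide_tail _

theorem tip_eq_onArc_of_head {v : Q.Leaf} (h : v.1 = head (leafArc v)) (t : ℝ) :
    tip v t = onArc (leafArc v) (Q.len (leafArc v) - t) := by
  rw [tip, ray, if_pos]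
  rw [h]
  exact headSide_head _

/-- At most one end of an arc is a leaf node, so at most one arm is cut from it. -/
theorem cutAt_tail_add_head_le (α : ℝ) (e : Q.Arc) :
    cutAt (Q := Q) α (tail e) + cutAt (Q := Q) α (head e) ≤ Q.len e := by
  have hne := (adj_tail_head e).ne
  by_cases ht : Q.IsLeaf (tail e)
  · rw [cutAt_of_not_isLeaf (not_isLeaf_of_mem ht (tail_mem e) (head_mem e) hne.symm), add_zero,
      cutAt_leaf ⟨_, ht⟩]
    exact (cut_le_len α _).trans_eq (by rw [leafArc_eq (v := ⟨_, ht⟩) (tail_mem e)])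
  · rw [cutAt_of_not_isLeaf ht, zero_add]
    by_cases hh : Q.IsLeaf (head e)
    · rw [cutAt_leaf ⟨_, hh⟩]
      exact (cut_le_len α _).trans_eq (by rw [leafArc_eq (v := ⟨_, hh⟩) (head_mem e)])
    · rw [cutAt_of_not_isLeaf hh]
      exact (Q.len_pos e).le

/-- A point of an arc that does not belong to the core lies in an arm, off its inner end. -/
theorem mem_arm_of_not_mem_core {e : Q.Arc} {t : ℝ} (ht : t ∈ Icc 0 (Q.len e))
    (h : t ∉ Icc (cutAt (Q := Q) α (tail e)) (Q.len e - cutAt (Q := Q) α (head e))) :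
    ∃ v : Q.Leaf, onArc e t ∈ arm v (cut α v) := by
  rw [mem_Icc, not_and_or, not_le, not_le] at h
  rcases h with h | h
  · by_cases hl : Q.IsLeaf (tail e)
    · refine ⟨⟨_, hl⟩, t, ⟨ht.1, ?_⟩, ?_⟩
      · rw [cutAt_leaf ⟨_, hl⟩] at h
        exact h.le
      · have he := leafArc_eq (v := ⟨_, hl⟩) (tail_mem e)
        rw [tip_eq_onArc_of_tail (by rw [he]), he]
    · rw [cutAt_of_not_isLeaf hl] at h
      exact absurd ht.1 (not_le.2 h)
  · by_cases hl : Q.IsLeaf (head e)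
    · refine ⟨⟨_, hl⟩, Q.len e - t, ⟨by linarith [ht.2], ?_⟩, ?_⟩
      · rw [cutAt_leaf ⟨_, hl⟩] at h
        linarith
      · have he := leafArc_eq (v := ⟨_, hl⟩) (head_mem e)
        rw [tip_eq_onArc_of_head (by rw [he]), he, sub_sub_cancel]
    · rw [cutAt_of_not_isLeaf hl, sub_zero] at h
      exact absurd ht.2 (not_le.2 h)

theorem attach_mem_core (v : Q.Leaf) :
    ∃ e, attach α v ∈
      onArc e '' Icc (cutAt (Q := Q) α (tail e)) (Q.len e - cutAt (Q := Q) α (head e)) := by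
  have h0 := cutAt_tail_add_head_le α (leafArc v)
  refine ⟨leafArc v, ?_⟩
  rcases mem_arc_iff.1 (mem_leafArc v) with h | h
  · refine ⟨cut α v, ⟨?_, ?_⟩, (tip_eq_onArc_of_tail h _).symm⟩
    · rw [← h, cutAt_leaf]
    · rw [← h, cutAt_leaf] at h0
      linarith
  · refine ⟨Q.len (leafArc v) - cut α v, ⟨?_, ?_⟩, (tip_eq_onArc_of_head h _).symm⟩
    · rw [← h, cutAt_leaf] at h0
      linarith
    · rw [← h, cutAt_leaf]

theorem eq_attach_of_mem_core (hα : 0 < α) {v : Q.Leaf} {e : Q.Arc} {x : Q.Point}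
    (hx : x ∈ onArc e '' Icc (cutAt (Q := Q) α (tail e)) (Q.len e - cutAt (Q := Q) α (head e)))
    (hv : x ∈ arm v (cut α v)) : x = attach α v := by
  obtain ⟨t, ht, rfl⟩ := hx
  have hta := cutAt_nonneg (Q := Q) hα (tail e)
  have hhe := cutAt_nonneg (Q := Q) hα (head e)
  have htI : t ∈ Icc 0 (Q.len e) := ⟨hta.trans ht.1, by linarith [ht.2]⟩
  have hcut := cut_pos hα v
  rcases mem_arm_cases hv with h | h | h
  · exfalso
    have hl := Q.len_pos e
    rcases htI.1.eq_or_lt with h0 | h0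
    · rw [← h0, onArc_zero] at h
      injection h with h
      rw [h, cutAt_leaf, ← h0] at ht
      linarith [ht.1]
    · rcases htI.2.eq_or_lt with h1 | h1
      · rw [h1, onArc_len] at h
        injection h with h
        rw [h, cutAt_leaf, h1] at ht
        linarith [ht.2]
      · rw [onArc_of_mem ⟨h0, h1⟩] at h
        cases h
  · exfalso
    rw [mem_openArm_iff (cut_le_len α v)] at h
    obtain ⟨h1, h2⟩ := h
    have he : e = leafArc v := by
      by_contra hne
      rw [coord_onArc_ne hne] at h1
      rcases nodeCoord_eq (leafArc v) (tail e) with h3 | h3 <;> simp [h3] at h1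
    subst he
    rcases mem_arc_iff.1 (mem_leafArc v) with h3 | h3
    · rw [depth, coord_onArc htI] at h2
      have h4 := nodeCoord_tail (leafArc v)
      rw [← h3] at h4
      rw [h4, abs_lt] at h2
      rw [← h3, cutAt_leaf] at ht
      linarith [ht.1]
    · rw [depth, coord_onArc htI] at h2
      have h4 := nodeCoord_head (leafArc v)
      rw [← h3] at h4
      rw [h4, abs_lt] at h2
      rw [← h3, cutAt_leaf] at ht
      linarith [ht.2]
  · exact h

/-- A tour of length `2 μ` that starts at a given regular point outside the closure of the extremity
set and covers each component of that closure in one closed path upon its first arrival. -/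
theorem exists_tour_with_components (hα : 0 < α) (h : Q.LeafCondition α) {x₀ : Q.Point}
    (hx₀ : x₀ ∉ closure (Q.extremitySet α)) :
    ∃ S : Q.ClosedPath, S.IsTour ∧ S.L = 2 * Q.totalLength ∧ S.toFun 0 = x₀ ∧
      ∀ v : Q.Leaf, ∃ t₁, IsLeast {t | 0 ≤ t ∧ S.toFun t ∈ star α v} t₁ ∧
        S.toFun '' Icc t₁ (t₁ + 2 * Q.length.real (star α v)) = star α v ∧
        S.toFun (t₁ + 2 * Q.length.real (star α v)) = S.toFun t₁ := by
  classical
  -- The arcs with the arms removed. The starting point belongs to this core, being outside the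
  -- closure of `E`.
  set lo : Q.Arc → ℝ := fun e => cutAt (Q := Q) α (tail e) with hlo
  set hi : Q.Arc → ℝ := fun e => Q.len e - cutAt (Q := Q) α (head e) with hhi
  obtain ⟨f₀, c, hc, hcx⟩ := exists_onArc_eq x₀
  have hcI : c ∈ Icc (lo f₀) (hi f₀) := by
    by_contra hcI
    obtain ⟨v, hv⟩ := mem_arm_of_not_mem_core hc hcI
    rw [hcx] at hv
    exact hx₀ (star_subset_closure hα h v (arm_subset_star α v hv))
  obtain ⟨f, hf, himg⟩ := exists_core_loop (lo := lo) (hi := hi)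
    (fun e => cutAt_nonneg hα _) (fun e => by linarith [cutAt_nonneg (Q := Q) hα (head e)])
    (fun e => by linarith [cutAt_tail_add_head_le (Q := Q) α e])
    (fun e he => cutAt_of_not_isLeaf he)
    (fun e he => by rw [hhi]; simp only [cutAt_of_not_isLeaf he, sub_zero]) hcI
  rw [hcx] at hf
  have hzig : ∀ v : Q.Leaf, ∃ C : ℝ → Q.Point, IsLoop C (2 * cut α v) (attach α v) ∧
      C '' Icc 0 (2 * cut α v) = arm v (cut α v) := by
    intro v
    -- With c = b the zigzag runs from the inner end of the arm to the leaf node and back.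
    have := exists_zigzag (γ := tip v) (a := 0) (b := cut α v) (c := cut α v)
      (fun s hs t ht => (dist_tip v ⟨hs.1, hs.2.trans (cut_le_len α v)⟩
        ⟨ht.1, ht.2.trans (cut_le_len α v)⟩).le) ⟨(cut_pos hα v).le, le_rfl⟩
    rwa [sub_zero] at this
  choose C hC hCA using hzig
  obtain ⟨g, hg, hgimg, hgk⟩ := hf.exists_first_arrival_insertions hC hCA himg
    (fun v => mem_iUnion.2 (attach_mem_core v))
    (fun v z hz hzA => by
      obtain ⟨e, he⟩ := mem_iUnion.1 hz
      exact eq_attach_of_mem_core hα he hzA)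
    (fun v v' hv => eq_attach_of_attach_mem_arm hα hv)
    (fun v v' z hz hz' => attach_eq_of_mem_arm hz hz') Finset.univ
  set L := ∑ e, 2 * (hi e - lo e) + ∑ v : Q.Leaf, 2 * cut α v with hL
  have hL2 : L = 2 * Q.totalLength := by
    rw [hL, ← Finset.mul_sum, ← Finset.mul_sum, ← sum_cutAt, ← mul_add, ← Finset.sum_add_distrib,
      totalLength_eq]
    congr 1
    refine Finset.sum_congr rfl fun e _ => ?_
    simp only [hlo, hhi]
    ring
  have hpos : 0 < L := by
    have := (Q.len_pos f₀).trans_le (len_le_totalLength f₀)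
    linarith
  obtain ⟨S, hSL, hS⟩ := exists_closedPath hg hpos
  have hStour : S.IsTour := by
    refine eq_univ_of_forall fun x => ?_
    have hx : x ∈ g '' Icc 0 L := by
      rw [hgimg]
      obtain ⟨e, t, ht, rfl⟩ := exists_onArc_eq x
      by_cases htc : t ∈ Icc (lo e) (hi e)
      · exact Or.inl (mem_iUnion.2 ⟨e, t, htc, rfl⟩)
      · obtain ⟨v, hv⟩ := mem_arm_of_not_mem_core ht htc
        exact Or.inr (mem_iUnion₂.2 ⟨v, Finset.mem_univ v, hv⟩)
    obtain ⟨s, hs, hgs⟩ := hx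
    exact ⟨s, (hS s hs).trans hgs⟩
  refine ⟨S, hStour, hSL.trans hL2, by rw [hS 0 ⟨le_rfl, hpos.le⟩, hg.left], fun v => ?_⟩
  obtain ⟨t₁, h1, h2, h3, h4, h5, h6⟩ := hgk v
  have hstar : insert (attach α v)
      (⋃ i ∈ Finset.univ.filter fun i : Q.Leaf => attach α i = attach α v, arm i (cut α i)) =
      star α v := by
    have : (⋃ i ∈ Finset.univ.filter fun i : Q.Leaf => attach α i = attach α v, arm i (cut α i)) =
        star α v := by
      ext z
      rw [mem_star]
      simp
    rw [this, insert_eq_of_mem (attach_mem_star hα v)]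
  have hlen : ∑ i : Q.Leaf with attach α i = attach α v, 2 * cut α i =
      2 * Q.length.real (star α v) := by
    rw [length_star hα, Finset.mul_sum]
  rw [hstar] at h3 h6
  rw [hlen] at h2 h5 h6
  have hnn : 0 ≤ Q.length.real (star α v) := measureReal_nonneg
  have hSg : ∀ t ∈ Icc t₁ (t₁ + 2 * Q.length.real (star α v)), S.toFun t = g t := fun t ht =>
    hS t ⟨h1.trans ht.1, ht.2.trans h2⟩
  have ht₁ : S.toFun t₁ = attach α v := by
    rw [hSg t₁ ⟨le_rfl, by linarith⟩, h4]
  refine ⟨t₁, ⟨⟨h1, ht₁ ▸ attach_mem_star hα v⟩, ?_⟩, ?_, ?_⟩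
  · rintro t ⟨ht0, htK⟩
    by_contra! htt
    refine h3 t ht0 htt ?_
    rwa [← hS t ⟨ht0, by linarith⟩]
  · exact (image_congr hSg).trans h6
  · rw [hSg _ ⟨by linarith, le_rfl⟩, h5, ht₁]

end

/-! ### Existence of the patrolling strategies -/

namespace ClosedPath

/-- A path that avoids the node `w` stays in one branch at `w`. -/
theorem mem_branch_of_isPreconnected (S : Q.ClosedPath) {w : V} {f : Q.Arc} (hf : w ∈ f.1)
    {I : Set ℝ} (hI : IsPreconnected I) (hw : ∀ t ∈ I, S.toFun t ≠ .node w) {a : ℝ} (ha : a ∈ I)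
    (hab : S.toFun a ∈ branch w f) {t : ℝ} (ht : t ∈ I) : S.toFun t ∈ branch w f := by
  have hsub : S.toFun '' I ⊆ branch w f := by
    refine IsPreconnected.subset_left_of_subset_union (isOpen_branch w f)
      (v := ⋃ (g : Q.Arc) (_ : w ∈ g.1 ∧ g ≠ f), branch w g)
      (isOpen_iUnion fun g => isOpen_iUnion fun _ => isOpen_branch w g) ?_ ?_
      ⟨_, ⟨a, ha, rfl⟩, hab⟩ (hI.image _ S.lipschitz.continuous.continuousOn)
    · simp only [disjoint_iUnion_right]
      exact fun g hg => disjoint_left.2 fun y hy hy' => hg.2 (branch_unique hg.1 hf hy' hy)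
    · rintro _ ⟨r, hr, rfl⟩
      obtain ⟨g, hg, hgb⟩ := exists_mem_branch (hw r hr)
      by_cases hgf : g = f
      · exact Or.inl (hgf ▸ hgb)
      · exact Or.inr (mem_iUnion₂.2 ⟨g, ⟨hg, hgf⟩, hgb⟩)
  exact hsub ⟨t, ht, rfl⟩

/-- After a visit to a node, a tour of length `2 μ` moves immediately into one branch. -/
theorem IsTour.exists_next_branch {S : Q.ClosedPath} (hS : S.IsTour)
    (hL : S.L = 2 * Q.totalLength) {w : V} {s₁ : ℝ} (h1 : S.toFun s₁ = .node w) :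
    ∃ f : Q.Arc, w ∈ f.1 ∧ ∃ q, s₁ < q ∧ q < s₁ + S.L ∧ ∀ t ∈ Ioc s₁ q, S.toFun t ∈ branch w f := by
  -- Otherwise the tour would rest at `w` for some time, but it spends time 2λ({w}) = 0 there. As
  -- there are finitely many arcs, one branch is visited at times arbitrarily close to `s₁`.
  have hfreq : ∃ f : Q.Arc, ∃ᶠ t in nhdsWithin s₁ (Ioi s₁), w ∈ f.1 ∧ S.toFun t ∈ branch w f := by
    by_contra! hno
    rw [← Filter.eventually_all] at hno
    have hw : ∀ᶠ t in nhdsWithin s₁ (Ioi s₁), S.toFun t = .node w := by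
      filter_upwards [hno] with t ht
      by_contra hne
      obtain ⟨f, hf, hb⟩ := exists_mem_branch hne
      exact ht f hf hb
    obtain ⟨b, hb, hsub⟩ := (mem_nhdsGT_iff_exists_Ioo_subset).1 hw
    have hb' : s₁ < b := hb
    have h2 := hS.volume_eq hL (measurableSet_singleton (Point.node w)) s₁
    rw [measure_singleton, mul_zero] at h2
    have h3 : Ioo s₁ (min b (s₁ + S.L)) ⊆
        S.toFun ⁻¹' {.node w} ∩ Ioc s₁ (s₁ + S.L) := fun t ht =>
      ⟨hsub ⟨ht.1, ht.2.trans_le (min_le_left _ _)⟩, ht.1, (ht.2.trans_le (min_le_right _ _)).le⟩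
    have h4 := measure_mono_null h3 h2
    rw [Real.volume_Ioo, ENNReal.ofReal_eq_zero] at h4
    have h5 : s₁ < min b (s₁ + S.L) := lt_min hb' (by linarith [S.L_pos])
    linarith
  obtain ⟨f, hfr⟩ := hfreq
  have hnear : ∀ q, s₁ < q → ∃ p ∈ Ioo s₁ q, w ∈ f.1 ∧ S.toFun p ∈ branch w f := by
    intro q hq
    obtain ⟨p, hp, hpI⟩ := (hfr.and_eventually (Ioo_mem_nhdsGT hq)).exists
    exact ⟨p, hpI, hp⟩
  obtain ⟨q, hq, hf, hqb⟩ := hnear (s₁ + S.L) (by linarith [S.L_pos])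
  refine ⟨f, hf, q, hq.1, hq.2, fun t ht => ?_⟩
  -- Such a visit before `t`, the visit at `q`, and the uniqueness of the excursion put all of (s₁,
  -- q] in the branch.
  obtain ⟨p, hp, -, hpb⟩ := hnear t ht.1
  exact ((hS.ordConnected_excursion hL (a := s₁) (h1 ▸ node_not_mem_branch w f)).out
    ⟨⟨hp.1, by linarith [hp.2, ht.2, hq.2]⟩, hpb⟩ ⟨hq, hqb⟩ ⟨hp.2.le, ht.2⟩).2

/-- A tour of length `2 μ` that covers a small component upon its first arrival returns to it. -/
theorem IsTour.exists_return {S : Q.ClosedPath} (hS : S.IsTour) (hL : S.L = 2 * Q.totalLength)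
    {K : Set Q.Point} (hK : IsClosed K) {w : V} (h0 : S.toFun 0 ∉ K) (hwK : Point.node w ∈ K)
    (hw : ∀ f : Q.Arc, w ∈ f.1 → Disjoint (branch w f) K ∨ branch w f ⊆ K)
    (hlen : ∀ f : Q.Arc, w ∈ f.1 → Q.length.real K < Q.length.real (branch w f)ᶜ)
    {t₁ s₁ : ℝ} (ht₁ : 0 ≤ t₁) (hfirst : ∀ t, 0 ≤ t → t < t₁ → S.toFun t ∉ K)
    (himg : S.toFun '' Icc t₁ s₁ = K) (hs₁ : S.toFun s₁ = .node w) (hs₁L : s₁ < S.L) :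
    ∃ τ, IsLeast {t | s₁ < t ∧ t ≤ S.L ∧ S.toFun t ∈ K} τ := by
  have hne : ∀ {t}, S.toFun t ∉ K → S.toFun t ≠ .node w := fun h h' => h (h' ▸ hwK)
  have hLK : S.toFun S.L ∉ K := S.apply_L.symm ▸ h0
  obtain ⟨f, hf, q, hsq, hqL, hqb⟩ := hS.exists_next_branch hL hs₁
  have hd : Disjoint (branch w f) K := by
    -- A branch inside `K` was already entered during the tour of `K`. By uniqueness its excursion
    -- would last through time `S.L`, when the tour is outside `K`.
    refine (hw f hf).resolve_right fun hfK => ?_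
    set p := min q S.L with hp
    have hpI : p ∈ Ioc s₁ q := ⟨lt_min hsq hs₁L, min_le_left _ _⟩
    have hpK := hfK (hqb p hpI)
    rw [← himg] at hpK
    obtain ⟨r, hr, hrp⟩ := hpK
    have hrb : S.toFun r ∈ branch w f := hrp ▸ hqb p hpI
    have hrs : r < s₁ := lt_of_le_of_ne hr.2 fun h' => by
      rw [h', hs₁] at hrb
      exact node_not_mem_branch w f hrb
    have := (hS.ordConnected_excursion hL (a := s₁) (hs₁ ▸ node_not_mem_branch w f)).out
      (⟨⟨hpI.1, by linarith [hpI.2]⟩, hqb p hpI⟩ :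
        p ∈ {t | t ∈ Ioo s₁ (s₁ + S.L) ∧ S.toFun t ∈ branch w f})
      (⟨⟨by linarith [hr.1], by linarith⟩, by rw [S.periodic]; exact hrb⟩ :
        r + S.L ∈ {t | t ∈ Ioo s₁ (s₁ + S.L) ∧ S.toFun t ∈ branch w f})
      (⟨min_le_right _ _, by linarith [hr.1]⟩ : S.L ∈ Icc p (r + S.L))
    exact hLK (hfK this.2)
  obtain ⟨t, hst, htL, htK⟩ : ∃ t, s₁ < t ∧ t ≤ S.L ∧ S.toFun t ∈ K := by
    -- Without a return, the tour stays in the branch `f` after `s₁`, and by periodicity also before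
    -- `t₁`. So `K` contains everything outside that branch, which is too long.
    by_contra! hno
    have hout : ∀ t ∈ Ioc s₁ S.L, S.toFun t ∈ branch w f := by
      intro t ht
      refine S.mem_branch_of_isPreconnected hf isPreconnected_Ioc
        (fun r hr => hne (hno r hr.1 hr.2)) (a := min q S.L) ⟨lt_min hsq hs₁L, min_le_right _ _⟩
        (hqb _ ⟨lt_min hsq hs₁L, min_le_left _ _⟩) ht
    have h0b : S.toFun 0 ∈ branch w f := by
      rw [← S.apply_L]
      exact hout _ ⟨hs₁L, le_rfl⟩
    have hcov : (branch w f)ᶜ ⊆ K := by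
      intro x hx
      obtain ⟨r, hr, hrx⟩ := hS.exists_time x 0
      rw [zero_add] at hr
      rcases le_or_gt r s₁ with h1 | h1
      · rcases lt_or_ge r t₁ with h2 | h2
        · refine absurd ?_ hx
          rw [← hrx]
          exact S.mem_branch_of_isPreconnected hf (isPreconnected_Ico (a := 0) (b := t₁))
            (fun r hr => hne (hfirst r hr.1 hr.2)) ⟨le_rfl, hr.1.trans_lt h2⟩ h0b ⟨hr.1, h2⟩
        · rw [← himg]
          exact ⟨r, ⟨h2, h1⟩, hrx⟩
      · exact absurd (hrx ▸ hout r ⟨h1, hr.2.le⟩) hx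
    exact absurd (measureReal_mono (μ := Q.length) hcov) (not_le.2 (hlen f hf))
  have hqK : ∀ r ∈ Ioc s₁ q, S.toFun r ∉ K := fun r hr => disjoint_left.1 hd (hqb r hr)
  have hqt : q < t := by
    by_contra! h
    exact hqK t ⟨hst, h⟩ htK
  -- The condition `s₁ < t` is not closed, but the tour avoids `K` on (s₁, q], so the minimum can be
  -- taken over [q, S.L].
  obtain ⟨τ, ⟨hτK, hτ⟩, hmin⟩ := (isCompact_Icc.inter_left
    (hK.preimage S.lipschitz.continuous)).exists_isLeast
    (⟨t, htK, hqt.le, htL⟩ : (S.toFun ⁻¹' K ∩ Icc q S.L).Nonempty)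
  refine ⟨τ, ⟨hsq.trans_le hτ.1, hτ.2, hτK⟩, ?_⟩
  rintro r ⟨hr1, hr2, hrK⟩
  rcases le_or_gt r q with h | h
  · exact absurd hrK (hqK r ⟨hr1, h⟩)
  · exact hmin ⟨hrK, h.le, hr2⟩

end ClosedPath

section

variable {α : ℝ}

theorem exists_isEExpansion (hα : 0 < α) (h : Q.LeafCondition α)
    (hE : closure (Q.extremitySet α) ≠ univ) : ∃ S T : Q.ClosedPath, IsEExpansion α S T := by
  obtain ⟨x₀, hx₀, hreg⟩ := exists_regular_mem_of_isOpen
    (isClosed_closure (s := Q.extremitySet α)).isOpen_compl (nonempty_compl.2 hE)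
  obtain ⟨S, hS, hL, hS0, hK⟩ := exists_tour_with_components hα h hx₀
  have h0E : S.toFun 0 ∉ closure (Q.extremitySet α) := hS0 ▸ hx₀
  have hLpos := S.L_pos
  have hex : ∀ K ∈ Q.closureComponents α, ∃ t₁ τ : ℝ,
      (IsLeast {t | 0 ≤ t ∧ S.toFun t ∈ K} t₁ ∧
      S.toFun '' Icc t₁ (t₁ + 2 * Q.length.real K) = K ∧
      S.toFun (t₁ + 2 * Q.length.real K) = S.toFun t₁ ∧
      (α / 2 ≤ Q.length.real K → τ = t₁ + 2 * Q.length.real K) ∧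
      (Q.length.real K < α / 2 →
        IsLeast {t | t₁ + 2 * Q.length.real K < t ∧ t ≤ S.L ∧ S.toFun t ∈ K} τ)) ∧
      0 ≤ τ ∧ τ < S.L ∧ 0 ≤ t₁ ∧ t₁ + 2 * Q.length.real K ≤ S.L ∧ S.toFun τ ∈ K ∧
        S.toFun τ = S.toFun t₁ := by
    intro K hKc
    rw [closureComponents_eq hα h] at hKc
    obtain ⟨v, rfl⟩ := hKc
    obtain ⟨t₁, hleast, himg, hend⟩ := hK v
    set K := star α v with hKdef
    have hnn : 0 ≤ Q.length.real K := measureReal_nonneg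
    have h0K : S.toFun 0 ∉ K := fun h' => h0E (star_subset_closure hα h v h')
    have ht₁L : t₁ ≤ S.L := by
      obtain ⟨t, ht, htx⟩ := hS.exists_time (attach α v) 0
      rw [zero_add] at ht
      exact (hleast.2 ⟨ht.1, htx ▸ attach_mem_star hα v⟩).trans ht.2.le
    have hs₁L : t₁ + 2 * Q.length.real K < S.L := by
      by_contra! hle
      have := mem_image_of_mem S.toFun (show S.L ∈ Icc t₁ (t₁ + 2 * Q.length.real K) from ⟨ht₁L, hle⟩)
      rw [himg, S.apply_L] at this
      exact h0K this
    have ht₁0 := hleast.1.1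
    rcases le_or_gt (α / 2) (Q.length.real K) with h5 | h5
    · exact ⟨t₁, t₁ + 2 * Q.length.real K, ⟨hleast, himg, hend, fun _ => rfl,
        fun h6 => absurd h6 (not_lt.2 h5)⟩, by linarith, hs₁L, ht₁0, hs₁L.le,
        hend ▸ hleast.1.2, hend⟩
    · obtain ⟨w, hwl, hvw, hw⟩ := exists_center_of_length_lt hα h h5
      have hw' : ∀ f : Q.Arc, w ∈ f.1 → Disjoint (branch w f) K ∨ branch w f ⊆ K :=
        fun f hf => (hw f hf).imp_left And.right
      have h6 : S.toFun t₁ = .node w :=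
        ClosedPath.arrival_eq (lt_of_le_of_ne ht₁0 fun h' => h0K (h' ▸ hleast.1.2)) hw'
          (fun r hr hrK => absurd (hleast.2 ⟨hr.1.le, hrK⟩) (not_le.2 hr.2)) hleast.1.2
      obtain ⟨τ, hτ⟩ := hS.exists_return hL (isClosed_star α v) h0K (hvw ▸ attach_mem_star hα v) hw'
        (fun f hf => h5.trans_le (half_le_length_compl_branch hα h hE hwl hf)) ht₁0
        (fun t ht0 htt htK => absurd (hleast.2 ⟨ht0, htK⟩) (not_le.2 htt)) himg (hend.trans h6) hs₁L
      -- The return, like the first arrival, takes place at `w`, so the loop C_K fits there.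
      have h7 : S.toFun τ = .node w := ClosedPath.arrival_eq hτ.1.1 hw'
        (fun r hr hrK => absurd (hτ.2 ⟨hr.1, by linarith [hr.2, hτ.1.2.1], hrK⟩)
          (not_le.2 hr.2)) hτ.1.2.2
      refine ⟨t₁, τ, ⟨hleast, himg, hend, fun h8 => absurd h5 (not_lt.2 h8), fun _ => hτ⟩, ?_, ?_,
        ht₁0, hs₁L.le, hτ.1.2.2, h7.trans h6.symm⟩
      · linarith [hτ.1.1]
      · exact lt_of_le_of_ne hτ.1.2.1 fun h' => h0K (S.apply_L ▸ h' ▸ hτ.1.2.2)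
  choose! t₁ τ hmain hτ0 hτL ht₁0 hs₁L hτK hτt using hex
  set ℓ : Set Q.Point → ℝ := fun K => 2 * Q.length.real K with hℓdef
  have hfin := finite_closureComponents hα h
  have hFm : ∀ {K}, K ∈ hfin.toFinset ↔ K ∈ Q.closureComponents α := by simp
  have hℓ0 : ∀ K, 0 ≤ ℓ K := fun K => mul_nonneg zero_le_two measureReal_nonneg
  have hdist : ∀ s t, s ≤ t → dist (S.toFun s) (S.toFun t) ≤ t - s := fun s t hst => by
    have := S.lipschitz.dist_le_mul s t
    rwa [NNReal.coe_one, one_mul, dist_comm s, Real.dist_eq,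
      abs_of_nonneg (sub_nonneg.2 hst)] at this
  have hloop : IsLoop S.toFun S.L (S.toFun 0) :=
    ⟨hLpos.le, rfl, S.apply_L, fun s t _ hst _ => hdist s t hst⟩
  have hCloop : ∀ K ∈ hfin.toFinset,
      IsLoop (fun s => S.toFun (t₁ K + s)) (ℓ K) (S.toFun (τ K)) := by
    intro K hKF
    have hKc := hFm.1 hKF
    refine ⟨hℓ0 K, by rw [add_zero, hτt K hKc], by rw [hτt K hKc, ← (hmain K hKc).2.2.1],
      fun s t _ hst _ => (hdist _ _ (by linarith)).trans_eq (by ring)⟩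
  -- `S` is in `K` at the time `τ K`, and different components are disjoint.
  have hinj : InjOn τ hfin.toFinset := by
    intro K hKF K' hKF' heq
    have hKc := hFm.1 hKF
    have hKc' := hFm.1 hKF'
    have h1 := hτK K hKc
    have h2 := hτK K' hKc'
    rw [heq] at h1
    rw [closureComponents_eq hα h] at hKc hKc'
    obtain ⟨v, rfl⟩ := hKc
    obtain ⟨v', rfl⟩ := hKc'
    exact star_congr (attach_eq_of_mem_star h1 h2)
  obtain ⟨g, hg, hgS, hgC⟩ := hloop.exists_insertions hfin.toFinset
    (fun K hKF => ⟨hτ0 K (hFm.1 hKF), hτL K (hFm.1 hKF)⟩) hinj hCloop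
  have hℓF : ∀ K ∈ hfin.toFinset, 0 ≤ ℓ K := fun K _ => hℓ0 K
  have hpos : 0 < stretch hfin.toFinset τ ℓ S.L := hLpos.trans_le (le_stretch hℓF _)
  obtain ⟨T, hTL, hT⟩ := exists_closedPath hg hpos
  refine ⟨S, T, hS.isCPT hL, hS0 ▸ hreg, h0E, t₁, τ, hmain, stretch hfin.toFinset τ ℓ,
    fun t => (finsum_eq_stretch _ hfin t).symm, hTL, fun t ht => ?_, fun K hKc s hs => ?_⟩
  · rw [hT _ ⟨ht.1.trans (le_stretch hℓF t), ?_⟩, hgS t ht]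
    have := sub_le_stretch_sub (τ := τ) hℓF ht.2
    linarith [ht.2]
  · have h1 := stretch_add_le hℓF (hFm.2 hKc) (hτL K hKc)
    rw [hT _ ⟨?_, ?_⟩, hgC K (hFm.2 hKc) s hs]
    · have := le_stretch (τ := τ) hℓF (τ K)
      linarith [hτ0 K hKc, hs.1]
    · have h2 : s ≤ ℓ K := hs.2
      linarith

theorem exists_isEPatrollingTour (hα : 0 < α) (h : Q.LeafCondition α) :
    ∃ T : Q.ClosedPath, IsEPatrollingTour α T := by
  by_cases hE : closure (Q.extremitySet α) = univ
  · obtain ⟨S, hS, hL⟩ := exists_tour Q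
    exact ⟨S, fun _ => hS.isCPT hL, fun h' => absurd hE h'⟩
  · obtain ⟨S, T, hST⟩ := exists_isEExpansion hα h hE
    exact ⟨T, fun h' => absurd h' hE, fun _ => ⟨S, hST⟩⟩

end

end TreeNetwork

/-! ### The theorem: the two guarantees coincide. -/

theorem mainTheorem1 {V : Type*} [Fintype V] (Q : TreeNetwork V) (α : ℝ)
    (hα : 0 < α) (hα' : α < 2 * Q.totalLength) (hleaf : Q.LeafCondition α) :
    (∃ σ, Q.IsEPatrollingStrategy α σ) ∧
    (∀ σ, Q.IsEPatrollingStrategy α σ → TreeNetwork.PatrollerOptimal α σ) ∧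
    TreeNetwork.AttackerOptimal α (Q.eAttack α) ∧
    Q.IsValue α (α / (Q.totalLength + Q.length.real (Q.extremitySet α))) := by
  obtain ⟨T, hT⟩ := TreeNetwork.exists_isEPatrollingTour hα hleaf
  have := TreeNetwork.isProbabilityMeasure_eAttack hα hα' hleaf
  have hatt := TreeNetwork.attackGuarantee_le hα.le
    (TreeNetwork.eAttack_intercepts_le hα hα' hleaf)
  have hpat := hT.le_patrolGuarantee hα hα' hleaf (TreeNetwork.exists_tour Q)
  refine ⟨⟨_, T, hT, rfl⟩, ?_, TreeNetwork.attackerOptimal_of_le hpat hatt,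
    TreeNetwork.isValue_of_le hpat hatt⟩
  rintro σ ⟨T', hT', rfl⟩
  exact TreeNetwork.patrollerOptimal_of_le
    (hT'.le_patrolGuarantee hα hα' hleaf (TreeNetwork.exists_tour Q)) hatt
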